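/- Theorem. Throughout, $n\ge 3$, $G_0=GL^+(2,\mathbb R)\times SO(n)$, $\tilde G_0=GL^+(2,\mathbb R)\times Spin(n)$ and $G_0^c=GL^+(2,\mathbb R)\times Spin^c(n)$ with $Spin^c(n)=(U(1)\times Spin(n))/\{\pm(1,1)\}$. There are homomorphisms $G_0^c\to G_0$, $(A,\langle z,a\rangle)\mapsto(A,\rho_n(a))$, where $\rho_n:Spin(n)\to SO(n)$ is the double covering, and $G_0^c\to U(1)$, $(A,\langle z,a\rangle)\mapsto z^2$, and the kernel of the latter is $\tilde G_0$. Let $\mathfrak g_-=\mathfrak g_{-2}\oplus\mathfrak g_{-1}$ with $\mathfrak g_{-1}=M_{n\times 2}(\mathbb R)$, $\mathfrak g_{-2}$ the skew-symmetric $2\times2$ matrices and bracket $[X,X']=X'^TX-X^TX'$ on $\mathfrak g_{-1}$; it is the negative part of the contact grading of $\mathfrak{so}(2,n+2)$, and $(A,B)\in G_0$ acts on it by $X\mapsto BXA^{-1}$, $Y\mapsto (A^{-1})^TYA^{-1}$. Let $(\mathcal G_0,M,p_0,\theta)$ be a PCS-structure of Grassmannian type (of positive definite signature) on a connected manifold $M$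 of dimension $2n$: a $G_0$-principal bundle $p_0:\mathcal G_0\to M$ with a $G_0$-equivariant, strictly horizontal soldering form $\theta\in\Omega^1(\mathcal G_0,\mathfrak g_{-1})$, such that the line bundle $\ell\subset\Lambda^2T^*M$ that corresponds to the bracket $\Lambda^2\mathfrak g_{-1}\to\mathfrak g_{-2}\cong\mathbb R$ locally admits nowhere zero closed sections. Let $p_0^c:\mathcal G_0^c\to M$ be a $G_0^c$-principal bundle with a lift $t:\mathcal G_0^c\to\mathcal G_0$, i.e. a smooth map over $\mathrm{id}_M$ that is equivariant over $G_0^c\to G_0$. Let $q:M^\sharp=\mathcal G_0^c\times_{G_0^c}U(1)\to M$ be the determinant circle bundle. Suppose that it admits a compatible principal connection $i\alpha$, i.e. $d\alpha=q^*\Omega$ for a global closed section $\Omega$ of $\ell$ (equivalently, a section that is parallel for the canonical connection of the PCS-structure), and that its real Chern class $c_1(M^\sharp)=-\frac1{2\pi}[\Omega]\in H^2(M,\mathbb R)$ is non-zero. (1) Then $\alpha\in\Omega^1(M^\sharp)$ is a contact form. Put $H=\ker\alpha$ and let $\xi$ be the Reeb field of $\alpha$. A Lie contact structure of type $(G,P)$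 on $(M^\sharp,H)$ is a $G_0$-principal bundle $\mathcal G_0^\sharp\to M^\sharp$ with a reduction $\mathcal G_0^\sharp\to\mathcal G^\sharp$ over $G_0\to\mathrm{Aut}_{gr}(\mathfrak g_-)$ to the natural frame bundle $\mathcal G^\sharp$ of graded Lie algebra isomorphisms $\mathfrak g_-\to(T_xM^\sharp/H_x\oplus H_x,\text{Levi bracket})$; let $\theta^\sharp=(\theta^\sharp_{-2},\theta^\sharp_{-1})$ be the pulled back tautological forms, where $\theta^\sharp_{-1}$ is defined on the preimage $T^{-1}\mathcal G_0^\sharp$ of $H$. A Lie contact structure of type $(\tilde G,\tilde P)$ is in addition a $\tilde G_0$-principal bundle with a smooth map to $\mathcal G_0^\sharp$ over $\mathrm{id}_{M^\sharp}$ that is equivariant over $\tilde G_0\to G_0$. A vector field is an infinitesimal symmetry if it has an equivariant lift to the total space that preserves the tautological forms, and it is transversal if it is nowhere tangent to $H$. A PCS-quotient by a transversal infinitesimal symmetry $\xi$ with lift $\xi_0$ is a surjective morphism $q_0:\mathcal G_0^\sharp\to\mathcal G_0$ of $G_0$-principal bundles with connected fibers, with $\ker Tq_0$ spanned by $\xi_0$,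 and with $q_0^*\theta=\theta^\sharp_{-1}$ on $T^{-1}\mathcal G_0^\sharp$. (2) There is a Lie contact structure of type $(\tilde G,\tilde P)$ on $(M^\sharp,H)$ such that - $\mathcal G_0^c\to M^\sharp$ (the canonical projection, with the restricted action of $\tilde G_0\subset G_0^c$) is the underlying $\tilde G_0$-principal bundle; - $\xi$ is a transversal infinitesimal symmetry; - there is a PCS-quotient $q_0:\mathcal G^\sharp_0\to\mathcal G_0$ by $\xi$ which covers $q$, where $\mathcal G_0^\sharp\to M^\sharp$ is the $G_0$-principal bundle of the underlying Lie contact structure of type $(G,P)$, and the given lift $t$ is the composition $\mathcal G_0^c\to\mathcal G_0^\sharp\xrightarrow{q_0}\mathcal G_0$. It is unique: for any other such structure, with $G_0$-bundle $\mathcal G_0^{\sharp\prime}$, there is a unique isomorphism $\mathcal G_0^\sharp\to\mathcal G_0^{\sharp\prime}$ of Lie contact structures of type $(G,P)$ that is compatible with the maps from $\mathcal G_0^c$. Moreover, the underlying structure of type $(G,P)$ is already determined by the PCS-quotient: any Lie contact structure of type $(G,P)$ on $(M^\sharp,H)$ with a PCS-quotient $q_0'$ by $\xi$ onto $(\mathcal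 G_0,M,p_0,\theta)$ which covers $q$ is isomorphic to it by a unique isomorphism $f$ with $q_0'\circ f=q_0$. -/

import Mathlib

open scoped Manifold ContDiff Matrix TensorProduct

universe w

noncomputable section

/-- The negative definite form `v ↦ -|v|²` on `ℝⁿ`. -/
abbrev negSq (n : ℕ) : QuadraticForm ℝ (Fin n → ℝ) :=
  QuadraticMap.weightedSumSquares ℝ (fun _ : Fin n => (-1 : ℝ))

/-- The real Clifford algebra of `ℝⁿ`, with `v² = -|v|²`. -/
abbrev Cl (n : ℕ) : Type := CliffordAlgebra (negSq n)

/-- The inclusion `ℝⁿ → Cl(n)`. -/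
abbrev clVec (n : ℕ) : (Fin n → ℝ) →ₗ[ℝ] Cl n := CliffordAlgebra.ι (negSq n)

/-- The group `Spin(n)`. -/
abbrev Spin (n : ℕ) : Type := spinGroup (negSq n)

/-- The group `SO(n)`. -/
abbrev SOrth (n : ℕ) : Type := Matrix.specialOrthogonalGroup (Fin n) ℝ

theorem negSq_apply {n : ℕ} (v : Fin n → ℝ) : negSq n v = -(v ⬝ᵥ v) := by
  simp [negSq, QuadraticMap.weightedSumSquares_apply, dotProduct]

theorem negSq_polar {n : ℕ} (v w : Fin n → ℝ) :
    QuadraticMap.polar (negSq n) v w = -(2 * (v ⬝ᵥ w)) := by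
  simp only [QuadraticMap.polar, negSq_apply, add_dotProduct, dotProduct_add]
  rw [dotProduct_comm w v]; ring

theorem clVec_injective (n : ℕ) : Function.Injective (clVec n) := by
  rw [← LinearMap.ker_eq_bot, LinearMap.ker_eq_bot']
  intro v hv
  have h := CliffordAlgebra.ι_sq_scalar (negSq n) v
  rw [hv, mul_zero] at h
  have h2 : negSq n v = 0 := by
    have := (algebraMap ℝ (Cl n)).injective
    apply this; rw [← h, map_zero]
  rw [negSq_apply, neg_eq_zero] at h2
  exact dotProduct_self_eq_zero.mp h2

/-- `B` is the orthogonal matrix by which `x` acts on vectors through the twisted conjugation,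
and `det B` is the parity of `x`. -/
def TwistedAct {n : ℕ} (x : Cl n) (B : Matrix (Fin n) (Fin n) ℝ) : Prop :=
  B ∈ Matrix.orthogonalGroup (Fin n) ℝ ∧
    (∀ v, CliffordAlgebra.involute x * clVec n v = clVec n (B *ᵥ v) * x) ∧
    CliffordAlgebra.involute x = B.det • x

theorem twistedAct_vec {n : ℕ} (w : Fin n → ℝ) (hw : w ⬝ᵥ w ≠ 0) :
    TwistedAct (clVec n w) (1 + Matrix.replicateCol Unit ((-2 / (w ⬝ᵥ w)) • w) *
      Matrix.replicateRow Unit w) := by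
  have hdet : (1 + Matrix.replicateCol Unit ((-2 / (w ⬝ᵥ w)) • w) *
      Matrix.replicateRow Unit w).det = -1 := by
    rw [Matrix.det_one_add_replicateCol_mul_replicateRow, dotProduct_smul, smul_eq_mul,
      div_mul_cancel₀ _ hw]
    norm_num
  have hact : ∀ v, (1 + Matrix.replicateCol Unit ((-2 / (w ⬝ᵥ w)) • w) *
      Matrix.replicateRow Unit w) *ᵥ v = v + ((-2 / (w ⬝ᵥ w)) * (w ⬝ᵥ v)) • w := by
    intro v
    rw [Matrix.add_mulVec, Matrix.one_mulVec, ← Matrix.mulVec_mulVec]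
    congr 1
    ext i
    simp [Matrix.mulVec, dotProduct, mul_comm, mul_assoc]
  refine ⟨?_, ?_, ?_⟩
  · rw [Matrix.mem_orthogonalGroup_iff]
    have hT : (1 + Matrix.replicateCol Unit ((-2 / (w ⬝ᵥ w)) • w) *
      Matrix.replicateRow Unit w)ᵀ = 1 + Matrix.replicateCol Unit ((-2 / (w ⬝ᵥ w)) • w) *
      Matrix.replicateRow Unit w := by
      ext i j
      simp [Matrix.mul_apply, Matrix.one_apply, eq_comm, mul_comm]
    rw [hT]
    apply Matrix.toLin'.injective
    apply LinearMap.ext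
    intro v
    rw [Matrix.toLin'_mul, LinearMap.comp_apply, Matrix.toLin'_apply, Matrix.toLin'_apply, hact,
      hact, Matrix.toLin'_one, LinearMap.id_apply, dotProduct_add, dotProduct_smul, smul_eq_mul,
      add_assoc, ← add_smul]
    convert add_zero v using 2
    convert zero_smul ℝ w
    field_simp
    ring
  · intro v
    rw [CliffordAlgebra.involute_ι, hact, map_add, map_smul, add_mul, smul_mul_assoc,
      CliffordAlgebra.ι_sq_scalar, negSq_apply, neg_mul, eq_comm, ← sub_eq_zero, sub_neg_eq_add,
      add_right_comm, CliffordAlgebra.ι_mul_ι_add_swap, negSq_polar, Algebra.smul_def, ← map_mul,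
      ← map_add]
    convert map_zero (algebraMap ℝ (Cl n))
    rw [dotProduct_comm v w]
    field_simp
    ring
  · rw [CliffordAlgebra.involute_ι, hdet, neg_one_smul]

theorem TwistedAct.mul {n : ℕ} {x y : Cl n} {B C : Matrix (Fin n) (Fin n) ℝ}
    (hx : TwistedAct x B) (hy : TwistedAct y C) : TwistedAct (x * y) (B * C) := by
  refine ⟨mul_mem hx.1 hy.1, fun v => ?_, ?_⟩
  · rw [map_mul, mul_assoc, hy.2.1, ← mul_assoc, hx.2.1, Matrix.mulVec_mulVec, mul_assoc]
  · rw [map_mul, hx.2.2, hy.2.2, Matrix.det_mul, smul_mul_smul_comm]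

theorem exists_twistedAct {n : ℕ} (x : (Cl n)ˣ) (hx : x ∈ lipschitzGroup (negSq n)) :
    ∃ B, TwistedAct (x : Cl n) B := by
  induction hx using Subgroup.closure_induction with
  | mem x hx =>
    obtain ⟨w, hw⟩ := hx
    rw [← hw]
    refine ⟨_, twistedAct_vec w fun h0 => ?_⟩
    have h1 := CliffordAlgebra.ι_sq_scalar (negSq n) w
    rw [negSq_apply, h0, neg_zero, map_zero, hw] at h1
    have h2 : ((x * x : (Cl n)ˣ) : Cl n) = 0 := by
      rw [Units.val_mul]
      exact h1
    exact (x * x).ne_zero h2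
  | one => exact ⟨1, one_mem _, by simp, by simp⟩
  | mul x y _ _ hx hy =>
    obtain ⟨B, hB⟩ := hx
    obtain ⟨C, hC⟩ := hy
    exact ⟨B * C, by simpa using hB.mul hC⟩
  | inv x _ hx =>
    obtain ⟨B, hB, h1, h2⟩ := hx
    have hBs : B * star B = 1 := (Matrix.mem_orthogonalGroup_iff _ _).1 hB
    have hsB : star B * B = 1 := (Matrix.mem_orthogonalGroup_iff' _ _).1 hB
    have hd : (star B).det * B.det = 1 := by rw [← Matrix.det_mul, hsB, Matrix.det_one]
    have hi : CliffordAlgebra.involute ((x⁻¹ : (Cl n)ˣ) : Cl n) *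
        CliffordAlgebra.involute (x : Cl n) = 1 := by rw [← map_mul]; simp
    refine ⟨star B, Unitary.star_mem hB, fun v => ?_, ?_⟩
    · have h3 := h1 (star B *ᵥ v)
      rw [Matrix.mulVec_mulVec, hBs, Matrix.one_mulVec] at h3
      calc _ = CliffordAlgebra.involute ((x⁻¹ : (Cl n)ˣ) : Cl n) *
            (clVec n v * x) * ((x⁻¹ : (Cl n)ˣ) : Cl n) := by simp [mul_assoc]
        _ = _ := by rw [← h3, ← mul_assoc, hi, one_mul]
    · calc _ = CliffordAlgebra.involute ((x⁻¹ : (Cl n)ˣ) : Cl n) *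
            (((star B).det * B.det) • (x : Cl n)) * ((x⁻¹ : (Cl n)ˣ) : Cl n) := by
              rw [hd]; simp [mul_assoc]
        _ = _ := by
              rw [mul_smul, ← h2, mul_smul_comm, hi, smul_mul_assoc, one_mul]

theorem exists_rho {n : ℕ} (a : Spin n) :
    ∃ B : SOrth n, ∀ v, (a : Cl n) * clVec n v = clVec n ((B : Matrix _ _ ℝ) *ᵥ v) * (a : Cl n) := by
  obtain ⟨B, hB, h1, h2⟩ := exists_twistedAct (spinGroup.toUnits a)
    (spinGroup.units_mem_lipschitzGroup a.2)
  change CliffordAlgebra.involute (a : Cl n) = B.det • (a : Cl n) at h2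
  change ∀ v, CliffordAlgebra.involute (a : Cl n) * clVec n v = clVec n (B *ᵥ v) * (a : Cl n) at h1
  rw [spinGroup.involute_eq a.2] at h1 h2
  refine ⟨⟨B, Matrix.mem_specialOrthogonalGroup_iff.2 ⟨hB, ?_⟩⟩, h1⟩
  have h3 : (1 : ℝ) • (1 : Cl n) = B.det • (1 : Cl n) := by
    have := congrArg (· * (star a.1)) h2
    simpa [smul_mul_assoc, spinGroup.mul_star_self_of_mem a.2] using this
  rw [← Algebra.algebraMap_eq_smul_one, ← Algebra.algebraMap_eq_smul_one] at h3
  exact ((algebraMap ℝ (Cl n)).injective h3).symm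

theorem rho_unique {n : ℕ} (a : Spin n) {B C : SOrth n}
    (hB : ∀ v, (a : Cl n) * clVec n v = clVec n ((B : Matrix _ _ ℝ) *ᵥ v) * (a : Cl n))
    (hC : ∀ v, (a : Cl n) * clVec n v = clVec n ((C : Matrix _ _ ℝ) *ᵥ v) * (a : Cl n)) :
    B = C := by
  apply Subtype.ext
  apply Matrix.toLin'.injective
  apply LinearMap.ext
  intro v
  apply clVec_injective n
  have h := (hB v).symm.trans (hC v)
  have := congrArg (· * (star a.1)) h
  simpa [mul_assoc, spinGroup.mul_star_self_of_mem a.2] using this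

/-- The covering `ρₙ : Spin(n) → SO(n)`; `ρₙ(a) v = a v a⁻¹` for `v ∈ ℝⁿ ⊂ Cl(n)`. -/
def spinRho (n : ℕ) : Spin n →* SOrth n where
  toFun a := (exists_rho a).choose
  map_one' := rho_unique 1 (exists_rho 1).choose_spec (fun v => by
    rw [OneMemClass.coe_one, OneMemClass.coe_one, Matrix.one_mulVec, one_mul, mul_one])
  map_mul' a b := rho_unique (a * b) (exists_rho (a * b)).choose_spec (by
    intro v
    rw [Submonoid.coe_mul, Submonoid.coe_mul, mul_assoc, (exists_rho b).choose_spec v, ← mul_assoc,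
      (exists_rho a).choose_spec, Matrix.mulVec_mulVec, mul_assoc])

theorem spinRho_spec {n : ℕ} (a : Spin n) (v : Fin n → ℝ) :
    (a : Cl n) * clVec n v = clVec n ((spinRho n a : Matrix _ _ ℝ) *ᵥ v) * (a : Cl n) :=
  (exists_rho a).choose_spec v

/-- The subgroup `{±(1, 1)}` of `U(1) × Spin(n)`. -/
def spinCKernel (n : ℕ) : Subgroup (Circle × Spin n) where
  carrier := {p | ((p.1 : ℂ) = 1 ∧ (p.2 : Cl n) = 1) ∨ ((p.1 : ℂ) = -1 ∧ (p.2 : Cl n) = -1)}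
  one_mem' := by simp
  mul_mem' := by
    rintro p q (⟨h1, h2⟩ | ⟨h1, h2⟩) (⟨h3, h4⟩ | ⟨h3, h4⟩) <;>
    simp only [Set.mem_ofPred_eq, Prod.fst_mul, Prod.snd_mul, Circle.coe_mul, Submonoid.coe_mul, h1,
      h2, h3, h4, mul_one, mul_neg, neg_neg, and_self, true_or, or_true]
  inv_mem' := by
    rintro p (⟨h1, h2⟩ | ⟨h1, h2⟩)
    · left
      refine ⟨by simp [h1], ?_⟩
      rw [Prod.snd_inv, ← spinGroup.star_eq_inv, spinGroup.coe_star, h2, star_one]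
    · right
      refine ⟨by simp [h1, inv_neg], ?_⟩
      rw [Prod.snd_inv, ← spinGroup.star_eq_inv, spinGroup.coe_star, h2, star_neg, star_one]

instance (n : ℕ) : (spinCKernel n).Normal where
  conj_mem := by
    rintro p hp g
    have : g * p * g⁻¹ = p := by
      rw [mul_inv_eq_iff_eq_mul]
      rcases hp with ⟨h1, h2⟩ | ⟨h1, h2⟩ <;>
      · refine Prod.ext (mul_comm _ _) (Subtype.ext ?_)
        simp [h2]
    rwa [this]

/-- The group `Spinᶜ(n) = (U(1) × Spin(n)) / {±(1, 1)}`. -/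
abbrev SpinC (n : ℕ) : Type := (Circle × Spin n) ⧸ spinCKernel n

/-- `ρₙᶜ : Spinᶜ(n) → SO(n)`, `⟨z, a⟩ ↦ ρₙ(a)`. -/
def spinCRho (n : ℕ) : SpinC n →* SOrth n :=
  QuotientGroup.lift (spinCKernel n) ((spinRho n).comp (MonoidHom.snd _ _)) (by
    rintro ⟨z, a⟩ hp
    rw [MonoidHom.mem_ker]
    change spinRho n a = 1
    refine rho_unique a (spinRho_spec a) fun v => ?_
    rcases hp with ⟨_, h2⟩ | ⟨_, h2⟩ <;>
    · change (a : Cl n) = _ at h2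
      simp [h2])

/-- `ςₙ : Spinᶜ(n) → U(1)`, `⟨z, a⟩ ↦ z²`. -/
def spinCDet (n : ℕ) : SpinC n →* Circle :=
  QuotientGroup.lift (spinCKernel n) ((powMonoidHom 2).comp (MonoidHom.fst _ _)) (by
    rintro ⟨z, a⟩ hp
    rw [MonoidHom.mem_ker]
    apply Circle.ext
    change ((z ^ 2 : Circle) : ℂ) = 1
    rcases hp with ⟨h1, _⟩ | ⟨h1, _⟩ <;>
    · change (z : ℂ) = _ at h1
      simp [h1])

/-- The faithful linear realization `Spinᶜ(n) → ℂ ⊗ Cl(n)`, `⟨z, a⟩ ↦ z ⊗ a`. -/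
def spinCToAlgebra (n : ℕ) : SpinC n →* ℂ ⊗[ℝ] Cl n :=
  QuotientGroup.lift (spinCKernel n)
    { toFun := fun p => (p.1 : ℂ) ⊗ₜ[ℝ] (p.2 : Cl n)
      map_one' := rfl
      map_mul' := fun p q => by simp [Algebra.TensorProduct.tmul_mul_tmul] } (by
    rintro ⟨z, a⟩ hp
    rw [MonoidHom.mem_ker]
    change (z : ℂ) ⊗ₜ[ℝ] (a : Cl n) = 1
    rw [Algebra.TensorProduct.one_def]
    rcases hp with ⟨h1, h2⟩ | ⟨h1, h2⟩ <;>
    · change (z : ℂ) = _ at h1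
      change (a : Cl n) = _ at h2
      simp [h1, h2, TensorProduct.neg_tmul, TensorProduct.tmul_neg])

/-- The inclusion `Spin(n) → Spinᶜ(n)`, `a ↦ ⟨1, a⟩`. -/
def spinToSpinC (n : ℕ) : Spin n →* SpinC n :=
  (QuotientGroup.mk' (spinCKernel n)).comp (MonoidHom.inr _ _)

/-! ### The structure groups and smoothness -/

/-- The group `GL⁺(2, ℝ)`. -/
abbrev GLTwoPos : Type := Matrix.GLPos (Fin 2) ℝ

/-- The matrix of an element of `GL⁺(2, ℝ)`. -/
def glMat (A : GLTwoPos) : Matrix (Fin 2) (Fin 2) ℝ := ((A : GL (Fin 2) ℝ) : Matrix _ _ ℝ)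

/-- `G₀ = GL⁺(2, ℝ) × SO(n)`. -/
abbrev GZero (n : ℕ) : Type := GLTwoPos × SOrth n

/-- `G̃₀ = GL⁺(2, ℝ) × Spin(n)`. -/
abbrev GZeroSpin (n : ℕ) : Type := GLTwoPos × Spin n

/-- `G₀ᶜ = GL⁺(2, ℝ) × Spinᶜ(n)`. -/
abbrev GZeroC (n : ℕ) : Type := GLTwoPos × SpinC n

/-- The covering `G̃₀ → G₀`. -/
def gSpinToG (n : ℕ) : GZeroSpin n →* GZero n := (MonoidHom.id _).prodMap (spinRho n)

/-- The homomorphism `G₀ᶜ → G₀`. -/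
def gCToG (n : ℕ) : GZeroC n →* GZero n := (MonoidHom.id _).prodMap (spinCRho n)

/-- The inclusion `G̃₀ → G₀ᶜ`. -/
def gSpinToGC (n : ℕ) : GZeroSpin n →* GZeroC n := (MonoidHom.id _).prodMap (spinToSpinC n)

/-- The homomorphism `G₀ᶜ → Spinᶜ(n) → U(1)`. -/
def gCDet (n : ℕ) : GZeroC n →* Circle := (spinCDet n).comp (MonoidHom.snd _ _)

/-- The Lie groups that occur here are embedded submanifolds of finite-dimensional real vector
spaces; this class records the restrictions to the group of linear functions (or enough of them)
on the ambient space. They determine the smooth structure of the group. -/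
class EmbeddedGroup (G : Type) where
  coords : Set (G → ℝ)

/-- `GL⁺(2, ℝ)` as an open subset of `M₂(ℝ)`. -/
instance : EmbeddedGroup GLTwoPos := ⟨{f | ∃ i j, f = fun A => glMat A i j}⟩

/-- `SO(n)` inside `Mₙ(ℝ)`. -/
instance (n : ℕ) : EmbeddedGroup (SOrth n) := ⟨{f | ∃ i j, f = fun B => B.1 i j}⟩

/-- `U(1)` inside `ℂ`. -/
instance : EmbeddedGroup Circle := ⟨{fun z : Circle => (z : ℂ).re, fun z : Circle => (z : ℂ).im}⟩

/-- `Spin(n)` inside `Cl(n)`. -/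
instance (n : ℕ) : EmbeddedGroup (Spin n) :=
  ⟨{f | ∃ l : Cl n →ₗ[ℝ] ℝ, f = fun a : Spin n => l (a : Cl n)}⟩

/-- `Spinᶜ(n)` inside `ℂ ⊗ Cl(n)`. -/
instance (n : ℕ) : EmbeddedGroup (SpinC n) :=
  ⟨{f | ∃ l : ℂ ⊗[ℝ] Cl n →ₗ[ℝ] ℝ, f = fun a => l (spinCToAlgebra n a)}⟩

instance (G K : Type) [EmbeddedGroup G] [EmbeddedGroup K] : EmbeddedGroup (G × K) :=
  ⟨{f | (∃ c ∈ EmbeddedGroup.coords (G := G), f = fun p => c p.1) ∨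
    ∃ c ∈ EmbeddedGroup.coords (G := K), f = fun p => c p.2}⟩

/-- `f` is smooth on `s` as a map from a manifold into an embedded group: its linear coordinates
are smooth. -/
def SmoothInto (d : ℕ) {N : Type*} [TopologicalSpace N] [ChartedSpace (EuclideanSpace ℝ (Fin d)) N]
    {G : Type} [EmbeddedGroup G] (f : N → G) (s : Set N) : Prop :=
  ∀ c ∈ EmbeddedGroup.coords (G := G), ContMDiffOn (𝓡 d) 𝓘(ℝ, ℝ) ∞ (fun x => c (f x)) s

/-! ### Vector fields and differential forms -/

section Manifold

variable {d : ℕ} {M : Type*} [TopologicalSpace M] [ChartedSpace (EuclideanSpace ℝ (Fin d)) M]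

variable (d M) in
/-- Vector fields (not necessarily smooth). -/
abbrev VField : Type _ := ∀ x : M, TangentSpace (𝓡 d) x

variable (d M) in
/-- Differential forms of degree `k` (not necessarily smooth). -/
abbrev DForm (k : ℕ) : Type _ := ∀ x : M, (TangentSpace (𝓡 d) x) [⋀^Fin k]→L[ℝ] ℝ

variable (d M) in
/-- Forms of degree one, as fields of linear functionals (not necessarily smooth). -/
abbrev OneForm : Type _ := ∀ x : M, TangentSpace (𝓡 d) x →L[ℝ] ℝ

/-- The vector field `ξ` is smooth on `s`. -/
def SmoothVFieldOn [IsManifold (𝓡 d) ∞ M] (ξ : VField d M) (s : Set M) : Prop :=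
  ContMDiffOn (𝓡 d) (𝓡 d).tangent ∞ (fun x => (⟨x, ξ x⟩ : TangentBundle (𝓡 d) M)) s

/-- The local expression of a form in the chart at `x₀`: its pullback by the inverse chart. -/
def formInChart {k : ℕ} (η : DForm d M k) (x₀ : M) :
    EuclideanSpace ℝ (Fin d) → (EuclideanSpace ℝ (Fin d)) [⋀^Fin k]→L[ℝ] ℝ := fun y =>
  (η ((extChartAt (𝓡 d) x₀).symm y)).compContinuousLinearMap
    (mfderiv 𝓘(ℝ, EuclideanSpace ℝ (Fin d)) (𝓡 d) (extChartAt (𝓡 d) x₀).symm y)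

/-- The form `η` is smooth on the open set `s`: its local expressions are smooth. -/
def SmoothFormOn {k : ℕ} (η : DForm d M k) (s : Set M) : Prop :=
  ∀ x₀ : M, ContDiffOn ℝ ∞ (formInChart η x₀)
    ((extChartAt (𝓡 d) x₀).target ∩ (extChartAt (𝓡 d) x₀).symm ⁻¹' s)

/-- The exterior derivative, computed at `x` in the chart at `x`. -/
def extD {k : ℕ} (η : DForm d M k) : DForm d M (k + 1) := fun x =>
  (extDeriv (formInChart η x) (extChartAt (𝓡 d) x x)).compContinuousLinearMap
    (mfderiv (𝓡 d) 𝓘(ℝ, EuclideanSpace ℝ (Fin d)) (extChartAt (𝓡 d) x) x)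

/-- The pullback `f^*η`. -/
def formPullback (d e : ℕ) {N : Type*} [TopologicalSpace N]
    [ChartedSpace (EuclideanSpace ℝ (Fin e)) N] {M : Type*} [TopologicalSpace M]
    [ChartedSpace (EuclideanSpace ℝ (Fin d)) M] {k : ℕ} (f : N → M) (η : DForm d M k) :
    DForm e N k := fun y =>
  (η (f y)).compContinuousLinearMap (mfderiv (𝓡 e) (𝓡 d) f y)

/-- A field of linear functionals as a differential form of degree one. -/
def toForm (α : OneForm d M) : DForm d M 1 := fun x =>
  ContinuousAlternatingMap.ofSubsingleton ℝ (TangentSpace (𝓡 d) x) ℝ (0 : Fin 1) (α x)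

/-- The two-form `η` is exact. -/
def IsExact (η : DForm d M 2) : Prop :=
  ∃ β : OneForm d M, SmoothFormOn (toForm β) Set.univ ∧ extD (toForm β) = η

variable (d M) in
/-- Distributions on `M` (not necessarily smooth). -/
abbrev TDistribution : Type _ := ∀ x : M, Submodule ℝ (TangentSpace (𝓡 d) x)

/-- The distribution `Ker(α)`. -/
def kerDistribution (α : OneForm d M) : TDistribution d M := fun x => (α x).ker

/-- `α` is a contact form: it is smooth, vanishes nowhere, and `dα` is non-degenerate on
`Ker(α)`. -/
def IsContactForm (α : OneForm d M) : Prop :=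
  SmoothFormOn (toForm α) Set.univ ∧ ∀ x, α x ≠ 0 ∧ ∀ v ∈ kerDistribution α x,
    (∀ w ∈ kerDistribution α x, extD (toForm α) x ![v, w] = 0) → v = 0

/-- `ξ` is the Reeb field of `α`: `α(ξ) = 1` and `dα(ξ, ·) = 0`. -/
def IsReebField (α : OneForm d M) (ξ : VField d M) : Prop :=
  ∀ x, α x (ξ x) = 1 ∧ ∀ v, extD (toForm α) x ![ξ x, v] = 0

end Manifold

/-! ### Principal bundles -/

/-- A smooth principal `G`-bundle `P → N` (right action, locally trivial). The group is embedded,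
so the action `P × G → P` is smooth iff its composites with smooth maps `ℝᵏ → G` are, and the
trivialization `(y, g) ↦ s(y) g` over `U` is a diffeomorphism iff the `G`-component `τ` of its
inverse is smooth. -/
structure PrincipalBundle (G : Type) [Group G] [EmbeddedGroup G]
    (p : ℕ) (P : Type*) [TopologicalSpace P] [ChartedSpace (EuclideanSpace ℝ (Fin p)) P]
    (d : ℕ) (N : Type*) [TopologicalSpace N] [ChartedSpace (EuclideanSpace ℝ (Fin d)) N] where
  proj : P → N
  act : P → G → P
  smooth_proj : ContMDiff (𝓡 p) (𝓡 d) ∞ proj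
  smooth_act : ∀ (k : ℕ) (c : EuclideanSpace ℝ (Fin k) → G), SmoothInto k c Set.univ →
    ContMDiff ((𝓡 k).prod (𝓡 p)) (𝓡 p) ∞
      (fun y : EuclideanSpace ℝ (Fin k) × P => act y.2 (c y.1))
  act_one : ∀ u, act u 1 = u
  act_mul : ∀ u g h, act u (g * h) = act (act u g) h
  proj_act : ∀ u g, proj (act u g) = proj u
  existsUnique_act : ∀ u v, proj u = proj v → ∃! g, act u g = v
  locally_trivial : ∀ x : N, ∃ U : Set N, IsOpen U ∧ x ∈ U ∧
    ∃ (s : N → P) (τ : P → G),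
      ContMDiffOn (𝓡 d) (𝓡 p) ∞ s U ∧ (∀ y ∈ U, proj (s y) = y) ∧
      SmoothInto p τ (proj ⁻¹' U) ∧ ∀ u ∈ proj ⁻¹' U, act (s (proj u)) (τ u) = u

/-! ### The Heisenberg algebra `𝔤₋` -/

/-- `𝔤₋₁ = M_{n × 2}(ℝ)`. -/
abbrev GNegOne (n : ℕ) : Type := Matrix (Fin n) (Fin 2) ℝ

/-- `𝔤₋₂ = A₂(ℝ)`, the skew-symmetric matrices. -/
def GNegTwo : Submodule ℝ (Matrix (Fin 2) (Fin 2) ℝ) where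
  carrier := {Y | Yᵀ = -Y}
  zero_mem' := by simp
  add_mem' := by
    intro Y Z (hY : Yᵀ = -Y) (hZ : Zᵀ = -Z)
    change (Y + Z)ᵀ = -(Y + Z)
    rw [Matrix.transpose_add, hY, hZ, neg_add]
  smul_mem' := by
    intro c Y (hY : Yᵀ = -Y)
    change (c • Y)ᵀ = -(c • Y)
    rw [Matrix.transpose_smul, hY, smul_neg]

/-- The Lie bracket `𝔤₋₁ × 𝔤₋₁ → 𝔤₋₂` of block matrices in `𝔰𝔬(2, n + 2)`. -/
def gBracket {n : ℕ} (X X' : GNegOne n) : GNegTwo :=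
  ⟨X'ᵀ * X - Xᵀ * X', by
    change (X'ᵀ * X - Xᵀ * X')ᵀ = -(X'ᵀ * X - Xᵀ * X')
    rw [Matrix.transpose_sub, Matrix.transpose_mul, Matrix.transpose_mul,
      Matrix.transpose_transpose, Matrix.transpose_transpose, neg_sub]⟩

theorem glMat_mul (A A' : GLTwoPos) : glMat (A * A') = glMat A * glMat A' := rfl

theorem glMat_one : glMat 1 = 1 := rfl

theorem sOrth_transpose_mul {n : ℕ} (B : SOrth n) : (B.1)ᵀ * B.1 = 1 :=
  (Matrix.mem_orthogonalGroup_iff' _ _).1 (Matrix.mem_specialOrthogonalGroup_iff.1 B.2).1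

/-- The adjoint action of `(A, B) ∈ G₀` on `𝔤₋₁`: `X ↦ B X A⁻¹`. -/
def adNegOne {n : ℕ} (g : GZero n) : GNegOne n ≃ₗ[ℝ] GNegOne n where
  toFun X := g.2.1 * X * glMat g.1⁻¹
  map_add' X Y := by rw [Matrix.mul_add, Matrix.add_mul]
  map_smul' c X := by rw [Matrix.mul_smul, Matrix.smul_mul, RingHom.id_apply]
  invFun X := (g⁻¹).2.1 * X * glMat g.1
  left_inv X := by
    have h1 : (g⁻¹).2.1 * g.2.1 = 1 := congrArg Subtype.val (inv_mul_cancel g.2)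
    have h2 : glMat g.1⁻¹ * glMat g.1 = 1 := by rw [← glMat_mul, inv_mul_cancel, glMat_one]
    simp only [Matrix.mul_assoc, h2, Matrix.mul_one]
    rw [← Matrix.mul_assoc, h1, Matrix.one_mul]
  right_inv X := by
    have h1 : g.2.1 * (g⁻¹).2.1 = 1 := congrArg Subtype.val (mul_inv_cancel g.2)
    have h2 : glMat g.1 * glMat g.1⁻¹ = 1 := by rw [← glMat_mul, mul_inv_cancel, glMat_one]
    simp only [Matrix.mul_assoc, h2, Matrix.mul_one]
    rw [← Matrix.mul_assoc, h1, Matrix.one_mul]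

/-- `Y ↦ Cᵀ Y C` on `𝔤₋₂`. -/
def congrNegTwo (C : Matrix (Fin 2) (Fin 2) ℝ) (Y : GNegTwo) : GNegTwo :=
  ⟨Cᵀ * Y.1 * C, by
    have hY : (Y.1)ᵀ = -Y.1 := Y.2
    change (Cᵀ * Y.1 * C)ᵀ = -(Cᵀ * Y.1 * C)
    rw [Matrix.transpose_mul, Matrix.transpose_mul, Matrix.transpose_transpose, hY]
    simp [Matrix.mul_assoc]⟩

theorem congrNegTwo_congrNegTwo {C D : Matrix (Fin 2) (Fin 2) ℝ} (h : C * D = 1) (Y : GNegTwo) :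
    congrNegTwo D (congrNegTwo C Y) = Y := by
  apply Subtype.ext
  change Dᵀ * (Cᵀ * Y.1 * C) * D = Y.1
  have h' : Dᵀ * Cᵀ = 1 := by rw [← Matrix.transpose_mul, h, Matrix.transpose_one]
  rw [Matrix.mul_assoc, Matrix.mul_assoc, h, Matrix.mul_one, ← Matrix.mul_assoc, h',
    Matrix.one_mul]

/-- The adjoint action of `(A, B) ∈ G₀` on `𝔤₋₂`: `Y ↦ (A⁻¹)ᵀ Y A⁻¹`. -/
def adNegTwo {n : ℕ} (g : GZero n) : GNegTwo ≃ₗ[ℝ] GNegTwo where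
  toFun Y := congrNegTwo (glMat g.1⁻¹) Y
  map_add' Y Z := by
    apply Subtype.ext
    simp [congrNegTwo, Matrix.mul_add, Matrix.add_mul]
  map_smul' c Y := by
    apply Subtype.ext
    simp [congrNegTwo]
  invFun Y := congrNegTwo (glMat g.1) Y
  left_inv := congrNegTwo_congrNegTwo (by rw [← glMat_mul, inv_mul_cancel, glMat_one])
  right_inv := congrNegTwo_congrNegTwo (by rw [← glMat_mul, mul_inv_cancel, glMat_one])

theorem gBracket_ad {n : ℕ} (g : GZero n) (X X' : GNegOne n) :
    gBracket (adNegOne g X) (adNegOne g X') = adNegTwo g (gBracket X X') := by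
  apply Subtype.ext
  change (g.2.1 * X' * glMat g.1⁻¹)ᵀ * (g.2.1 * X * glMat g.1⁻¹) -
      (g.2.1 * X * glMat g.1⁻¹)ᵀ * (g.2.1 * X' * glMat g.1⁻¹) =
    (glMat g.1⁻¹)ᵀ * (X'ᵀ * X - Xᵀ * X') * glMat g.1⁻¹
  have key : ∀ Z Z' : GNegOne n, (g.2.1 * Z' * glMat g.1⁻¹)ᵀ * (g.2.1 * Z * glMat g.1⁻¹) =
      (glMat g.1⁻¹)ᵀ * (Z'ᵀ * Z) * glMat g.1⁻¹ := by
    intro Z Z'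
    calc _ = (glMat g.1⁻¹)ᵀ * Z'ᵀ * ((g.2.1)ᵀ * g.2.1) * Z * glMat g.1⁻¹ := by
            simp only [Matrix.transpose_mul, Matrix.mul_assoc]
      _ = _ := by rw [sOrth_transpose_mul]; simp only [Matrix.mul_one, Matrix.mul_assoc]
  rw [key, key, Matrix.mul_sub, Matrix.sub_mul]

/-! ### PCS-structures of Grassmannian type -/

/-- A `G₀`-structure `(𝒢₀, M, p₀, θ)` on a manifold of dimension `2n`, that is, a PACS-structure of
Grassmannian type (with positive definite signature): a `G₀`-principal bundle with a smooth,
equivariant and strictly horizontal soldering form with values in `𝔤₋₁`. -/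
structure PACSStructure (n p : ℕ) (P : Type*) [TopologicalSpace P]
    [ChartedSpace (EuclideanSpace ℝ (Fin p)) P] [IsManifold (𝓡 p) ∞ P]
    (M : Type*) [TopologicalSpace M] [ChartedSpace (EuclideanSpace ℝ (Fin (2 * n))) M]
    extends PrincipalBundle (GZero n) p P (2 * n) M where
  solder : ∀ u : P, TangentSpace (𝓡 p) u →ₗ[ℝ] GNegOne n
  smooth_solder : ∀ i j, ContMDiff (𝓡 p).tangent 𝓘(ℝ, ℝ) ∞
    (fun v : TangentBundle (𝓡 p) P => solder v.1 v.2 i j)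
  solder_act : ∀ u g v, solder (act u g) (mfderiv (𝓡 p) (𝓡 p) (fun w => act w g) u v) =
    adNegOne g⁻¹ (solder u v)
  ker_solder : ∀ u v, solder u v = 0 ↔ mfderiv (𝓡 p) (𝓡 (2 * n)) proj u v = 0

section PCS

variable {n p : ℕ} {P : Type*} [TopologicalSpace P]
  [ChartedSpace (EuclideanSpace ℝ (Fin p)) P] [IsManifold (𝓡 p) ∞ P]
  {M : Type*} [TopologicalSpace M] [ChartedSpace (EuclideanSpace ℝ (Fin (2 * n))) M]

/-- On `U`, the two-form `η` is a section of the line bundle `ℓ ⊂ Λ²T^*M` of the underlying Hermitian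
almost conformally symplectic structure, which corresponds to the bracket `Λ²𝔤₋₁ → 𝔤₋₂ ≅ ℝ`. -/
def PACSStructure.IsSectionOn (S : PACSStructure n p P M) (η : DForm (2 * n) M 2)
    (U : Set M) : Prop :=
  ∀ u : P, S.proj u ∈ U → ∃ c : ℝ, ∀ v w : TangentSpace (𝓡 p) u,
    formPullback (2 * n) p S.proj η u ![v, w] =
      c * (gBracket (S.solder u v) (S.solder u w)).1 0 1

/-- The `G₀`-structure is a PCS-structure: `ℓ` is a conformally symplectic structure, that is, it has
closed, nowhere zero local sections near every point. -/
def PACSStructure.IsPCS (S : PACSStructure n p P M) : Prop :=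
  ∀ x : M, ∃ U : Set M, IsOpen U ∧ x ∈ U ∧ ∃ η : DForm (2 * n) M 2,
    SmoothFormOn η U ∧ S.IsSectionOn η U ∧ ∀ y ∈ U, η y ≠ 0 ∧ extD η y = 0

/-- `Γ_∇(ℓ)`: the global sections of `ℓ` that are parallel for the canonical connection, that is,
that are closed as two-forms. -/
def PACSStructure.IsParallelSection (S : PACSStructure n p P M) (η : DForm (2 * n) M 2) : Prop :=
  SmoothFormOn η Set.univ ∧ S.IsSectionOn η Set.univ ∧ extD η = 0

end PCS

/-! ### Circle bundles -/

section Circle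

variable {e d : ℕ} {N M : Type*} [TopologicalSpace N] [ChartedSpace (EuclideanSpace ℝ (Fin e)) N]
  [TopologicalSpace M] [ChartedSpace (EuclideanSpace ℝ (Fin d)) M]

/-- `iα` is a principal connection on the circle bundle: `α` is smooth, `U(1)`-invariant and
`α(∂ₜ) = 1`, where `∂ₜ` is the fundamental vector field of `i ∈ 𝔲(1)`. -/
def PrincipalBundle.IsConnection (B : PrincipalBundle Circle e N d M) (α : OneForm e N) : Prop :=
  SmoothFormOn (toForm α) Set.univ ∧
  (∀ (z : Circle) (x : N) (v : TangentSpace (𝓡 e) x),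
    α (B.act x z) (mfderiv (𝓡 e) (𝓡 e) (fun y => B.act y z) x v) = α x v) ∧
  ∀ x : N, α (B.act x (Circle.exp 0))
    (mfderiv 𝓘(ℝ, ℝ) (𝓡 e) (fun t : ℝ => B.act x (Circle.exp t)) 0 (1 : ℝ)) = 1

/-- The real Chern class of a circle bundle, as a set of closed two-forms: the de Rham class of
`-Ω / 2π`, where `dα = q^*Ω` for some principal connection `iα`. -/
def PrincipalBundle.chernClass (B : PrincipalBundle Circle e N d M) : Set (DForm d M 2) :=
  {η | ∃ (α : OneForm e N) (Ω : DForm d M 2), B.IsConnection α ∧ SmoothFormOn Ω Set.univ ∧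
    extD (toForm α) = formPullback d e B.proj Ω ∧ IsExact (η - (-1 / (2 * Real.pi)) • Ω)}

end Circle

/-- The principal connection `iα` on the circle bundle `q : N → M` is compatible with the
PCS-structure: `dα = q^*Ω` for some `Ω ∈ Γ_∇(ℓ)`. -/
def IsCompatibleConnection {n p e : ℕ} {P N M : Type*} [TopologicalSpace P]
    [ChartedSpace (EuclideanSpace ℝ (Fin p)) P] [IsManifold (𝓡 p) ∞ P]
    [TopologicalSpace N] [ChartedSpace (EuclideanSpace ℝ (Fin e)) N]
    [TopologicalSpace M] [ChartedSpace (EuclideanSpace ℝ (Fin (2 * n))) M]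
    (S : PACSStructure n p P M) (B : PrincipalBundle Circle e N (2 * n) M)
    (α : OneForm e N) : Prop :=
  B.IsConnection α ∧ ∃ Ω : DForm (2 * n) M 2, S.IsParallelSection Ω ∧
    extD (toForm α) = formPullback (2 * n) e B.proj Ω

/-- A smooth map of principal bundles covering the map `f` of base manifolds and equivariant over
the group homomorphism `χ`. -/
structure IsBundleMap {G K : Type} [Group G] [EmbeddedGroup G] [Group K] [EmbeddedGroup K]
    {p p' d d' : ℕ} {P P' N N' : Type*}
    [TopologicalSpace P] [ChartedSpace (EuclideanSpace ℝ (Fin p)) P]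
    [TopologicalSpace P'] [ChartedSpace (EuclideanSpace ℝ (Fin p')) P']
    [TopologicalSpace N] [ChartedSpace (EuclideanSpace ℝ (Fin d)) N]
    [TopologicalSpace N'] [ChartedSpace (EuclideanSpace ℝ (Fin d')) N']
    (B : PrincipalBundle G p P d N) (B' : PrincipalBundle K p' P' d' N')
    (χ : G →* K) (f : N → N') (F : P → P') : Prop where
  smooth : ContMDiff (𝓡 p) (𝓡 p') ∞ F
  covers : ∀ u, B'.proj (F u) = f (B.proj u)
  equivariant : ∀ u g, F (B.act u g) = B'.act (F u) (χ g)

/-! ### Lie contact structures -/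

section Frames

variable {d : ℕ} {N : Type*} [TopologicalSpace N] [ChartedSpace (EuclideanSpace ℝ (Fin d)) N]
  [IsManifold (𝓡 d) ∞ N]

/-- An isomorphism of graded Lie algebras `𝔤₋ → gr(T_xN) = T_xN/H_x ⊕ H_x`, where the bracket on
the right is the Levi bracket induced by the Lie bracket of sections of `H`. -/
@[ext]
structure GradedFrame (n : ℕ) (H : TDistribution d N) (x : N) where
  negTwo : GNegTwo ≃ₗ[ℝ] (TangentSpace (𝓡 d) x ⧸ H x)
  negOne : GNegOne n ≃ₗ[ℝ] H x
  bracket : ∀ (U : Set N) (V W : VField d N), IsOpen U → x ∈ U →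
    SmoothVFieldOn V U → SmoothVFieldOn W U → (∀ y ∈ U, V y ∈ H y ∧ W y ∈ H y) →
    ∀ X Y : GNegOne n, (negOne X : TangentSpace (𝓡 d) x) = V x →
      (negOne Y : TangentSpace (𝓡 d) x) = W x →
      negTwo (gBracket X Y) = (H x).mkQ (VectorField.mlieBracket (𝓡 d) V W x)

/-- The natural frame bundle of `(N, H)`. -/
abbrev FrameBundle (n : ℕ) (H : TDistribution d N) : Type _ := Σ x : N, GradedFrame n H x

/-- The right action of `G₀` on graded frames, through `Ad : G₀ → Aut_gr(𝔤₋)`. -/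
def GradedFrame.act {n : ℕ} {H : TDistribution d N} {x : N} (φ : GradedFrame n H x)
    (g : GZero n) : GradedFrame n H x where
  negTwo := (adNegTwo g).trans φ.negTwo
  negOne := (adNegOne g).trans φ.negOne
  bracket U V W hU hx hV hW hH X Y hX hY := by
    rw [LinearEquiv.trans_apply, ← gBracket_ad]
    exact φ.bracket U V W hU hx hV hW hH _ _ hX hY

variable {n p : ℕ} {P : Type*} [TopologicalSpace P] [ChartedSpace (EuclideanSpace ℝ (Fin p)) P]
  [IsManifold (𝓡 p) ∞ P] {H : TDistribution d N}

/-- The component `θ₋₂` at `u` of the tautological form pulled back along a map `F` to the natural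
frame bundle. -/
def tautNegTwo (F : P → FrameBundle n H) (u : P) (v : TangentSpace (𝓡 p) u) : GNegTwo :=
  (F u).2.negTwo.symm ((H (F u).1).mkQ (mfderiv (𝓡 p) (𝓡 d) (fun w => (F w).1) u v))

/-- `v ∈ T⁻¹P`, the preimage of `H`. -/
def InTNegOne (F : P → FrameBundle n H) (u : P) (v : TangentSpace (𝓡 p) u) : Prop :=
  mfderiv (𝓡 p) (𝓡 d) (fun w => (F w).1) u v ∈ H (F u).1

open scoped Classical in
/-- The component `θ₋₁` at `u` of the pulled back tautological form. It is only defined on `T⁻¹P`, and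
here extended by zero. -/
def tautNegOne (F : P → FrameBundle n H) (u : P) (v : TangentSpace (𝓡 p) u) : GNegOne n :=
  if h : InTNegOne F u v then (F u).2.negOne.symm ⟨_, h⟩ else 0

/-- `F` is a reduction of the natural frame bundle along `χ : K → G₀`: a smooth map over the
identity of `N` that is equivariant over `χ`. -/
structure IsFrameReduction {K : Type} [Group K] [EmbeddedGroup K] (B : PrincipalBundle K p P d N)
    (χ : K →* GZero n) (F : P → FrameBundle n H) : Prop where
  fst_eq : ∀ u, (F u).1 = B.proj u
  equivariant : ∀ u k, F (B.act u k) = ⟨(F u).1, (F u).2.act (χ k)⟩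
  smooth : ∀ X : GNegOne n, ContMDiff (𝓡 p) (𝓡 d).tangent ∞
    (fun u => (⟨(F u).1, ((F u).2.negOne X : TangentSpace (𝓡 d) (F u).1)⟩ :
      TangentBundle (𝓡 d) N))

/-- `ξ₀` is the lift to `P` of the infinitesimal symmetry `ξ` of the structure `F`: it is smooth,
equivariant, projects to `ξ`, and the Lie derivatives along `ξ₀` of both components of the
tautological form vanish. -/
structure IsSymmetryLift {K : Type} [Group K] [EmbeddedGroup K] (B : PrincipalBundle K p P d N)
    (F : P → FrameBundle n H) (ξ : VField d N) (ξ₀ : VField p P) : Prop where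
  smooth : SmoothVFieldOn ξ₀ Set.univ
  equivariant : ∀ u k, mfderiv (𝓡 p) (𝓡 p) (fun w => B.act w k) u (ξ₀ u) = ξ₀ (B.act u k)
  projects : ∀ u, mfderiv (𝓡 p) (𝓡 d) B.proj u (ξ₀ u) = ξ (B.proj u)
  negTwo : ∀ (U : Set P) (Y : VField p P), IsOpen U → SmoothVFieldOn Y U → ∀ u ∈ U, ∀ i j,
    mfderiv (𝓡 p) 𝓘(ℝ, ℝ) (fun w => (tautNegTwo F w (Y w)).1 i j) u (ξ₀ u) =
      (tautNegTwo F u (VectorField.mlieBracket (𝓡 p) ξ₀ Y u)).1 i j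
  negOne : ∀ (U : Set P) (Y : VField p P), IsOpen U → SmoothVFieldOn Y U →
    (∀ u ∈ U, InTNegOne F u (Y u)) → ∀ u ∈ U,
    InTNegOne F u (VectorField.mlieBracket (𝓡 p) ξ₀ Y u) ∧ ∀ i j,
    mfderiv (𝓡 p) 𝓘(ℝ, ℝ) (fun w => tautNegOne F w (Y w) i j) u (ξ₀ u) =
      tautNegOne F u (VectorField.mlieBracket (𝓡 p) ξ₀ Y u) i j

/-- `ξ` is a transversal infinitesimal symmetry. -/
def IsTransversalSymmetry {K : Type} [Group K] [EmbeddedGroup K] (B : PrincipalBundle K p P d N)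
    (F : P → FrameBundle n H) (ξ : VField d N) : Prop :=
  SmoothVFieldOn ξ Set.univ ∧ (∃ ξ₀ : VField p P, IsSymmetryLift B F ξ ξ₀) ∧ ∀ x, ξ x ∉ H x

variable (n p P H) in
/-- A Lie contact structure of type `(G, P)` on `(N, H)`: a reduction of the natural frame bundle to
the structure group `G₀`. -/
structure LieContactStructure extends PrincipalBundle (GZero n) p P d N where
  frame : P → FrameBundle n H
  reduction : IsFrameReduction toPrincipalBundle (MonoidHom.id _) frame

variable (n p P H) in
/-- A Lie contact structure of type `(G̃, P̃)` on `(N, H)`: a Lie contact structure of type `(G, P)`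
with a lift of its `G₀`-bundle `P → N` to a `G̃₀`-bundle `P' → N`. -/
structure SpinLieContactStructure (p' : ℕ) (P' : Type*) [TopologicalSpace P']
    [ChartedSpace (EuclideanSpace ℝ (Fin p')) P'] where
  base : LieContactStructure n p P H
  bundle : PrincipalBundle (GZeroSpin n) p' P' d N
  lift : P' → P
  isLift : IsBundleMap bundle base.toPrincipalBundle (gSpinToG n) id lift

/-- `q₀ : P → P₀` is a PCS-quotient of the Lie contact structure `L` by the transversal infinitesimal
symmetry `ξ` which covers `q : N → M`. -/
structure IsPCSQuotient {p₀ : ℕ} {P₀ : Type*} [TopologicalSpace P₀]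
    [ChartedSpace (EuclideanSpace ℝ (Fin p₀)) P₀] [IsManifold (𝓡 p₀) ∞ P₀]
    {M : Type*} [TopologicalSpace M] [ChartedSpace (EuclideanSpace ℝ (Fin (2 * n))) M]
    (L : LieContactStructure n p P H) (ξ : VField d N) (S : PACSStructure n p₀ P₀ M) (q : N → M)
    (q₀ : P → P₀) : Prop where
  symmetry : IsTransversalSymmetry L.toPrincipalBundle L.frame ξ
  bundleMap : IsBundleMap L.toPrincipalBundle S.toPrincipalBundle (MonoidHom.id _) q q₀
  surjective : Function.Surjective q₀
  connected_fibers : ∀ w, IsConnected (q₀ ⁻¹' {w})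
  ker : ∃ ξ₀ : VField p P, IsSymmetryLift L.toPrincipalBundle L.frame ξ ξ₀ ∧
    ∀ u, (mfderiv (𝓡 p) (𝓡 p₀) q₀ u).ker = Submodule.span ℝ {ξ₀ u}
  solder : ∀ u v, InTNegOne L.frame u v →
    S.solder (q₀ u) (mfderiv (𝓡 p) (𝓡 p₀) q₀ u v) = tautNegOne L.frame u v

/-- `f` is an isomorphism of Lie contact structures of type `(G, P)` over the identity of `(N, H)`. -/
def IsLieContactIso {p' : ℕ} {P' : Type*} [TopologicalSpace P']
    [ChartedSpace (EuclideanSpace ℝ (Fin p')) P'] [IsManifold (𝓡 p') ∞ P']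
    (L : LieContactStructure n p P H) (L' : LieContactStructure n p' P' H)
    (f : Diffeomorph (𝓡 p) (𝓡 p') P P' ∞) : Prop :=
  (∀ u g, f (L.act u g) = L'.act (f u) g) ∧ ∀ u, L'.frame (f u) = L.frame u

end Frames

/-! ### The determinant circle bundle and the induced Lie contact structure -/

section Determinant

variable {n pc p₀ : ℕ} {Pc P₀ N M : Type*}
  [TopologicalSpace M] [ChartedSpace (EuclideanSpace ℝ (Fin (2 * n))) M]
  [TopologicalSpace P₀] [ChartedSpace (EuclideanSpace ℝ (Fin p₀)) P₀] [IsManifold (𝓡 p₀) ∞ P₀]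
  [TopologicalSpace Pc] [ChartedSpace (EuclideanSpace ℝ (Fin pc)) Pc] [IsManifold (𝓡 pc) ∞ Pc]
  [TopologicalSpace N] [ChartedSpace (EuclideanSpace ℝ (Fin (2 * n + 1))) N]

/-- The `G₀ᶜ`-bundle `Bc` is a lift of the `G₀`-bundle `S`, by the map `t : 𝒢₀ᶜ → 𝒢₀`. -/
def IsGCLift (Bc : PrincipalBundle (GZeroC n) pc Pc (2 * n) M) (S : PACSStructure n p₀ P₀ M)
    (t : Pc → P₀) : Prop :=
  IsBundleMap Bc S.toPrincipalBundle (gCToG n) id t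

/-- The circle bundle `B` is the determinant circle bundle `𝒢₀ᶜ ×_{G₀ᶜ} U(1)` of `Bc`, where
`δ(u)` is the class `[u, 1]`: the class `[u, z]` is then `δ(u) z`, and a smooth map `δ` over the
identity of `M` which is equivariant over `G₀ᶜ → U(1)` is the same as an isomorphism of circle bundles
from the associated bundle to `B`. -/
def IsDeterminantBundle (Bc : PrincipalBundle (GZeroC n) pc Pc (2 * n) M)
    (B : PrincipalBundle Circle (2 * n + 1) N (2 * n) M) (δ : Pc → N) : Prop :=
  IsBundleMap Bc B (gCDet n) id δ

/-- The conditions on a Lie contact structure `L` of type `(G̃, P̃)` on the determinant circle bundle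
`N` of `𝒢₀ᶜ`: its `G̃₀`-bundle is `𝒢₀ᶜ → N`, with the restricted action of `G̃₀ ⊂ G₀ᶜ`, the field `ξ`
is a transversal infinitesimal symmetry, and `q₀` is a PCS-quotient by `ξ` which covers the projection
to `M` and through which the given lift `t : 𝒢₀ᶜ → 𝒢₀` factors. -/
structure IsInducedLieContact [IsManifold (𝓡 (2 * n + 1)) ∞ N]
    (Bc : PrincipalBundle (GZeroC n) pc Pc (2 * n) M) (S : PACSStructure n p₀ P₀ M)
    (t : Pc → P₀) (B : PrincipalBundle Circle (2 * n + 1) N (2 * n) M) (δ : Pc → N)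
    {H : TDistribution (2 * n + 1) N} (ξ : VField (2 * n + 1) N)
    {p : ℕ} {P : Type*} [TopologicalSpace P] [ChartedSpace (EuclideanSpace ℝ (Fin p)) P]
    [IsManifold (𝓡 p) ∞ P] (L : SpinLieContactStructure n p P H pc Pc) (q₀ : P → P₀) : Prop where
  proj_eq : L.bundle.proj = δ
  act_eq : ∀ u g, L.bundle.act u g = Bc.act u (gSpinToGC n g)
  symmetry : IsTransversalSymmetry L.bundle (fun u => L.base.frame (L.lift u)) ξ
  quotient : IsPCSQuotient L.base ξ S B.proj q₀
  lift_eq : ∀ u, q₀ (L.lift u) = t u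

end Determinant

end

/-!
The bundle of the induced structure is the fibre product `P = N ×_M 𝒢₀` of the determinant circle
bundle `q : N → M` with `𝒢₀`. It carries the pullback of the `G₀`-action and its projection `q₀` to
`𝒢₀`, and `u ↦ (δ(u), t(u))` identifies it with the quotient of `𝒢₀ᶜ` by the kernel `{1, ε}` of
`G₀ᶜ → G₀ × U(1)` (`exists_isFibreProduct`). This rests on the surjectivity of `G₀ᶜ → G₀ × U(1)` and
on its smooth local sections, which come from an explicit local section of `Spin(n) → SO(n)`
(`exists_spin_of_pos`): averaging over the group generated by the basis vectors of the Clifford algebra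
produces from `B = ρₙ(a)` a multiple of `a` that depends polynomially on `B`. The kernel of
`G₀ᶜ → U(1)` being `G̃₀`, the projection `𝒢₀ᶜ → N` is a `G̃₀`-bundle (`exists_spin_bundle`).

The closed form `Ω` is locally a multiple `f η` of a nowhere zero closed section `η` of `ℓ`, and
`df ∧ η = 0` forces `df = 0`. Since `M` is connected, `Ω` vanishes everywhere or nowhere, and the former
would make the Chern class zero (`PACSStructure.IsParallelSection.ne_zero`). So `dα = q^*Ω` is
non-degenerate on `H = ker α ≅ q^*TM`; hence `α` is a contact form and its Reeb field `ξ` is the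
fundamental vector field of the circle action.

On `H` the Levi bracket is `-dα` times the class of `ξ`, and `Ω` is a multiple of the bracket of `𝔤₋`
transported by the soldering form. Hence for a point `x` of `N` and a point `w` of `𝒢₀` over `q(x)`, the
isomorphism `H_x ≅ T_{q(x)}M ≅ 𝔤₋₁` extends to a graded frame (`IsContactConnection.frame`), and in only
one way, because the bracket generates `𝔤₋₂`. These frames make `P` a Lie contact structure. The flow of
`ξ` lifts to `P` by acting on the factor `N` alone, and to `𝒢₀ᶜ` by the central subgroup
`⟨exp(is/2), 1⟩`; the generator is tangent to the fibres over `𝒢₀`, so that Cartan's formula for `α` and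
for the entries of `θ` shows that it preserves the tautological forms
(`IsContactConnection.isSymmetryLift`).

Conversely, the total space of any Lie contact structure with a PCS-quotient onto `𝒢₀` is the fibre
product as well, since its structure group is also `G₀`, and the condition on the soldering form
determines the frames. This gives the unique isomorphism
(`IsContactConnection.existsUnique_isLieContactIso`), from which the uniqueness of the structure of type
`(G̃, P̃)` follows, as `𝒢₀ᶜ → P` is surjective and is determined by its components `δ` and `t`.
-/

/-! ### The covering `Spin(n) → SO(n)` -/

/-- The `i`-th generator of the Clifford algebra. -/
noncomputable abbrev clE {n : ℕ} (i : Fin n) : Cl n := clVec n (Pi.single i 1)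

theorem clE_mul_self {n : ℕ} (i : Fin n) : clE i * clE i = -1 := by
  rw [CliffordAlgebra.ι_sq_scalar, negSq_apply]
  simp

theorem clE_mul_clE {n : ℕ} {i j : Fin n} (h : i ≠ j) : clE i * clE j = -(clE j * clE i) := by
  rw [← add_eq_zero_iff_eq_neg, CliffordAlgebra.ι_mul_ι_add_swap, negSq_polar]
  simp [h.symm]

/-- The product of the generators with indices in a list. -/
noncomputable def clMono {n : ℕ} (L : List (Fin n)) : Cl n := (L.map clE).prod

theorem clMono_cons {n : ℕ} (i : Fin n) (L : List (Fin n)) :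
    clMono (i :: L) = clE i * clMono L := by
  simp [clMono]

theorem clMono_append {n : ℕ} (L L' : List (Fin n)) :
    clMono (L ++ L') = clMono L * clMono L' := by
  simp [clMono]

theorem clMono_mul_clE {n : ℕ} (L : List (Fin n)) (i : Fin n) :
    clMono L * clE i = (-1 : ℝ) ^ (L.length + L.count i) • (clE i * clMono L) := by
  induction L with
  | nil => simp [clMono]
  | cons j L ih =>
    rw [clMono_cons, mul_assoc, ih, mul_smul_comm, ← mul_assoc, ← mul_assoc]
    by_cases h : j = i
    · subst h
      simp [pow_add]
    · rw [clE_mul_clE h, List.length_cons, List.count_cons_of_ne (by simpa using h), neg_mul,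
        smul_neg, add_right_comm, pow_succ, mul_neg_one, neg_smul]

theorem involute_clMono {n : ℕ} (L : List (Fin n)) :
    CliffordAlgebra.involute (clMono L) = (-1 : ℝ) ^ L.length • clMono L := by
  induction L with
  | nil => simp [clMono]
  | cons j L ih =>
    rw [clMono_cons, map_mul, ih, CliffordAlgebra.involute_ι, List.length_cons, pow_succ,
      mul_smul_comm, neg_mul, smul_neg, mul_neg_one, neg_smul]

theorem mem_span_clMono {n : ℕ} (y : Cl n) : y ∈ Submodule.span ℝ (Set.range (clMono (n := n))) := by
  induction y using CliffordAlgebra.induction with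
  | algebraMap r =>
    rw [Algebra.algebraMap_eq_smul_one]
    exact Submodule.smul_mem _ _ (Submodule.subset_span ⟨[], by simp [clMono]⟩)
  | ι v =>
    have : v = ∑ i, v i • (Pi.single i 1 : Fin n → ℝ) := by
      ext j
      simp [Finset.sum_apply, Pi.single_apply]
    rw [this, map_sum]
    refine Submodule.sum_mem _ fun i _ => ?_
    rw [map_smul]
    exact Submodule.smul_mem _ _ (Submodule.subset_span ⟨[i], by simp [clMono]⟩)
  | mul a b ha hb =>
    have h := Submodule.mul_mem_mul ha hb
    rw [Submodule.span_mul_span] at h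
    refine Submodule.span_mono ?_ h
    rintro _ ⟨_, ⟨L, rfl⟩, _, ⟨L', rfl⟩, rfl⟩
    exact ⟨L ++ L', clMono_append L L'⟩
  | add a b ha hb => exact Submodule.add_mem _ ha hb

/-- A product of generators in which every generator occurs an even number of times is a scalar. -/
theorem clMono_scalar {n : ℕ} (L : List (Fin n)) (hL : ∀ i, Even (L.count i)) :
    ∃ c : ℝ, clMono L = c • 1 := by
  induction h : L.length using Nat.strong_induction_on generalizing L with
  | _ m ih =>
    cases L with
    | nil => exact ⟨1, by simp [clMono]⟩
    | cons i L =>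
      have hi := hL i
      rw [List.count_cons_self, Nat.even_add_one, Nat.not_even_iff_odd] at hi
      obtain ⟨s, t, rfl⟩ := List.append_of_mem (List.count_pos_iff.1 hi.pos)
      -- Move the first generator to its next occurrence and cancel the two.
      obtain ⟨c, hc⟩ := ih (s ++ t).length (by simp at h ⊢; omega) (s ++ t) (fun j => by
        have := hL j
        by_cases hj : i = j
        · subst hj
          simp only [List.count_append, List.count_cons_self] at this ⊢
          rw [show s.count i + (t.count i + 1) + 1 = s.count i + t.count i + 2 by ring,
            Nat.even_add] at this
          simpa using this
        · simp only [List.count_append, List.count_cons_of_ne hj] at this ⊢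
          exact this) rfl
      refine ⟨-((-1 : ℝ) ^ (s.length + s.count i)) * c, ?_⟩
      rw [clMono_cons, clMono_append, clMono_cons, ← mul_assoc (clMono s), clMono_mul_clE, mul_smul,
        ← hc, clMono_append, smul_mul_assoc, mul_smul_comm, ← mul_assoc, ← mul_assoc, clE_mul_self]
      simp

/-- The operator `y ↦ y - (B eᵢ) y eᵢ = y + (B eᵢ) y eᵢ⁻¹` on the Clifford algebra. -/
noncomputable def clStep {n : ℕ} (B : Matrix (Fin n) (Fin n) ℝ) (i : Fin n) : Cl n →ₗ[ℝ] Cl n where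
  toFun y := y - clVec n (B *ᵥ Pi.single i 1) * y * clE i
  map_add' y z := by rw [mul_add, add_mul]; abel
  map_smul' c y := by rw [mul_smul_comm, smul_mul_assoc, RingHom.id_apply, smul_sub]

theorem clStep_apply {n : ℕ} (B : Matrix (Fin n) (Fin n) ℝ) (i : Fin n) (y : Cl n) :
    clStep B i y = y - clVec n (B *ᵥ Pi.single i 1) * y * clE i := rfl

theorem clStep_one_apply {n : ℕ} (i : Fin n) (y : Cl n) :
    clStep 1 i y = y - clE i * y * clE i := by
  rw [clStep_apply, Matrix.one_mulVec]

/-- The composition of the operators `clStep B i` over a list of indices. -/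
noncomputable def clAvg {n : ℕ} (B : Matrix (Fin n) (Fin n) ℝ) (l : List (Fin n)) (y : Cl n) :
    Cl n :=
  l.foldr (fun i z => clStep B i z) y

theorem clAvg_cons {n : ℕ} (B : Matrix (Fin n) (Fin n) ℝ) (i : Fin n) (l : List (Fin n))
    (y : Cl n) : clAvg B (i :: l) y = clStep B i (clAvg B l y) := rfl

theorem clAvg_add {n : ℕ} (B : Matrix (Fin n) (Fin n) ℝ) (l : List (Fin n)) (y z : Cl n) :
    clAvg B l (y + z) = clAvg B l y + clAvg B l z := by
  induction l with
  | nil => rfl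
  | cons i l ih => rw [clAvg_cons, ih, map_add, clAvg_cons, clAvg_cons]

theorem clAvg_smul {n : ℕ} (B : Matrix (Fin n) (Fin n) ℝ) (l : List (Fin n)) (c : ℝ) (y : Cl n) :
    clAvg B l (c • y) = c • clAvg B l y := by
  induction l with
  | nil => rfl
  | cons i l ih => rw [clAvg_cons, ih, map_smul, clAvg_cons]

/-- Since `(ρₙ(a) eᵢ) a = a eᵢ`, left multiplication by `a` intertwines the operators for `1` and for
`ρₙ(a)`. -/
theorem clAvg_spin_mul {n : ℕ} (a : Spin n) (l : List (Fin n)) (y : Cl n) :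
    clAvg (spinRho n a).1 l (a * y) = a * clAvg 1 l y := by
  induction l with
  | nil => rfl
  | cons i l ih =>
    rw [clAvg_cons, ih, clStep_apply, clAvg_cons, clStep_one_apply, ← mul_assoc, ← spinRho_spec,
      mul_sub]
    simp only [mul_assoc]

theorem clAvg_star {n : ℕ} (l : List (Fin n)) (y : Cl n) :
    clAvg 1 l (star y) = star (clAvg 1 l y) := by
  induction l with
  | nil => rfl
  | cons i l ih =>
    rw [clAvg_cons, ih, clStep_one_apply, clAvg_cons, clStep_one_apply, star_sub, star_mul,
      star_mul, CliffordAlgebra.star_ι]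
    simp [mul_assoc]

theorem clAvg_clMono {n : ℕ} (l L : List (Fin n)) (hL : Even L.length) :
    clAvg 1 l (clMono L) = (l.map fun i => 1 + (-1 : ℝ) ^ L.count i).prod • clMono L := by
  induction l with
  | nil => simp [clAvg]
  | cons i l ih =>
    rw [clAvg_cons, ih, map_smul, clStep_one_apply, mul_assoc, clMono_mul_clE, mul_smul_comm,
      ← mul_assoc, clE_mul_self, pow_add, hL.neg_one_pow, List.map_cons, List.prod_cons, one_mul,
      neg_one_mul, smul_neg, sub_neg_eq_add]
    nth_rw 1 [← one_smul ℝ (clMono L)]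
    rw [← add_smul, smul_smul, mul_comm]

/-- The average `y ↦ ∑ g y g⁻¹` over the group generated by the generators, up to a factor. It maps
the even part of the Clifford algebra to the scalars. -/
theorem clAvg_even {n : ℕ} (y : Cl n) :
    ∃ c : ℝ, clAvg 1 (List.finRange n) (y + CliffordAlgebra.involute y) = c • 1 := by
  have h := mem_span_clMono y
  induction h using Submodule.span_induction with
  | mem y hy =>
    obtain ⟨L, rfl⟩ := hy
    rw [involute_clMono]
    rcases Nat.even_or_odd L.length with hL | hL
    · rw [hL.neg_one_pow, one_smul, clAvg_add, clAvg_clMono _ _ hL]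
      by_cases hc : ∀ i, Even (L.count i)
      · obtain ⟨c, hc⟩ := clMono_scalar L hc
        rw [hc, ← add_smul, smul_smul]
        exact ⟨_, rfl⟩
      · push Not at hc
        obtain ⟨i, hi⟩ := hc
        refine ⟨0, ?_⟩
        have : (List.map (fun i => 1 + (-1 : ℝ) ^ L.count i) (List.finRange n)).prod = 0 := by
          rw [List.prod_eq_zero_iff, List.mem_map]
          exact ⟨i, List.mem_finRange i, by
            rw [Odd.neg_one_pow (Nat.not_even_iff_odd.1 hi)]; norm_num⟩
        rw [this]; simp
    · refine ⟨0, ?_⟩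
      rw [hL.neg_one_pow, neg_one_smul, add_neg_cancel]
      simpa using clAvg_smul 1 (List.finRange n) 0 (0 : Cl n)
  | zero => exact ⟨0, by simpa using clAvg_smul 1 (List.finRange n) 0 (0 : Cl n)⟩
  | add y z _ _ hy hz =>
    obtain ⟨c, hc⟩ := hy
    obtain ⟨d, hd⟩ := hz
    refine ⟨c + d, ?_⟩
    rw [map_add, add_add_add_comm, clAvg_add, hc, hd, add_smul]
  | smul r y _ hy =>
    obtain ⟨c, hc⟩ := hy
    refine ⟨r * c, ?_⟩
    rw [map_smul, ← smul_add, clAvg_smul, hc, mul_smul]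

theorem exists_clLam (n : ℕ) : ∃ l : Cl n →ₗ[ℝ] ℝ, l 1 = 1 := by
  obtain ⟨l, hl⟩ := LinearMap.exists_leftInverse_of_injective (Algebra.linearMap ℝ (Cl n))
    (LinearMap.ker_eq_bot.2 (algebraMap ℝ (Cl n)).injective)
  exact ⟨l, by simpa using congrArg (fun f => f 1) hl⟩

/-- A linear functional on the Clifford algebra which maps `1` to `1`. -/
noncomputable def clLam (n : ℕ) : Cl n →ₗ[ℝ] ℝ := (exists_clLam n).choose

theorem clLam_one (n : ℕ) : clLam n 1 = 1 := (exists_clLam n).choose_spec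

/-- The average as a linear functional: on even elements, it is a positive multiple of the scalar
part. -/
noncomputable def clScal {n : ℕ} : Cl n →ₗ[ℝ] ℝ where
  toFun y := clLam n (clAvg 1 (List.finRange n) y)
  map_add' y z := by rw [clAvg_add, map_add]
  map_smul' c y := by rw [clAvg_smul, map_smul, RingHom.id_apply]

theorem clAvg_spin {n : ℕ} (a : Spin n) :
    clAvg 1 (List.finRange n) (a : Cl n) = clScal (a : Cl n) • 1 := by
  obtain ⟨c, hc⟩ := clAvg_even (a : Cl n)
  rw [spinGroup.involute_eq a.2, ← two_smul ℝ, clAvg_smul] at hc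
  have h : clAvg 1 (List.finRange n) (a : Cl n) = (c / 2) • 1 := by
    rw [div_eq_inv_mul, mul_smul, ← hc, smul_smul]
    norm_num
  change _ = clLam n (clAvg 1 (List.finRange n) (a : Cl n)) • (1 : Cl n)
  rw [h, map_smul, clLam_one, smul_eq_mul, mul_one]

theorem clScal_one_pos (n : ℕ) : 0 < clScal (1 : Cl n) := by
  change 0 < clLam n (clAvg 1 (List.finRange n) (1 : Cl n))
  have h : (1 : Cl n) = clMono [] := by simp [clMono]
  rw [h, clAvg_clMono _ _ (by simp), map_smul, ← h, clLam_one]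
  simp only [List.count_nil, pow_zero, smul_eq_mul, mul_one, List.map_const', List.prod_replicate]
  positivity

/-- An element of the Clifford algebra, polynomial in `B`, which spans the line of the even
elements `a` with `a v = (B v) a` for all vectors `v`, if `B ∈ SO(n)` is close to `1`. -/
noncomputable def clLine {n : ℕ} (B : Matrix (Fin n) (Fin n) ℝ) : Cl n :=
  clAvg B (List.finRange n) 1

/-- For `B = ρₙ(a)`, write `1 = a a⁻¹`: the factor `a` can be pulled out, and the average of
`a⁻¹ = a^*` is a scalar. -/
theorem clLine_spinRho {n : ℕ} (a : Spin n) :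
    clLine (spinRho n a).1 = clScal (a : Cl n) • (a : Cl n) := by
  have h1 : (1 : Cl n) = (a : Cl n) * star (a : Cl n) := (spinGroup.mul_star_self_of_mem a.2).symm
  rw [clLine, h1, clAvg_spin_mul, clAvg_star, clAvg_spin, CliffordAlgebra.star_smul, star_one,
    mul_smul_comm, mul_one]

/-- The kernel of `ρₙ` is `{±1}`: if `ρₙ(a) = 1`, then `clLine 1` is a multiple both of `a` and of
`1`. -/
theorem spinRho_eq_one {n : ℕ} (a : Spin n) (h : spinRho n a = 1) :
    (a : Cl n) = 1 ∨ (a : Cl n) = -1 := by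
  have h1 := clLine_spinRho a
  have h2 := clLine_spinRho (1 : Spin n)
  rw [map_one, OneMemClass.coe_one, OneMemClass.coe_one] at h2
  rw [h, OneMemClass.coe_one, h2] at h1
  have h0 := (clScal_one_pos n).ne'
  have h3 : clScal (a : Cl n) ≠ 0 := by
    intro h3
    rw [h3, zero_smul, smul_eq_zero] at h1
    exact h1.elim h0 one_ne_zero
  have h4 : (a : Cl n) = (clScal (1 : Cl n) / clScal (a : Cl n)) • 1 := by
    rw [div_eq_inv_mul, mul_smul, h1, smul_smul, inv_mul_cancel₀ h3, one_smul]
  set c := clScal (1 : Cl n) / clScal (a : Cl n)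
  have h5 := spinGroup.mul_star_self_of_mem a.2
  rw [h4, CliffordAlgebra.star_smul, star_one, smul_mul_smul_comm, mul_one,
    ← Algebra.algebraMap_eq_smul_one] at h5
  have h6 : c * c = 1 := (algebraMap ℝ (Cl n)).injective (by rw [h5, map_one])
  rcases mul_self_eq_one_iff.1 h6 with h7 | h7
  · left; rw [h4, h7, one_smul]
  · right; rw [h4, h7, neg_smul, one_smul]

/-- A product of reflections is the twisted conjugation by a product of unit vectors. -/
theorem twistedAct_pin_reflection {n : ℕ} (l : List (EuclideanSpace ℝ (Fin n))) :
    ∃ x ∈ pinGroup (negSq n), ∃ B, TwistedAct x B ∧ ∀ v : EuclideanSpace ℝ (Fin n),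
      ((l.map fun v => (ℝ ∙ v)ᗮ.reflection).prod v).ofLp = B *ᵥ v.ofLp := by
  induction l with
  | nil => exact ⟨1, one_mem _, 1, ⟨one_mem _, by simp, by simp⟩, by simp⟩
  | cons u l ih =>
    obtain ⟨x, hx, B, hB, h⟩ := ih
    by_cases hu : u = 0
    · refine ⟨x, hx, B, hB, fun v => ?_⟩
      rw [List.map_cons, List.prod_cons, LinearIsometryEquiv.coe_mul, Function.comp_apply, ← h v,
        Submodule.reflection_orthogonal_apply, hu, Submodule.reflection_singleton_apply]
      simp
    set r : ℝ := ‖u‖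
    have hr : r ≠ 0 := norm_ne_zero_iff.2 hu
    have huu : u.ofLp ⬝ᵥ u.ofLp = r ^ 2 := by
      rw [EuclideanSpace.real_norm_sq_eq]
      simp [dotProduct, pow_two]
    have hd : (r⁻¹ • u.ofLp) ⬝ᵥ (r⁻¹ • u.ofLp) = 1 := by
      rw [smul_dotProduct, dotProduct_smul, huu]
      simp only [smul_eq_mul]
      field_simp
    have hw := twistedAct_vec (r⁻¹ • u.ofLp) (by rw [hd]; exact one_ne_zero)
    have hsq : clVec n (r⁻¹ • u.ofLp) * clVec n (r⁻¹ • u.ofLp) = -1 := by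
      rw [CliffordAlgebra.ι_sq_scalar, negSq_apply, hd]; simp
    refine ⟨clVec n (r⁻¹ • u.ofLp) * x, mul_mem ?_ hx, _, hw.mul hB, fun v => ?_⟩
    · refine pinGroup.mem_iff.2 ⟨?_, ?_⟩
      · refine ⟨⟨clVec n (r⁻¹ • u.ofLp), -clVec n (r⁻¹ • u.ofLp), by rw [mul_neg, hsq, neg_neg],
          by rw [neg_mul, hsq, neg_neg]⟩, Subgroup.subset_closure ⟨_, rfl⟩, rfl⟩
      · rw [Unitary.mem_iff, CliffordAlgebra.star_ι, neg_mul, mul_neg, hsq, neg_neg]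
        exact ⟨rfl, rfl⟩
    · rw [List.map_cons, List.prod_cons, LinearIsometryEquiv.coe_mul, Function.comp_apply, ← Matrix.mulVec_mulVec,
        ← h v, Submodule.reflection_orthogonal_apply, Submodule.reflection_singleton_apply, hd]
      generalize ((l.map fun v => (ℝ ∙ v)ᗮ.reflection).prod v) = y
      rw [Matrix.add_mulVec, Matrix.one_mulVec, ← Matrix.mulVec_mulVec]
      have hi : inner ℝ u y = u.ofLp ⬝ᵥ y.ofLp := by
        simp [PiLp.inner_apply, dotProduct, mul_comm]
      have hi' : (Matrix.replicateRow Unit (r⁻¹ • u.ofLp)) *ᵥ y.ofLp =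
          fun _ => r⁻¹ * (u.ofLp ⬝ᵥ y.ofLp) := by
        ext k
        simp [Matrix.mulVec, dotProduct, Finset.mul_sum, mul_assoc]
      rw [hi', hi]
      ext k
      simp [Matrix.mulVec, dotProduct]
      field_simp
      ring

theorem mem_even_of_involute_eq {n : ℕ} {x : Cl n} (h : CliffordAlgebra.involute x = x) :
    x ∈ CliffordAlgebra.even (negSq n) := by
  have hx : x ∈ CliffordAlgebra.evenOdd (negSq n) 0 ⊔ CliffordAlgebra.evenOdd (negSq n) 1 := by
    rw [(CliffordAlgebra.evenOdd_isCompl (Q := negSq n)).sup_eq_top]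
    exact Submodule.mem_top
  obtain ⟨a, ha, b, hb, rfl⟩ := Submodule.mem_sup.1 hx
  rw [map_add, CliffordAlgebra.involute_eq_of_mem_even ha,
    CliffordAlgebra.involute_eq_of_mem_odd hb, add_right_inj] at h
  have hb0 : b = 0 := by
    have h2 : (2 : ℝ) • b = 0 := by
      rw [two_smul]
      nth_rw 1 [← h]
      exact neg_add_cancel b
    exact (smul_eq_zero.1 h2).resolve_left two_ne_zero
  rw [hb0, add_zero]
  exact ha

/-- A rotation is a product of reflections, so it is given by an element of the Pin group, which is even
since the determinant is `1`. -/
theorem spinRho_surjective (n : ℕ) : Function.Surjective (spinRho n) := by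
  intro B
  obtain ⟨hB, hdet⟩ := Matrix.mem_specialOrthogonalGroup_iff.1 B.2
  have hTB : (B.1)ᵀ * B.1 = 1 := sOrth_transpose_mul B
  let f : EuclideanSpace ℝ (Fin n) →ₗᵢ[ℝ] EuclideanSpace ℝ (Fin n) :=
    { toFun := fun v => WithLp.toLp 2 (B.1 *ᵥ v.ofLp)
      map_add' := fun v w => by simp [Matrix.mulVec_add]
      map_smul' := fun c v => by simp [Matrix.mulVec_smul]
      norm_map' := fun v => by
        rw [← sq_eq_sq₀ (norm_nonneg _) (norm_nonneg _), EuclideanSpace.real_norm_sq_eq,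
          EuclideanSpace.real_norm_sq_eq]
        have : (B.1 *ᵥ v.ofLp) ⬝ᵥ (B.1 *ᵥ v.ofLp) = v.ofLp ⬝ᵥ v.ofLp := by
          rw [Matrix.dotProduct_mulVec, ← Matrix.mulVec_transpose, Matrix.mulVec_mulVec, hTB,
            Matrix.one_mulVec]
        simpa [dotProduct, pow_two] using this }
  obtain ⟨l, -, hl⟩ := (f.toLinearIsometryEquiv rfl).reflections_generate_dim
  obtain ⟨x, hx, C, hC, h⟩ := twistedAct_pin_reflection l
  have hBC : C = B.1 := by
    apply Matrix.toLin'.injective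
    apply LinearMap.ext
    intro v
    rw [Matrix.toLin'_apply, Matrix.toLin'_apply, ← h (WithLp.toLp 2 v), ← hl]
    rfl
  subst hBC
  have hi : CliffordAlgebra.involute x = x := by rw [hC.2.2, hdet, one_smul]
  have hev : x ∈ CliffordAlgebra.even (negSq n) := mem_even_of_involute_eq hi
  refine ⟨⟨x, spinGroup.mem_iff.2 ⟨hx, hev⟩⟩, rho_unique _ (spinRho_spec _) fun v => ?_⟩
  have := hC.2.1 v
  rwa [hi] at this

/-- The element `-1` of `Spin(n)`. -/
noncomputable def spinNegOne {n : ℕ} (hn : 0 < n) : Spin n :=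
  ⟨-1, by
    have hsq := clE_mul_self (⟨0, hn⟩ : Fin n)
    refine spinGroup.mem_iff.2 ⟨pinGroup.mem_iff.2 ⟨?_, ?_⟩, neg_mem (one_mem _)⟩
    · let e : (Cl n)ˣ := ⟨clE ⟨0, hn⟩, -clE ⟨0, hn⟩, by rw [mul_neg, hsq, neg_neg],
          by rw [neg_mul, hsq, neg_neg]⟩
      have he : e ∈ lipschitzGroup (negSq n) := Subgroup.subset_closure ⟨_, rfl⟩
      exact ⟨e * e, mul_mem he he, hsq⟩
    · rw [Unitary.mem_iff]; simp⟩

theorem coe_spinNegOne {n : ℕ} (hn : 0 < n) : (spinNegOne hn : Cl n) = -1 := rfl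

theorem spinRho_spinNegOne {n : ℕ} (hn : 0 < n) : spinRho n (spinNegOne hn) = 1 :=
  rho_unique _ (spinRho_spec _) fun v => by
    rw [coe_spinNegOne, OneMemClass.coe_one, Matrix.one_mulVec]; simp

/-- The local section of `Spin(n) → SO(n)` near `1`, given by an explicit formula. -/
theorem exists_spin_of_pos {n : ℕ} (hn : 0 < n) (B : SOrth n) (hB : 0 < clScal (clLine B.1)) :
    ∃ a : Spin n, spinRho n a = B ∧
      (a : Cl n) = (Real.sqrt (clScal (clLine B.1)))⁻¹ • clLine B.1 := by
  obtain ⟨a, rfl⟩ := spinRho_surjective n B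
  have key : ∀ b : Spin n, 0 < clScal (b : Cl n) →
      (b : Cl n) = (Real.sqrt (clScal (clLine (spinRho n b).1)))⁻¹ • clLine (spinRho n b).1 := by
    intro b hb
    rw [clLine_spinRho, map_smul, smul_eq_mul, Real.sqrt_mul_self hb.le, smul_smul,
      inv_mul_cancel₀ hb.ne', one_smul]
  have h0 : clScal (a : Cl n) ≠ 0 := by
    rintro h0
    rw [clLine_spinRho, h0, zero_smul, map_zero] at hB
    exact lt_irrefl _ hB
  -- Of the two preimages `±a`, the formula gives the one with positive scalar part.
  rcases lt_or_gt_of_ne h0 with h | h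
  · refine ⟨spinNegOne hn * a, by rw [map_mul, spinRho_spinNegOne, one_mul], ?_⟩
    have := key (spinNegOne hn * a) (by
      rw [Submonoid.coe_mul, coe_spinNegOne, neg_one_mul, map_neg]; linarith)
    rwa [map_mul, spinRho_spinNegOne, one_mul] at this
  · exact ⟨a, rfl, key a h⟩

theorem clScal_clLine_one_pos (n : ℕ) : 0 < clScal (clLine (1 : Matrix (Fin n) (Fin n) ℝ)) := by
  have h := clLine_spinRho (1 : Spin n)
  rw [map_one, OneMemClass.coe_one, OneMemClass.coe_one] at h
  rw [h, map_smul, smul_eq_mul]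
  exact mul_pos (clScal_one_pos n) (clScal_one_pos n)

theorem inv_sqrt_smul_clLine_one (n : ℕ) :
    (Real.sqrt (clScal (clLine (1 : Matrix (Fin n) (Fin n) ℝ))))⁻¹ •
      clLine (1 : Matrix (Fin n) (Fin n) ℝ) = 1 := by
  have h := clLine_spinRho (1 : Spin n)
  rw [map_one, OneMemClass.coe_one, OneMemClass.coe_one] at h
  rw [h, map_smul, smul_eq_mul, Real.sqrt_mul_self (clScal_one_pos n).le, smul_smul,
      inv_mul_cancel₀ (clScal_one_pos n).ne', one_smul]

/-- The principal square root on the circle, by formulas which show that it is smooth. -/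
theorem exists_circle_sqrt (z : Circle) (hz : -1 < (z : ℂ).re) :
    ∃ w : Circle, w * w = z ∧ (w : ℂ).re = Real.sqrt ((1 + (z : ℂ).re) / 2) ∧
      (w : ℂ).im = (z : ℂ).im / (2 * Real.sqrt ((1 + (z : ℂ).re) / 2)) := by
  set r := Real.sqrt ((1 + (z : ℂ).re) / 2) with hr
  have hr0 : 0 < r := Real.sqrt_pos.2 (by linarith)
  have hr2 : r ^ 2 = (1 + (z : ℂ).re) / 2 := Real.sq_sqrt (by linarith)
  have hz1 : (z : ℂ).re ^ 2 + (z : ℂ).im ^ 2 = 1 := by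
    have := Circle.normSq_coe z
    rw [Complex.normSq_apply] at this
    linarith
  let c : ℂ := ⟨r, (z : ℂ).im / (2 * r)⟩
  have hc : c ∈ Submonoid.unitSphere ℂ := by
    rw [show c ∈ Submonoid.unitSphere ℂ ↔ ‖c‖ = 1 from mem_sphere_zero_iff_norm, ← sq_eq_sq₀ (norm_nonneg _) zero_le_one, ← Complex.normSq_eq_norm_sq,
      Complex.normSq_apply]
    change r * r + (z : ℂ).im / (2 * r) * ((z : ℂ).im / (2 * r)) = _
    field_simp
    nlinarith
  refine ⟨⟨c, hc⟩, Circle.ext (Complex.ext ?_ ?_), rfl, rfl⟩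
  · change r * r - (z : ℂ).im / (2 * r) * ((z : ℂ).im / (2 * r)) = _
    field_simp
    nlinarith
  · change r * ((z : ℂ).im / (2 * r)) + (z : ℂ).im / (2 * r) * r = _
    field_simp
    ring

/-! ### Smooth maps into embedded groups -/

section GroupSmooth

open Set

variable {E : Type*} [NormedAddCommGroup E] [NormedSpace ℝ E] {H : Type*} [TopologicalSpace H]
  {I : ModelWithCorners ℝ E H} {X : Type*} [TopologicalSpace X] [ChartedSpace H X]
  {E' : Type*} [NormedAddCommGroup E'] [NormedSpace ℝ E'] {H' : Type*} [TopologicalSpace H']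
  {I' : ModelWithCorners ℝ E' H'} {X' : Type*} [TopologicalSpace X'] [ChartedSpace H' X']
  {G : Type} [EmbeddedGroup G] {K : Type} [EmbeddedGroup K]

variable (I) in
/-- The variant of `SmoothInto` for a manifold over an arbitrary model with corners. -/
def GSmoothOn (g : X → G) (U : Set X) : Prop :=
  ∀ c ∈ EmbeddedGroup.coords (G := G), ContMDiffOn I 𝓘(ℝ, ℝ) ∞ (fun x => c (g x)) U

theorem GSmoothOn.comp {g : X' → G} {V : Set X'} {f : X → X'} {U : Set X} (hg : GSmoothOn I' g V)
    (hf : ContMDiffOn I I' ∞ f U) (h : MapsTo f U V) : GSmoothOn I (fun x => g (f x)) U :=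
  fun c hc => (hg c hc).comp hf h

theorem GSmoothOn.mono {g : X → G} {U V : Set X} (hg : GSmoothOn I g V) (h : U ⊆ V) :
    GSmoothOn I g U :=
  fun c hc => (hg c hc).mono h

theorem GSmoothOn.congr {g g' : X → G} {U : Set X} (hg : GSmoothOn I g U)
    (h : ∀ x ∈ U, g' x = g x) : GSmoothOn I g' U :=
  fun c hc => (hg c hc).congr fun x hx => by rw [h x hx]

theorem gSmoothOn_const (g : G) (U : Set X) : GSmoothOn I (fun _ => g) U :=
  fun _ _ => contMDiffOn_const

theorem GSmoothOn.prodMk {g : X → G} {k : X → K} {U : Set X} (hg : GSmoothOn I g U)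
    (hk : GSmoothOn I k U) : GSmoothOn I (fun x => (g x, k x)) U := by
  rintro _ (⟨c, hc, rfl⟩ | ⟨c, hc, rfl⟩)
  · exact hg c hc
  · exact hk c hc

theorem GSmoothOn.fst {g : X → G × K} {U : Set X} (hg : GSmoothOn I g U) :
    GSmoothOn I (fun x => (g x).1) U :=
  fun c hc => hg (fun p => c p.1) (Or.inl ⟨c, hc, rfl⟩)

theorem GSmoothOn.snd {g : X → G × K} {U : Set X} (hg : GSmoothOn I g U) :
    GSmoothOn I (fun x => (g x).2) U :=
  fun c hc => hg (fun p => c p.2) (Or.inr ⟨c, hc, rfl⟩)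

theorem gSmoothOn_gl {g : X → GLTwoPos} {U : Set X} :
    GSmoothOn I g U ↔ ∀ i j, ContMDiffOn I 𝓘(ℝ, ℝ) ∞ (fun x => glMat (g x) i j) U :=
  ⟨fun h i j => h _ ⟨i, j, rfl⟩, by rintro h _ ⟨i, j, rfl⟩; exact h i j⟩

theorem gSmoothOn_so {n : ℕ} {g : X → SOrth n} {U : Set X} :
    GSmoothOn I g U ↔ ∀ i j, ContMDiffOn I 𝓘(ℝ, ℝ) ∞ (fun x => (g x).1 i j) U :=
  ⟨fun h i j => h _ ⟨i, j, rfl⟩, by rintro h _ ⟨i, j, rfl⟩; exact h i j⟩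

theorem gSmoothOn_circle {g : X → Circle} {U : Set X} :
    GSmoothOn I g U ↔ ContMDiffOn I 𝓘(ℝ, ℝ) ∞ (fun x => (g x : ℂ).re) U ∧
      ContMDiffOn I 𝓘(ℝ, ℝ) ∞ (fun x => (g x : ℂ).im) U :=
  ⟨fun h => ⟨h _ (Or.inl rfl), h _ (Or.inr rfl)⟩, by
    rintro ⟨h1, h2⟩ _ (rfl | rfl)
    · exact h1
    · exact h2⟩

theorem GSmoothOn.gl_mul {g k : X → GLTwoPos} {U : Set X} (hg : GSmoothOn I g U)
    (hk : GSmoothOn I k U) : GSmoothOn I (fun x => g x * k x) U := by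
  rw [gSmoothOn_gl] at *
  intro i j
  simp only [glMat_mul, Matrix.mul_apply]
  exact contMDiffOn_finsetSum fun l _ => (hg i l).mul (hk l j)

theorem glMat_inv (A : GLTwoPos) : glMat A⁻¹ = (glMat A)⁻¹ := by
  refine (Matrix.inv_eq_left_inv ?_).symm
  rw [← glMat_mul, inv_mul_cancel, glMat_one]

theorem glMat_det_pos (A : GLTwoPos) : 0 < (glMat A).det := A.2

theorem GSmoothOn.gl_inv {g : X → GLTwoPos} {U : Set X} (hg : GSmoothOn I g U) :
    GSmoothOn I (fun x => (g x)⁻¹) U := by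
  rw [gSmoothOn_gl] at *
  have hd : ContMDiffOn I 𝓘(ℝ, ℝ) ∞ (fun x => ((glMat (g x)).det)⁻¹) U := by
    refine ContMDiffOn.inv₀ ?_ fun x _ => (glMat_det_pos _).ne'
    simp only [Matrix.det_fin_two]
    exact ((hg 0 0).mul (hg 1 1)).sub ((hg 0 1).mul (hg 1 0))
  intro i j
  have : ∀ x, glMat (g x)⁻¹ i j = ((glMat (g x)).det)⁻¹ * (glMat (g x)).adjugate i j := by
    intro x
    rw [glMat_inv, Matrix.inv_def, Matrix.smul_apply, smul_eq_mul, Ring.inverse_eq_inv']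
  simp only [this]
  refine hd.mul ?_
  simp only [Matrix.adjugate_fin_two]
  fin_cases i <;> fin_cases j <;> simp <;>
    first | exact hg _ _ | exact (hg _ _).neg

theorem GSmoothOn.so_mul {n : ℕ} {g k : X → SOrth n} {U : Set X} (hg : GSmoothOn I g U)
    (hk : GSmoothOn I k U) : GSmoothOn I (fun x => g x * k x) U := by
  rw [gSmoothOn_so] at *
  intro i j
  simp only [Submonoid.coe_mul, Matrix.mul_apply]
  exact contMDiffOn_finsetSum fun l _ => (hg i l).mul (hk l j)

theorem GSmoothOn.so_inv {n : ℕ} {g : X → SOrth n} {U : Set X} (hg : GSmoothOn I g U) :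
    GSmoothOn I (fun x => (g x)⁻¹) U := by
  rw [gSmoothOn_so] at *
  exact fun i j => hg j i

theorem GSmoothOn.gZero_mul {n : ℕ} {g k : X → GZero n} {U : Set X} (hg : GSmoothOn I g U)
    (hk : GSmoothOn I k U) : GSmoothOn I (fun x => g x * k x) U :=
  (hg.fst.gl_mul hk.fst).prodMk (hg.snd.so_mul hk.snd)

theorem GSmoothOn.gZero_inv {n : ℕ} {g : X → GZero n} {U : Set X} (hg : GSmoothOn I g U) :
    GSmoothOn I (fun x => (g x)⁻¹) U :=
  hg.fst.gl_inv.prodMk hg.snd.so_inv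

theorem GSmoothOn.circle_mul {g k : X → Circle} {U : Set X} (hg : GSmoothOn I g U)
    (hk : GSmoothOn I k U) : GSmoothOn I (fun x => g x * k x) U := by
  rw [gSmoothOn_circle] at *
  simp only [Circle.coe_mul, Complex.mul_re, Complex.mul_im]
  exact ⟨(hg.1.mul hk.1).sub (hg.2.mul hk.2), (hg.1.mul hk.2).add (hg.2.mul hk.1)⟩

theorem GSmoothOn.circle_inv {g : X → Circle} {U : Set X} (hg : GSmoothOn I g U) :
    GSmoothOn I (fun x => (g x)⁻¹) U := by
  rw [gSmoothOn_circle] at *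
  simp only [Circle.coe_inv_eq_conj, Complex.conj_re, Complex.conj_im]
  exact ⟨hg.1, hg.2.neg⟩

theorem gSmoothOn_circleExp {f : X → ℝ} {U : Set X} (hf : ContMDiffOn I 𝓘(ℝ, ℝ) ∞ f U) :
    GSmoothOn I (fun x => Circle.exp (f x)) U := by
  rw [gSmoothOn_circle]
  simp only [Circle.coe_exp, Complex.exp_ofReal_mul_I_re, Complex.exp_ofReal_mul_I_im]
  exact ⟨Real.contDiff_cos.contMDiff.comp_contMDiffOn hf,
    Real.contDiff_sin.contMDiff.comp_contMDiffOn hf⟩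

end GroupSmooth

/-! ### Principal bundles -/

section Bundle

open Set Filter Topology

variable {E : Type*} [NormedAddCommGroup E] [NormedSpace ℝ E] [FiniteDimensional ℝ E]
  {H : Type*} [TopologicalSpace H] {I : ModelWithCorners ℝ E H} [I.Boundaryless]
  {X : Type*} [TopologicalSpace X] [ChartedSpace H X] [IsManifold I ∞ X]
  {G : Type} [Group G] [EmbeddedGroup G]
  {p d : ℕ} {P N : Type*} [TopologicalSpace P] [ChartedSpace (EuclideanSpace ℝ (Fin p)) P]
  [TopologicalSpace N] [ChartedSpace (EuclideanSpace ℝ (Fin d)) N]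

/-- The action of a principal bundle, composed with smooth maps to the total space and to the group,
is smooth. A bump function extends the map to the group, in a chart, to the whole model space. -/
theorem PrincipalBundle.contMDiffOn_act (B : PrincipalBundle G p P d N) {U : Set X}
    (hU : IsOpen U) {f : X → P} {g : X → G} (hf : ContMDiffOn I (𝓡 p) ∞ f U)
    (hg : GSmoothOn I g U) : ContMDiffOn I (𝓡 p) ∞ (fun x => B.act (f x) (g x)) U := by
  intro x₀ hx₀
  set k := Module.finrank ℝ E
  let T : E ≃L[ℝ] EuclideanSpace ℝ (Fin k) := toEuclidean
  let e := extChartAt I x₀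
  have hcont : ContinuousAt e.symm (e x₀) := continuousAt_extChartAt_symm x₀
  have hV : ∀ᶠ y in 𝓝 (T (e x₀)), T.symm y ∈ e.target ∧ e.symm (T.symm y) ∈ U := by
    have hT : Tendsto T.symm (𝓝 (T (e x₀))) (𝓝 (e x₀)) := by
      have := T.symm.continuous.tendsto (T (e x₀))
      rwa [T.symm_apply_apply] at this
    refine (hT.eventually_mem (extChartAt_target_mem_nhds (I := I) x₀)).and
      (hT.eventually (hcont.eventually_mem ?_))
    rw [show e.symm (e x₀) = x₀ from extChartAt_to_inv x₀]
    exact hU.mem_nhds hx₀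
  obtain ⟨r, hr, hball⟩ := Metric.eventually_nhds_iff_ball.1 hV
  let χ : ContDiffBump (T (e x₀)) := ⟨r / 2, r, by positivity, by linarith⟩
  -- `ρ` maps the model space into a small ball and is the identity near its centre.
  let ρ : EuclideanSpace ℝ (Fin k) → EuclideanSpace ℝ (Fin k) :=
    fun y => T (e x₀) + χ y • (y - T (e x₀))
  have hρ : ContDiff ℝ ∞ ρ :=
    contDiff_const.add (χ.contDiff.smul (contDiff_id.sub contDiff_const))
  have hρb : ∀ y, ρ y ∈ Metric.ball (T (e x₀)) r := by
    intro y
    rw [Metric.mem_ball, dist_eq_norm, add_sub_cancel_left, norm_smul, Real.norm_of_nonneg χ.nonneg]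
    by_cases hy : dist y (T (e x₀)) < r
    · refine lt_of_le_of_lt (mul_le_of_le_one_left (norm_nonneg _) χ.le_one) ?_
      rwa [dist_eq_norm] at hy
    · rw [χ.zero_of_le_dist (not_lt.1 hy), zero_mul]
      exact hr
  have hc : SmoothInto k (fun y => g (e.symm (T.symm (ρ y)))) univ := by
    refine GSmoothOn.comp (I := 𝓡 k) (f := fun y => e.symm (T.symm (ρ y))) hg ?_
      fun y _ => (hball _ (hρb y)).2
    refine (contMDiffOn_extChartAt_symm x₀).comp (t := e.target) ?_ fun y _ => (hball _ (hρb y)).1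
    exact ((T.symm.contDiff.comp hρ).contMDiff).contMDiffOn
  have hact := B.smooth_act k _ hc
  have hTe : ContMDiffAt I (𝓡 k) ∞ (fun x => T (e x)) x₀ :=
    T.contDiff.contMDiff.contMDiffAt.comp x₀ contMDiffAt_extChartAt
  have hfx : ContMDiffAt I (𝓡 p) ∞ f x₀ := hf.contMDiffAt (hU.mem_nhds hx₀)
  have h1 := hact.contMDiffAt.comp x₀ (hTe.prodMk hfx)
  refine (h1.congr_of_eventuallyEq ?_).contMDiffWithinAt
  have h2 : ∀ᶠ x in 𝓝 x₀, χ (T (e x)) = 1 :=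
    hTe.continuousAt.eventually χ.eventuallyEq_one
  filter_upwards [h2, extChartAt_source_mem_nhds (I := I) x₀] with x hx hxs
  simp only [Function.comp_apply, ρ, hx, one_smul, add_sub_cancel,
    ContinuousLinearEquiv.symm_apply_apply]
  rw [show e.symm (e x) = x from e.left_inv hxs]

theorem PrincipalBundle.contMDiff_act_const [IsManifold (𝓡 p) ∞ P] (B : PrincipalBundle G p P d N)
    (g : G) : ContMDiff (𝓡 p) (𝓡 p) ∞ (fun u => B.act u g) :=
  contMDiffOn_univ.1 (B.contMDiffOn_act isOpen_univ contMDiffOn_id (gSmoothOn_const g _))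

theorem PrincipalBundle.act_inj (B : PrincipalBundle G p P d N) {u : P} {g h : G}
    (hgh : B.act u g = B.act u h) : g = h :=
  (B.existsUnique_act u (B.act u h) (B.proj_act u h).symm).unique hgh rfl

theorem PrincipalBundle.act_inv_mul (B : PrincipalBundle G p P d N) {s u v : P} {g h : G}
    (hu : B.act s g = u) (hv : B.act s h = v) : B.act u (g⁻¹ * h) = v := by
  rw [← hu, ← B.act_mul, mul_inv_cancel_left, hv]

/-- There is a local section through every point. -/
theorem PrincipalBundle.exists_section [IsManifold (𝓡 d) ∞ N] (B : PrincipalBundle G p P d N)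
    (u : P) : ∃ U : Set N, IsOpen U ∧ B.proj u ∈ U ∧ ∃ s : N → P, ContMDiffOn (𝓡 d) (𝓡 p) ∞ s U ∧
      (∀ y ∈ U, B.proj (s y) = y) ∧ s (B.proj u) = u := by
  obtain ⟨U, hU, hx, s, τ, hs, hps, -, hτ⟩ := B.locally_trivial (B.proj u)
  refine ⟨U, hU, hx, fun y => B.act (s y) (τ u),
    B.contMDiffOn_act hU hs (gSmoothOn_const _ _), fun y hy => ?_, hτ u hx⟩
  rw [B.proj_act, hps y hy]

theorem PrincipalBundle.surjective_proj (B : PrincipalBundle G p P d N) :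
    Function.Surjective B.proj := fun x => by
  obtain ⟨U, -, hx, s, -, -, hps, -⟩ := B.locally_trivial x
  exact ⟨s x, hps x hx⟩

theorem PrincipalBundle.surjective_mfderiv_proj [IsManifold (𝓡 d) ∞ N]
    (B : PrincipalBundle G p P d N) (u : P) :
    Function.Surjective (mfderiv (𝓡 p) (𝓡 d) B.proj u) := by
  obtain ⟨U, hU, hx, s, hs, hps, hsu⟩ := B.exists_section u
  have hsd : MDifferentiableAt (𝓡 d) (𝓡 p) s (B.proj u) :=
    (hs.contMDiffAt (hU.mem_nhds hx)).mdifferentiableAt (by simp)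
  have hpd : MDifferentiableAt (𝓡 p) (𝓡 d) B.proj (s (B.proj u)) :=
    B.smooth_proj.mdifferentiableAt (by simp)
  have h := mfderiv_comp (B.proj u) hpd hsd
  have h2 : mfderiv (𝓡 d) (𝓡 d) (B.proj ∘ s) (B.proj u) = ContinuousLinearMap.id ℝ _ := by
    rw [← mfderiv_id (I := 𝓡 d) (x := B.proj u)]
    refine Filter.EventuallyEq.mfderiv_eq ?_
    filter_upwards [hU.mem_nhds hx] with y hy using hps y hy
  have key : Function.Surjective (mfderiv (𝓡 p) (𝓡 d) B.proj (s (B.proj u))) := fun v =>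
    ⟨mfderiv (𝓡 d) (𝓡 p) s (B.proj u) v, congrArg (fun L => L v) (h.symm.trans h2)⟩
  rwa [hsu] at key

end Bundle

/-! ### Pullback bundles -/

section Pullback

open Set Filter Topology

variable {E : Type*} [NormedAddCommGroup E] [NormedSpace ℝ E] {H : Type*} [TopologicalSpace H]
  {I : ModelWithCorners ℝ E H} {X : Type*} [TopologicalSpace X] [ChartedSpace H X]
  {p p' e p₀ d : ℕ} {P P' P₀ N M : Type*}
  [TopologicalSpace P] [ChartedSpace (EuclideanSpace ℝ (Fin p)) P]
  [TopologicalSpace P'] [ChartedSpace (EuclideanSpace ℝ (Fin p')) P']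
  [TopologicalSpace P₀] [ChartedSpace (EuclideanSpace ℝ (Fin p₀)) P₀]
  [TopologicalSpace N] [ChartedSpace (EuclideanSpace ℝ (Fin e)) N]

variable (p e p₀) in
/-- By the maps `δ : P → N` and `t : P → P₀`, the manifold `P` is the fibre product of `q : N → M`
and `π : P₀ → M`. The smooth structure is described by local smooth extensions to `N × P₀` of the
inverse of the bijection from `P` to the fibre product. -/
structure IsFibreProduct (δ : P → N) (t : P → P₀) (q : N → M) (π : P₀ → M) : Prop where
  smooth_fst : ContMDiff (𝓡 p) (𝓡 e) ∞ δ
  smooth_snd : ContMDiff (𝓡 p) (𝓡 p₀) ∞ t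
  comm : ∀ u, q (δ u) = π (t u)
  inj : ∀ u v, δ u = δ v → t u = t v → u = v
  surj : ∀ x w, q x = π w → ∃ u, δ u = x ∧ t u = w
  exists_local : ∀ u, ∃ Ψ : N × P₀ → P,
    ContMDiffAt ((𝓡 e).prod (𝓡 p₀)) (𝓡 p) ∞ Ψ (δ u, t u) ∧
    ∀ᶠ y in 𝓝 (δ u, t u), ∀ v, (δ v, t v) = y → Ψ y = v

/-- A map into a fibre product is smooth if its components are. -/
theorem IsFibreProduct.contMDiffAt {δ : P → N} {t : P → P₀} {q : N → M} {π : P₀ → M}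
    (h : IsFibreProduct p e p₀ δ t q π) {f : X → P} {x : X}
    (h1 : ContMDiffAt I (𝓡 e) ∞ (fun y => δ (f y)) x)
    (h2 : ContMDiffAt I (𝓡 p₀) ∞ (fun y => t (f y)) x) : ContMDiffAt I (𝓡 p) ∞ f x := by
  obtain ⟨Ψ, hΨ, hev⟩ := h.exists_local (f x)
  have h3 : ContMDiffAt I ((𝓡 e).prod (𝓡 p₀)) ∞ (fun y => (δ (f y), t (f y))) x := h1.prodMk h2
  refine (ContMDiffAt.comp x (g := Ψ) hΨ h3).congr_of_eventuallyEq ?_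
  filter_upwards [h3.continuousAt.eventually hev] with y hy using (hy _ rfl).symm

theorem IsFibreProduct.contMDiff {δ : P → N} {t : P → P₀} {q : N → M} {π : P₀ → M}
    (h : IsFibreProduct p e p₀ δ t q π) {f : X → P} (h1 : ContMDiff I (𝓡 e) ∞ (fun y => δ (f y)))
    (h2 : ContMDiff I (𝓡 p₀) ∞ (fun y => t (f y))) : ContMDiff I (𝓡 p) ∞ f :=
  fun x => h.contMDiffAt (h1 x) (h2 x)

/-- If `v` is a smooth function of `(δ(v), t(v))`, then `(δ, t)` is an immersion. -/
theorem mfderiv_eq_zero_of_local_inverse {δ : P → N} {t : P → P₀} {u : P}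
    (h1 : MDifferentiableAt (𝓡 p) (𝓡 e) δ u) (h2 : MDifferentiableAt (𝓡 p) (𝓡 p₀) t u)
    {Ψ : N × P₀ → P} (hΨ : MDifferentiableAt ((𝓡 e).prod (𝓡 p₀)) (𝓡 p) Ψ (δ u, t u))
    (hev : ∀ᶠ v in 𝓝 u, Ψ (δ v, t v) = v) {v : TangentSpace (𝓡 p) u}
    (hv1 : mfderiv (𝓡 p) (𝓡 e) δ u v = 0) (hv2 : mfderiv (𝓡 p) (𝓡 p₀) t u v = 0) : v = 0 := by
  have h3 := mfderiv_comp (f := fun v => (δ v, t v)) u hΨ (h1.prodMk h2)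
  have h4 : mfderiv (𝓡 p) (𝓡 p) (Ψ ∘ fun v => (δ v, t v)) u = ContinuousLinearMap.id ℝ _ := by
    rw [← mfderiv_id (I := 𝓡 p) (x := u)]
    exact Filter.EventuallyEq.mfderiv_eq hev
  rw [mfderiv_prodMk h1 h2] at h3
  have h5 := congrArg (fun L => L v) (h4.symm.trans h3)
  refine h5.trans ?_
  change mfderiv ((𝓡 e).prod (𝓡 p₀)) (𝓡 p) Ψ (δ u, t u)
    (mfderiv (𝓡 p) (𝓡 e) δ u v, mfderiv (𝓡 p) (𝓡 p₀) t u v) = 0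
  rw [hv1, hv2]
  exact map_zero _

theorem IsFibreProduct.mfderiv_eq_zero {δ : P → N} {t : P → P₀} {q : N → M} {π : P₀ → M}
    (h : IsFibreProduct p e p₀ δ t q π) {u : P} {v : TangentSpace (𝓡 p) u}
    (hv1 : mfderiv (𝓡 p) (𝓡 e) δ u v = 0) (hv2 : mfderiv (𝓡 p) (𝓡 p₀) t u v = 0) : v = 0 := by
  obtain ⟨Ψ, hΨ, hev⟩ := h.exists_local u
  have h1 := h.smooth_fst.contMDiffAt (x := u)
  have h2 := h.smooth_snd.contMDiffAt (x := u)
  refine mfderiv_eq_zero_of_local_inverse (h1.mdifferentiableAt (by simp))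
    (h2.mdifferentiableAt (by simp)) (hΨ.mdifferentiableAt (by simp)) ?_ hv1 hv2
  filter_upwards [(h1.continuousAt.prodMk h2.continuousAt).eventually hev] with v hv using hv v rfl

/-- Fibre products of the same maps are diffeomorphic. -/
theorem IsFibreProduct.exists_diffeomorph {δ : P → N} {t : P → P₀} {δ' : P' → N} {t' : P' → P₀}
    {q : N → M} {π : P₀ → M} (h : IsFibreProduct p e p₀ δ t q π) (h' : IsFibreProduct p' e p₀ δ' t' q π) :
    ∃ f : Diffeomorph (𝓡 p) (𝓡 p') P P' ∞, ∀ u, δ' (f u) = δ u ∧ t' (f u) = t u := by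
  choose f hf using fun u => h'.surj (δ u) (t u) (h.comm u)
  choose g hg using fun u => h.surj (δ' u) (t' u) (h'.comm u)
  refine ⟨⟨⟨f, g, fun u => ?_, fun u => ?_⟩, ?_, ?_⟩, hf⟩
  · exact h.inj _ _ ((hg _).1.trans (hf _).1) ((hg _).2.trans (hf _).2)
  · exact h'.inj _ _ ((hf _).1.trans (hg _).1) ((hf _).2.trans (hg _).2)
  · exact h'.contMDiff (h.smooth_fst.congr fun u => (hf u).1)
      (h.smooth_snd.congr fun u => (hf u).2)
  · exact h.contMDiff (h'.smooth_fst.congr fun u => (hg u).1)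
      (h'.smooth_snd.congr fun u => (hg u).2)

/-- The total space of a `G₀`-bundle with a morphism to another `G₀`-bundle is the pullback of the
latter. -/
theorem IsBundleMap.isFibreProduct {n : ℕ} [TopologicalSpace M]
    [ChartedSpace (EuclideanSpace ℝ (Fin d)) M] [IsManifold (𝓡 e) ∞ N] [IsManifold (𝓡 p₀) ∞ P₀]
    {B : PrincipalBundle (GZero n) p P e N} {S : PrincipalBundle (GZero n) p₀ P₀ d M} {q : N → M}
    {q₀ : P → P₀} (hq : Continuous q) (h : IsBundleMap B S (MonoidHom.id _) q q₀) :
    IsFibreProduct p e p₀ B.proj q₀ q S.proj where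
  smooth_fst := B.smooth_proj
  smooth_snd := h.smooth
  comm u := (h.covers u).symm
  inj u v h1 h2 := by
    obtain ⟨g, rfl, -⟩ := B.existsUnique_act u v h1
    rw [h.equivariant, ← S.act_one (q₀ u), ← S.act_mul, one_mul] at h2
    have h3 : 1 = g := S.act_inj h2
    rw [← h3, B.act_one]
  surj x w hxw := by
    obtain ⟨u, rfl⟩ := B.surjective_proj x
    obtain ⟨g, hg, -⟩ := S.existsUnique_act (q₀ u) w ((h.covers u).trans hxw)
    exact ⟨B.act u g, B.proj_act u g, (h.equivariant u g).trans hg⟩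
  -- The point over `(x, w)` is `s(x) g`, where `g` is the difference of `q₀(s(x))` and `w`.
  exists_local u := by
    obtain ⟨U, hU, hx, s, τ, hs, hps, hτ, hsτ⟩ := B.locally_trivial (B.proj u)
    obtain ⟨U₀, hU₀, hm, s₀, τ₀, hs₀, hps₀, hτ₀, hsτ₀⟩ := S.locally_trivial (q (B.proj u))
    set W : Set (N × P₀) := {y | y.1 ∈ U ∩ q ⁻¹' U₀ ∧ y.2 ∈ S.proj ⁻¹' U₀} with hWdef
    have hW : IsOpen W := ((hU.inter (hU₀.preimage hq)).preimage continuous_fst).inter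
      ((hU₀.preimage S.smooth_proj.continuous).preimage continuous_snd)
    have hmem : (B.proj u, q₀ u) ∈ W := ⟨⟨hx, hm⟩, by
      change S.proj (q₀ u) ∈ U₀
      rwa [h.covers]⟩
    have hfst : ContMDiffOn ((𝓡 e).prod (𝓡 p₀)) (𝓡 p) ∞ (fun y : N × P₀ => s y.1) W :=
      hs.comp contMDiffOn_fst fun y hy => hy.1.1
    have hτs : GSmoothOn ((𝓡 e).prod (𝓡 p₀)) (fun y : N × P₀ => τ₀ (q₀ (s y.1))) W :=
      GSmoothOn.comp (I' := 𝓡 p₀) hτ₀ (h.smooth.comp_contMDiffOn hfst) fun y hy => by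
        change S.proj (q₀ (s y.1)) ∈ U₀
        rw [h.covers, hps _ hy.1.1]
        exact hy.1.2
    have hτw : GSmoothOn ((𝓡 e).prod (𝓡 p₀)) (fun y : N × P₀ => τ₀ y.2) W :=
      GSmoothOn.comp (I' := 𝓡 p₀) hτ₀ contMDiffOn_snd fun y hy => hy.2
    refine ⟨fun y => B.act (s y.1) ((τ₀ (q₀ (s y.1)))⁻¹ * τ₀ y.2),
      (B.contMDiffOn_act hW hfst (hτs.gZero_inv.gZero_mul hτw)).contMDiffAt (hW.mem_nhds hmem), ?_⟩
    filter_upwards [hW.mem_nhds hmem]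
    rintro _ hy v rfl
    have hv : B.proj v ∈ U := hy.1.1
    have h1 := hsτ v hv
    have hsm : S.proj (q₀ (s (B.proj v))) = q (B.proj v) := by rw [h.covers, hps _ hv]
    have h2 := hsτ₀ (q₀ (s (B.proj v))) (by
      change S.proj _ ∈ U₀
      rw [hsm]
      exact hy.1.2)
    have h3 := hsτ₀ (q₀ v) hy.2
    have h4 : τ₀ (q₀ v) = τ₀ (q₀ (s (B.proj v))) * τ v := by
      refine S.act_inj (u := s₀ (q (B.proj v))) ?_
      rw [S.act_mul, ← hsm, h2, hsm, ← h.covers v, h3]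
      conv_lhs => rw [← h1]
      exact h.equivariant _ _
    change B.act (s (B.proj v)) ((τ₀ (q₀ (s (B.proj v))))⁻¹ * τ₀ (q₀ v)) = v
    rw [h4, inv_mul_cancel_left, h1]

end Pullback

/-! ### The covering `G₀ᶜ → G₀ × U(1)` -/

section Covering

open Set Filter Topology

variable {E : Type*} [NormedAddCommGroup E] [NormedSpace ℝ E] {H : Type*} [TopologicalSpace H]
  {I : ModelWithCorners ℝ E H} {X : Type*} [TopologicalSpace X] [ChartedSpace H X] {n : ℕ}

/-- The operators are polynomial in the entries of `B`. -/
theorem contMDiffOn_clAvg {B : X → SOrth n} {U : Set X} (hB : GSmoothOn I B U) (L : List (Fin n))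
    (l : Cl n →ₗ[ℝ] ℝ) : ContMDiffOn I 𝓘(ℝ, ℝ) ∞ (fun x => l (clAvg (B x).1 L 1)) U := by
  rw [gSmoothOn_so] at hB
  induction L generalizing l with
  | nil =>
    change ContMDiffOn I 𝓘(ℝ, ℝ) ∞ (fun _ => l 1) U
    exact contMDiffOn_const
  | cons i L ih =>
    have h : ∀ x, l (clAvg (B x).1 (i :: L) 1) = l (clAvg (B x).1 L 1) -
        ∑ j, (B x).1 j i * (l ∘ₗ LinearMap.mulRight ℝ (clE i) ∘ₗ LinearMap.mulLeft ℝ (clE j))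
          (clAvg (B x).1 L 1) := by
      intro x
      have hv : (B x).1 *ᵥ Pi.single i 1 = ∑ j, (B x).1 j i • (Pi.single j 1 : Fin n → ℝ) := by
        ext k
        simp [Finset.sum_apply, Pi.single_apply]
      rw [clAvg_cons, clStep_apply, map_sub, hv, map_sum, Finset.sum_mul, Finset.sum_mul, map_sum]
      congr 1
      refine Finset.sum_congr rfl fun j _ => ?_
      rw [map_smul, smul_mul_assoc, smul_mul_assoc, map_smul]
      rfl
    simp only [h]
    exact (ih l).sub (contMDiffOn_finsetSum fun j _ => (hB j i).mul (ih _))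

theorem gSmoothOn_spinC {z : X → Circle} {a : X → Spin n} {U : Set X} (hz : GSmoothOn I z U)
    (ha : GSmoothOn I a U) :
    GSmoothOn I (fun x => (QuotientGroup.mk (z x, a x) : SpinC n)) U := by
  rintro _ ⟨l, rfl⟩
  rw [gSmoothOn_circle] at hz
  have h : ∀ x, l (spinCToAlgebra n (QuotientGroup.mk (z x, a x))) =
      (z x : ℂ).re * (l ∘ₗ TensorProduct.mk ℝ ℂ (Cl n) 1) (a x : Cl n) +
      (z x : ℂ).im * (l ∘ₗ TensorProduct.mk ℝ ℂ (Cl n) Complex.I) (a x : Cl n) := by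
    intro x
    change l ((z x : ℂ) ⊗ₜ[ℝ] (a x : Cl n)) = _ * l (1 ⊗ₜ[ℝ] (a x : Cl n)) +
      _ * l (Complex.I ⊗ₜ[ℝ] (a x : Cl n))
    have hz' : (z x : ℂ) = (z x : ℂ).re • (1 : ℂ) + (z x : ℂ).im • Complex.I := by
      rw [Complex.real_smul, Complex.real_smul, mul_one, Complex.re_add_im]
    conv_lhs => rw [hz', TensorProduct.add_tmul, map_add, ← TensorProduct.smul_tmul',
      ← TensorProduct.smul_tmul', map_smul, map_smul]
    rfl
  simp only [h]
  exact (hz.1.mul (ha _ ⟨_, rfl⟩)).add (hz.2.mul (ha _ ⟨_, rfl⟩))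

/-- Local lifts through the squaring map of the circle, translated to the principal branch of the square
root at `1`. -/
theorem exists_circle_lift {U : Set X} (hU : IsOpen U) {x₀ : X} (hx₀ : x₀ ∈ U)
    {z : X → Circle} (hz : GSmoothOn I z U) (z₀ : Circle) (hz₀ : z x₀ = z₀ ^ 2) :
    ∃ V, IsOpen V ∧ x₀ ∈ V ∧ V ⊆ U ∧ ∃ y : X → Circle, GSmoothOn I y V ∧ y x₀ = z₀ ∧
      ∀ x ∈ V, y x ^ 2 = z x := by
  let ζ : X → Circle := fun x => (z₀ ^ 2)⁻¹ * z x
  have hζ : GSmoothOn I ζ U := (gSmoothOn_const _ U).circle_mul hz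
  have hζ₀ : ζ x₀ = 1 := by simp [ζ, hz₀]
  rw [gSmoothOn_circle] at hζ
  have hV := hζ.1.continuousOn.isOpen_inter_preimage hU (isOpen_Ioi (a := (-1 : ℝ)))
  set V := U ∩ (fun x => (ζ x : ℂ).re) ⁻¹' Ioi (-1)
  have hVU : V ⊆ U := fun x hx => hx.1
  have hVz : ∀ x ∈ V, -1 < (ζ x : ℂ).re := fun x hx => hx.2
  have hx₀V : x₀ ∈ V := by
    refine ⟨hx₀, ?_⟩
    change -1 < (ζ x₀ : ℂ).re
    rw [hζ₀]
    simp
  have hex : ∀ x, ∃ y : Circle, x ∈ V → (y * y = ζ x ∧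
      (y : ℂ).re = Real.sqrt ((1 + (ζ x : ℂ).re) / 2) ∧
      (y : ℂ).im = (ζ x : ℂ).im / (2 * Real.sqrt ((1 + (ζ x : ℂ).re) / 2))) := by
    intro x
    by_cases hx : x ∈ V
    · obtain ⟨y, hy⟩ := exists_circle_sqrt (ζ x) (hVz x hx)
      exact ⟨y, fun _ => hy⟩
    · exact ⟨1, fun h => absurd h hx⟩
  choose y hay using hex
  have hsqrt' : ContMDiffOn I 𝓘(ℝ, ℝ) ∞ (fun x => Real.sqrt ((1 + (ζ x : ℂ).re) / 2)) V := by
    intro x hx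
    have h0 : (1 + (ζ x : ℂ).re) / 2 ≠ 0 := by linarith [hVz x hx]
    refine (Real.contDiffAt_sqrt h0).contMDiffAt.comp_contMDiffWithinAt x
      (f := fun x => (1 + (ζ x : ℂ).re) / 2) ?_
    have h3 : ContDiff ℝ ∞ (fun r : ℝ => (1 + r) / 2) := by fun_prop
    exact h3.contMDiff.contMDiffAt.comp_contMDiffWithinAt x (hζ.1.mono hVU x hx)
  have hy : GSmoothOn I y V := by
    rw [gSmoothOn_circle]
    refine ⟨hsqrt'.congr fun x hx => (hay x hx).2.1, ?_⟩
    have h2 : ContMDiffOn I 𝓘(ℝ, ℝ) ∞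
        (fun x => (2 * Real.sqrt ((1 + (ζ x : ℂ).re) / 2))⁻¹) V := by
      refine ContMDiffOn.inv₀ (contMDiffOn_const.mul hsqrt') fun x hx => ?_
      have : 0 < Real.sqrt ((1 + (ζ x : ℂ).re) / 2) :=
        Real.sqrt_pos.2 (by linarith [hVz x hx])
      positivity
    refine ((hζ.2.mono hVU).mul h2).congr fun x hx => ?_
    rw [(hay x hx).2.2, div_eq_mul_inv]
    rfl
  refine ⟨V, hV, hx₀V, hVU, fun x => z₀ * y x, (gSmoothOn_const _ V).circle_mul hy, ?_,
    fun x hx => ?_⟩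
  · have hy1 : y x₀ = 1 := by
      refine Circle.ext (Complex.ext ?_ ?_)
      · rw [(hay x₀ hx₀V).2.1, hζ₀]; norm_num
      · rw [(hay x₀ hx₀V).2.2, hζ₀]; norm_num
    simp only [hy1, mul_one]
  · rw [mul_pow, pow_two (y x), (hay x hx).1]
    exact mul_inv_cancel_left _ _

/-- Local lifts through `ρₙ`, translated to the local section of `ρₙ` near `1`. -/
theorem exists_spin_lift (hn : 0 < n) {U : Set X} (hU : IsOpen U) {x₀ : X} (hx₀ : x₀ ∈ U)
    {g : X → SOrth n} (hg : GSmoothOn I g U) (a₀ : Spin n) (hg₀ : g x₀ = spinRho n a₀) :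
    ∃ V, IsOpen V ∧ x₀ ∈ V ∧ V ⊆ U ∧ ∃ a : X → Spin n, GSmoothOn I a V ∧ a x₀ = a₀ ∧
      ∀ x ∈ V, spinRho n (a x) = g x := by
  let C : X → SOrth n := fun x => (spinRho n a₀)⁻¹ * g x
  have hC : GSmoothOn I C U := (gSmoothOn_const _ U).so_mul hg
  have hC₀ : C x₀ = 1 := by simp [C, hg₀]
  have hs : ContMDiffOn I 𝓘(ℝ, ℝ) ∞ (fun x => clScal (clLine (C x).1)) U :=
    contMDiffOn_clAvg hC _ clScal
  have hV := hs.continuousOn.isOpen_inter_preimage hU (isOpen_Ioi (a := (0 : ℝ)))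
  set V := U ∩ (fun x => clScal (clLine (C x).1)) ⁻¹' Ioi 0
  have hVU : V ⊆ U := fun x hx => hx.1
  have hVs : ∀ x ∈ V, 0 < clScal (clLine (C x).1) := fun x hx => hx.2
  have hx₀V : x₀ ∈ V := by
    refine ⟨hx₀, ?_⟩
    change 0 < clScal (clLine (C x₀).1)
    rw [hC₀]
    exact clScal_clLine_one_pos n
  have hex : ∀ x, ∃ a : Spin n, x ∈ V → (spinRho n a = C x ∧
      (a : Cl n) = (Real.sqrt (clScal (clLine (C x).1)))⁻¹ • clLine (C x).1) := by
    intro x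
    by_cases hx : x ∈ V
    · obtain ⟨a, ha⟩ := exists_spin_of_pos hn (C x) (hVs x hx)
      exact ⟨a, fun _ => ha⟩
    · exact ⟨1, fun h => absurd h hx⟩
  choose a hay using hex
  have hsqrt : ContMDiffOn I 𝓘(ℝ, ℝ) ∞ (fun x => (Real.sqrt (clScal (clLine (C x).1)))⁻¹) V := by
    refine ContMDiffOn.inv₀ (fun x hx => ?_) fun x hx => (Real.sqrt_pos.2 (hVs x hx)).ne'
    exact (Real.contDiffAt_sqrt (hVs x hx).ne').contMDiffAt.comp_contMDiffWithinAt x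
      (hs.mono hVU x hx)
  have ha : GSmoothOn I (fun x => a₀ * a x) V := by
    rintro _ ⟨l, rfl⟩
    refine (hsqrt.mul ((contMDiffOn_clAvg hC (List.finRange n)
      (l ∘ₗ LinearMap.mulLeft ℝ (a₀ : Cl n))).mono hVU)).congr fun x hx => ?_
    change l ((a₀ : Cl n) * (a x : Cl n)) = _
    rw [(hay x hx).2, mul_smul_comm, map_smul]
    rfl
  refine ⟨V, hV, hx₀V, hVU, fun x => a₀ * a x, ha, ?_, fun x hx => ?_⟩
  · have ha1 : a x₀ = 1 := by
      apply Subtype.ext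
      rw [(hay x₀ hx₀V).2, hC₀]
      exact inv_sqrt_smul_clLine_one n
    simp only [ha1, mul_one]
  · rw [map_mul, (hay x hx).1]
    exact mul_inv_cancel_left _ _

/-- Smooth maps to `G₀ × U(1)` lift locally, through any prescribed point, to smooth maps to
`G₀ᶜ`. -/
theorem exists_gC_lift (hn : 0 < n) {U : Set X} (hU : IsOpen U) {x₀ : X} (hx₀ : x₀ ∈ U)
    {z : X → Circle} {g : X → GZero n} (hz : GSmoothOn I z U) (hg : GSmoothOn I g U)
    (h₀ : GZeroC n) (hz₀ : z x₀ = gCDet n h₀) (hg₀ : g x₀ = gCToG n h₀) :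
    ∃ V, IsOpen V ∧ x₀ ∈ V ∧ V ⊆ U ∧ ∃ h : X → GZeroC n, GSmoothOn I h V ∧ h x₀ = h₀ ∧
      ∀ x ∈ V, gCDet n (h x) = z x ∧ gCToG n (h x) = g x := by
  obtain ⟨A₀, k₀⟩ := h₀
  obtain ⟨⟨z₀, a₀⟩, rfl⟩ := QuotientGroup.mk_surjective k₀
  obtain ⟨hg₁, hg₂⟩ := Prod.ext_iff.1 hg₀
  obtain ⟨V, hV, hxV, hVU, y, hy, hy₀, hyz⟩ := exists_circle_lift hU hx₀ hz z₀ hz₀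
  obtain ⟨V', hV', hxV', hVU', a, ha, ha₀, hag⟩ := exists_spin_lift hn hU hx₀ hg.snd a₀ hg₂
  refine ⟨V ∩ V', hV.inter hV', ⟨hxV, hxV'⟩, fun x hx => hVU hx.1,
    fun x => ((g x).1, QuotientGroup.mk (y x, a x)),
    (hg.fst.mono fun x hx => hVU hx.1).prodMk (gSmoothOn_spinC (hy.mono inter_subset_left)
      (ha.mono inter_subset_right)), ?_, fun x hx => ⟨hyz x hx.1, Prod.ext rfl (hag x hx.2)⟩⟩
  change ((g x₀).1, (QuotientGroup.mk (y x₀, a x₀) : SpinC n)) = _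
  rw [hy₀, ha₀, hg₁]
  rfl

theorem exists_gC_eq (z : Circle) (g : GZero n) :
    ∃ h : GZeroC n, gCDet n h = z ∧ gCToG n h = g := by
  obtain ⟨a, ha⟩ := spinRho_surjective n g.2
  obtain ⟨θ, rfl⟩ : ∃ θ : ℝ, Circle.exp θ = z := ⟨Complex.arg z, Circle.exp_arg z⟩
  refine ⟨(g.1, QuotientGroup.mk (Circle.exp (θ / 2), a)), ?_, Prod.ext rfl ha⟩
  change Circle.exp (θ / 2) ^ 2 = _
  rw [pow_two, ← Circle.exp_add, add_halves]

theorem gCDet_gSpinToGC (h : GZeroSpin n) : gCDet n (gSpinToGC n h) = 1 := by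
  change (1 : Circle) ^ 2 = 1
  rw [one_pow]

theorem gCToG_gSpinToGC (h : GZeroSpin n) : gCToG n (gSpinToGC n h) = gSpinToG n h := rfl

theorem gSpinToGC_injective : Function.Injective (gSpinToGC n) := by
  rintro ⟨A, a⟩ ⟨A', a'⟩ h
  obtain ⟨h1, h2⟩ := Prod.ext_iff.1 h
  refine Prod.ext h1 ?_
  have h3 : ((1 : Circle), a)⁻¹ * ((1 : Circle), a') ∈ spinCKernel n := QuotientGroup.eq.1 h2
  rcases h3 with ⟨-, h4⟩ | ⟨h4, -⟩
  · exact inv_mul_eq_one.1 (Subtype.ext h4)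
  · norm_num at h4

/-- The kernel of `G₀ᶜ → U(1)` is `G̃₀`. -/
theorem exists_gSpin_eq (hn : 0 < n) (h : GZeroC n) (hh : gCDet n h = 1) :
    ∃ k : GZeroSpin n, gSpinToGC n k = h := by
  obtain ⟨A, k⟩ := h
  obtain ⟨⟨z, a⟩, rfl⟩ := QuotientGroup.mk_surjective k
  have h1 : z ^ 2 = 1 := hh
  have h2 : (z : ℂ) * z = 1 := by
    rw [← pow_two, ← Circle.coe_pow, h1, Circle.coe_one]
  -- `⟨-1, a⟩ = ⟨1, -a⟩`.
  rcases mul_self_eq_one_iff.1 h2 with h3 | h3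
  · exact ⟨(A, a), Prod.ext rfl (congrArg QuotientGroup.mk
      (Prod.ext (Circle.ext h3.symm) rfl : ((1 : Circle), a) = (z, a)))⟩
  · refine ⟨(A, spinNegOne hn * a), Prod.ext rfl (QuotientGroup.eq.2 (Or.inr ⟨?_, ?_⟩))⟩
    · simp [h3]
    · change (((spinNegOne hn * a)⁻¹ * a : Spin n) : Cl n) = -1
      have h4 : spinNegOne hn * a = a * spinNegOne hn := Subtype.ext (by simp [coe_spinNegOne])
      have h5 : (spinNegOne hn)⁻¹ = spinNegOne hn := by
        rw [inv_eq_iff_mul_eq_one]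
        exact Subtype.ext (by simp [coe_spinNegOne])
      rw [h4, mul_inv_rev, inv_mul_cancel_right, h5, coe_spinNegOne]

/-- The nontrivial element of the kernel of `G₀ᶜ → G₀ × U(1)`. -/
noncomputable def gCNegOne (hn : 0 < n) : GZeroC n := gSpinToGC n (1, spinNegOne hn)

theorem eq_one_or_gCNegOne (hn : 0 < n) (h : GZeroC n) (h1 : gCDet n h = 1)
    (h2 : gCToG n h = 1) : h = 1 ∨ h = gCNegOne hn := by
  obtain ⟨⟨A, a⟩, rfl⟩ := exists_gSpin_eq hn h h1
  obtain ⟨h3, h4⟩ := Prod.ext_iff.1 h2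
  have h3' : A = 1 := h3
  have h4' : spinRho n a = 1 := h4
  subst h3'
  rcases spinRho_eq_one a h4' with h5 | h5
  · left
    rw [show a = 1 from Subtype.ext h5]
    exact map_one (gSpinToGC n)
  · right
    rw [show a = spinNegOne hn from Subtype.ext h5]
    rfl

theorem spinCToAlgebra_mul_gCNegOne (hn : 0 < n) (h : GZeroC n) :
    spinCToAlgebra n (h * gCNegOne hn).2 = -spinCToAlgebra n h.2 := by
  obtain ⟨A, k⟩ := h
  obtain ⟨⟨z, a⟩, rfl⟩ := QuotientGroup.mk_surjective k
  change ((z * 1 : Circle) : ℂ) ⊗ₜ[ℝ] ((a : Cl n) * -1) = -((z : ℂ) ⊗ₜ[ℝ] (a : Cl n))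
  rw [mul_one, mul_neg_one, TensorProduct.tmul_neg]

theorem gCDet_gCNegOne (hn : 0 < n) : gCDet n (gCNegOne hn) = 1 := gCDet_gSpinToGC _

theorem gCToG_gCNegOne (hn : 0 < n) : gCToG n (gCNegOne hn) = 1 :=
  Prod.ext rfl (spinRho_spinNegOne hn)

end Covering

/-! ### Quotient manifolds -/

section Quotient

open Set Filter Topology

variable {X Y : Type*} [TopologicalSpace X] [TopologicalSpace Y]

theorem IsLocalHomeomorph.mem_localInverseAt_source {π : X → Y}
    (hf : IsLocalHomeomorph π) {g : Y → X} (hg : Function.RightInverse g π) (y : Y) :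
    y ∈ (hf.localInverseAt (g y)).source := by
  have h := hf.apply_self_mem_localInverseAt_source (x := g y)
  rwa [hg.eq y] at h

theorem IsLocalHomeomorph.localInverseAt_rightInverse {π : X → Y}
    (hf : IsLocalHomeomorph π) {g : Y → X} (hg : Function.RightInverse g π) (y : Y) :
    hf.localInverseAt (g y) y = g y := by
  have h := hf.localInverseAt_apply_self (x := g y)
  rwa [hg.eq y] at h

variable {d : ℕ} [ChartedSpace (EuclideanSpace ℝ (Fin d)) X]
  [IsManifold (𝓡 d) ∞ X]

/-- Any two points of a fibre of `π` are related by a smooth map over the identity. -/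
def HasSmoothDeck (d : ℕ) {X Y : Type*} [TopologicalSpace X]
    [ChartedSpace (EuclideanSpace ℝ (Fin d)) X] (π : X → Y) : Prop :=
  ∀ x y, π x = π y → ∃ φ : X → X, ContMDiff (𝓡 d) (𝓡 d) ∞ φ ∧ φ x = y ∧ ∀ z, π (φ z) = π z

omit [IsManifold (𝓡 d) ∞ X] in
/-- A local inverse of `π` after `π` is smooth: near each point it is a deck map, as both are sections of
the same local homeomorphism. -/
theorem HasSmoothDeck.contMDiffOn_localInverse {π : X → Y} (hf : IsLocalHomeomorph π)
    (h : HasSmoothDeck d π) (u : X) : ContMDiffOn (𝓡 d) (𝓡 d) ∞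
      (fun x => hf.localInverseAt u (π x)) (π ⁻¹' (hf.localInverseAt u).source) := by
  intro x hx
  refine ContMDiffAt.contMDiffWithinAt ?_
  have hy := hf.apply_localInverseAt_of_mem hx
  obtain ⟨φ, hφ, hφx, hφπ⟩ := h x _ hy.symm
  refine (hφ x).congr_of_eventuallyEq ?_
  set y := hf.localInverseAt u (π x)
  have hT : (hf.localInverseAt y).target ∈ 𝓝 y :=
    (hf.localInverseAt y).open_target.mem_nhds hf.self_mem_localInverseAt_target
  have hc1 : ContinuousAt (fun z => hf.localInverseAt u (π z)) x :=
    ((hf.localInverseAt u).continuousAt hx).comp hf.continuous.continuousAt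
  have hc2 : Tendsto φ (𝓝 x) (𝓝 y) := hφx ▸ hφ.continuous.continuousAt
  filter_upwards [hc1.eventually_mem hT, hc2.eventually_mem hT,
    hf.continuous.continuousAt.eventually_mem ((hf.localInverseAt u).open_source.mem_nhds hx)]
    with z h1 h2 h3
  exact hf.injOn_localInverseAt_target h1 h2
    ((hf.apply_localInverseAt_of_mem h3).trans (hφπ z).symm)

/-- The charts of `X`, composed with local inverses of `π`, are a smooth atlas of `Y`. -/
theorem HasSmoothDeck.isManifold {π : X → Y} (hf : IsLocalHomeomorph π) (h : HasSmoothDeck d π)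
    {g : Y → X} (hg : Function.RightInverse g π) :
    @IsManifold ℝ _ _ _ _ _ _ (𝓡 d) ∞ Y _
      (hf.chartedSpaceOfRightInverse (H := EuclideanSpace ℝ (Fin d)) hg) := by
  let := hf.chartedSpaceOfRightInverse (H := EuclideanSpace ℝ (Fin d)) hg
  refine isManifold_of_contDiffOn (𝓡 d) ∞ Y ?_
  rintro _ _ ⟨q, rfl⟩ ⟨q', rfl⟩
  rw [← contMDiffOn_iff_contDiffOn]
  simp only [modelWithCornersSelf_coe, modelWithCornersSelf_coe_symm, preimage_id, range_id,
    inter_univ, Function.id_comp, Function.comp_id]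
  have h1 := contMDiffOn_chart_symm (I := 𝓡 d) (n := ∞) (x := g q)
  have h2 := h.contMDiffOn_localInverse hf (g q')
  have h3 := contMDiffOn_chart (I := 𝓡 d) (n := ∞) (x := g q')
  have hsub : ∀ z ∈ (((hf.localInverseAt (g q)).trans
      (chartAt (EuclideanSpace ℝ (Fin d)) (g q))).symm.trans ((hf.localInverseAt (g q')).trans
      (chartAt (EuclideanSpace ℝ (Fin d)) (g q')))).source,
      z ∈ (chartAt (EuclideanSpace ℝ (Fin d)) (g q)).target ∧
      π ((chartAt (EuclideanSpace ℝ (Fin d)) (g q)).symm z) ∈ (hf.localInverseAt (g q')).source ∧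
      hf.localInverseAt (g q') (π ((chartAt (EuclideanSpace ℝ (Fin d)) (g q)).symm z)) ∈
        (chartAt (EuclideanSpace ℝ (Fin d)) (g q')).source := by
    intro z hz
    simp only [OpenPartialHomeomorph.trans_source, OpenPartialHomeomorph.symm_source,
      OpenPartialHomeomorph.trans_target, mem_inter_iff, mem_preimage,
      OpenPartialHomeomorph.coe_trans_symm, Function.comp_apply,
      IsLocalHomeomorph.localInverseAt_symm] at hz
    exact ⟨hz.1.1, hz.2.1, hz.2.2⟩
  refine ((h3.comp (h2.comp (h1.mono fun z hz => (hsub z hz).1) fun z hz => (hsub z hz).2.1)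
    fun z hz => (hsub z hz).2.2)).congr fun z hz => ?_
  simp

theorem HasSmoothDeck.contMDiff {π : X → Y} (hf : IsLocalHomeomorph π) (h : HasSmoothDeck d π)
    {g : Y → X} (hg : Function.RightInverse g π) :
    letI := hf.chartedSpaceOfRightInverse (H := EuclideanSpace ℝ (Fin d)) hg
    ContMDiff (𝓡 d) (𝓡 d) ∞ π := by
  let := hf.chartedSpaceOfRightInverse (H := EuclideanSpace ℝ (Fin d)) hg
  have := h.isManifold hf hg
  intro x
  rw [contMDiffAt_iff_target]
  refine ⟨hf.continuous.continuousAt, ?_⟩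
  have hx := hf.mem_localInverseAt_source hg (π x)
  have h2 := (h.contMDiffOn_localInverse hf (g (π x))).contMDiffAt
    (((hf.localInverseAt (g (π x))).open_source.preimage hf.continuous).mem_nhds hx)
  have h5 : ContMDiffAt (𝓡 d) (𝓡 d) ∞ (chartAt (EuclideanSpace ℝ (Fin d)) (g (π x)))
      (hf.localInverseAt (g (π x)) (π x)) := by
    rw [hf.localInverseAt_rightInverse hg]
    exact contMDiffAt_extChartAt
  exact ContMDiffAt.comp x (f := fun z => hf.localInverseAt (g (π x)) (π z)) h5 h2

/-- A map on the quotient is smooth if its composition with the projection is. -/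
theorem HasSmoothDeck.contMDiff_of_comp {π : X → Y} (hf : IsLocalHomeomorph π)
    (h : HasSmoothDeck d π) {g : Y → X} (hg : Function.RightInverse g π)
    {E' : Type*} [NormedAddCommGroup E'] [NormedSpace ℝ E'] {H' : Type*} [TopologicalSpace H']
    {I' : ModelWithCorners ℝ E' H'} {Z : Type*} [TopologicalSpace Z] [ChartedSpace H' Z]
    {f : Y → Z} (hfπ : ContMDiff (𝓡 d) I' ∞ (fun x => f (π x))) :
    letI := hf.chartedSpaceOfRightInverse (H := EuclideanSpace ℝ (Fin d)) hg
    ContMDiff (𝓡 d) I' ∞ f := by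
  let := hf.chartedSpaceOfRightInverse (H := EuclideanSpace ℝ (Fin d)) hg
  have := h.isManifold hf hg
  intro y
  have hy := hf.mem_localInverseAt_source hg y
  have h1 : ContMDiffAt (𝓡 d) (𝓡 d) ∞ (extChartAt (𝓡 d) y) y := contMDiffAt_extChartAt
  have h2 : ContMDiffAt (𝓡 d) (𝓡 d) ∞ (extChartAt (𝓡 d) (g y)).symm (extChartAt (𝓡 d) y y) :=
    (contMDiffOn_extChartAt_symm (g y)).contMDiffAt (by
      change (extChartAt (𝓡 d) (g y)).target ∈ 𝓝 (extChartAt (𝓡 d) (g y) (hf.localInverseAt (g y) y))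
      rw [hf.localInverseAt_rightInverse hg]
      exact extChartAt_target_mem_nhds _)
  refine (ContMDiffAt.comp y (g := fun x => f (π x)) (hfπ _)
    (ContMDiffAt.comp y h2 h1)).congr_of_eventuallyEq ?_
  have hs : (extChartAt (𝓡 d) (g y)).source ∈ 𝓝 (hf.localInverseAt (g y) y) := by
    rw [hf.localInverseAt_rightInverse hg]
    exact extChartAt_source_mem_nhds _
  filter_upwards [(hf.localInverseAt (g y)).open_source.mem_nhds hy,
    ((hf.localInverseAt (g y)).continuousAt hy).eventually_mem hs] with z hz hz'
  have h3 : (extChartAt (𝓡 d) (g y)).symm (extChartAt (𝓡 d) y z) = hf.localInverseAt (g y) z :=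
    (extChartAt (𝓡 d) (g y)).left_inv hz'
  simp only [Function.comp_apply, h3, hf.apply_localInverseAt_of_mem hz]

end Quotient

/-! ### The `G₀`-bundle and the `G̃₀`-bundle over the determinant circle bundle -/

section Induced

open Set Filter Topology

variable {n p pc e p₀ d : ℕ} {Pc : Type w} {P P₀ N M : Type*}
  [TopologicalSpace P] [ChartedSpace (EuclideanSpace ℝ (Fin p)) P]
  [TopologicalSpace Pc] [ChartedSpace (EuclideanSpace ℝ (Fin pc)) Pc]
  [TopologicalSpace P₀] [ChartedSpace (EuclideanSpace ℝ (Fin p₀)) P₀]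
  [TopologicalSpace N] [ChartedSpace (EuclideanSpace ℝ (Fin e)) N]
  [TopologicalSpace M] [ChartedSpace (EuclideanSpace ℝ (Fin d)) M]

section PullbackBundle

variable {G : Type} [Group G] [EmbeddedGroup G] {S : PrincipalBundle G p₀ P₀ d M}
  {δ : P → N} {t : P → P₀} {q : N → M}

theorem IsFibreProduct.exists_act (h : IsFibreProduct p e p₀ δ t q S.proj) (u : P) (g : G) :
    ∃ v, δ v = δ u ∧ t v = S.act (t u) g :=
  h.surj _ _ ((h.comm u).trans (S.proj_act _ _).symm)

open scoped Classical in
/-- A point of the fibre product over `x`, which lies on the section `s` where the latter is defined. -/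
theorem IsFibreProduct.exists_sect (h : IsFibreProduct p e p₀ δ t q S.proj) (U : Set M)
    (s : M → P₀) (hs : ∀ y ∈ U, S.proj (s y) = y) (x : N) :
    ∃ u, δ u = x ∧ (q x ∈ U → t u = s (q x)) := by
  by_cases hx : q x ∈ U
  · obtain ⟨u, hu⟩ := h.surj x (s (q x)) (hs _ hx).symm
    exact ⟨u, hu.1, fun _ => hu.2⟩
  · obtain ⟨w, hw⟩ := S.surjective_proj (q x)
    obtain ⟨u, hu⟩ := h.surj x w hw.symm
    exact ⟨u, hu.1, fun hx' => absurd hx' hx⟩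

/-- The pullback of a principal bundle. -/
noncomputable def IsFibreProduct.bundle (h : IsFibreProduct p e p₀ δ t q S.proj)
    (hq : ContMDiff (𝓡 e) (𝓡 d) ∞ q) : PrincipalBundle G p P e N where
  proj := δ
  act u g := (h.exists_act u g).choose
  smooth_proj := h.smooth_fst
  smooth_act k c hc := by
    refine h.contMDiff ?_ ?_
    · refine (h.smooth_fst.comp contMDiff_snd).congr fun y => ?_
      exact (h.exists_act y.2 (c y.1)).choose_spec.1
    · have h1 : ContMDiff ((𝓡 k).prod (𝓡 p)) ((𝓡 k).prod (𝓡 p₀)) ∞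
          (fun y : EuclideanSpace ℝ (Fin k) × P => (y.1, t y.2)) :=
        contMDiff_fst.prodMk (h.smooth_snd.comp contMDiff_snd)
      refine ((S.smooth_act k c hc).comp h1).congr fun y => ?_
      exact (h.exists_act y.2 (c y.1)).choose_spec.2
  act_one u := h.inj _ _ (h.exists_act u 1).choose_spec.1
    ((h.exists_act u 1).choose_spec.2.trans (S.act_one _))
  act_mul u g k := by
    have h1 := (h.exists_act u g).choose_spec
    have h2 := (h.exists_act (h.exists_act u g).choose k).choose_spec
    have h3 := (h.exists_act u (g * k)).choose_spec
    refine h.inj _ _ (h3.1.trans (h2.1.trans h1.1).symm) ?_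
    rw [h3.2, h2.2, h1.2, S.act_mul]
  proj_act u g := (h.exists_act u g).choose_spec.1
  existsUnique_act u v huv := by
    obtain ⟨g, hg, hu⟩ := S.existsUnique_act (t u) (t v) (by rw [← h.comm, ← h.comm, huv])
    refine ⟨g, h.inj _ _ ((h.exists_act u g).choose_spec.1.trans huv)
      ((h.exists_act u g).choose_spec.2.trans hg), fun k hk => hu k ?_⟩
    dsimp only at hk ⊢
    rw [← (h.exists_act u k).choose_spec.2, hk]
  locally_trivial x := by
    obtain ⟨U, hU, hx, s, τ, hs, hps, hτ, hsτ⟩ := S.locally_trivial (q x)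
    choose σ hσ using h.exists_sect U s hps
    refine ⟨q ⁻¹' U, hU.preimage hq.continuous, hx, σ, fun u => τ (t u), fun y hy => ?_,
      fun y _ => (hσ y).1, ?_, fun u hu => ?_⟩
    · refine ContMDiffAt.contMDiffWithinAt (h.contMDiffAt ?_ ?_)
      · exact contMDiffAt_id.congr_of_eventuallyEq (Eventually.of_forall fun y => (hσ y).1)
      · have h1 : ContMDiffAt (𝓡 e) (𝓡 p₀) ∞ (fun y => s (q y)) y :=
          (hs.contMDiffAt (hU.mem_nhds hy)).comp y hq.contMDiffAt
        refine h1.congr_of_eventuallyEq ?_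
        filter_upwards [(hU.preimage hq.continuous).mem_nhds hy] with z hz using (hσ z).2 hz
    · refine GSmoothOn.comp (I := 𝓡 p) (I' := 𝓡 p₀) hτ h.smooth_snd.contMDiffOn fun u hu => ?_
      change S.proj (t u) ∈ U
      rw [← h.comm]
      exact hu
    · refine h.inj _ _ ((h.exists_act _ _).choose_spec.1.trans (hσ _).1) ?_
      refine (h.exists_act _ _).choose_spec.2.trans ?_
      rw [(hσ _).2 hu, h.comm]
      exact hsτ _ (by rw [mem_preimage, ← h.comm]; exact hu)

theorem IsFibreProduct.snd_act (h : IsFibreProduct p e p₀ δ t q S.proj)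
    (hq : ContMDiff (𝓡 e) (𝓡 d) ∞ q) (u : P) (g : G) :
    t ((h.bundle hq).act u g) = S.act (t u) g :=
  (h.exists_act u g).choose_spec.2

theorem IsFibreProduct.isBundleMap (h : IsFibreProduct p e p₀ δ t q S.proj)
    (hq : ContMDiff (𝓡 e) (𝓡 d) ∞ q) : IsBundleMap (h.bundle hq) S (MonoidHom.id G) q t :=
  ⟨h.smooth_snd, fun u => (h.comm u).symm, h.snd_act hq⟩

end PullbackBundle

variable {Bc : PrincipalBundle (GZeroC n) pc Pc d M} {S : PrincipalBundle (GZero n) p₀ P₀ d M}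
  {t : Pc → P₀} {B : PrincipalBundle Circle e N d M} {δ : Pc → N}

theorem mem_fibre_iff (ht : IsBundleMap Bc S (gCToG n) id t)
    (hδ : IsBundleMap Bc B (gCDet n) id δ) (hn : 0 < n) (u v : Pc) :
    (δ u = δ v ∧ t u = t v) ↔ v = u ∨ v = Bc.act u (gCNegOne hn) := by
  constructor
  · rintro ⟨h1, h2⟩
    have h3 : Bc.proj u = Bc.proj v := by
      have := congrArg S.proj h2
      rwa [ht.covers, ht.covers] at this
    obtain ⟨g, rfl, -⟩ := Bc.existsUnique_act u v h3
    rw [hδ.equivariant, ← B.act_one (δ u), ← B.act_mul, one_mul] at h1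
    rw [ht.equivariant, ← S.act_one (t u), ← S.act_mul, one_mul] at h2
    rcases eq_one_or_gCNegOne hn g (B.act_inj h1).symm (S.act_inj h2).symm with rfl | rfl
    · exact Or.inl (Bc.act_one u)
    · exact Or.inr rfl
  · rintro (rfl | rfl)
    · exact ⟨rfl, rfl⟩
    · rw [hδ.equivariant, ht.equivariant, gCDet_gCNegOne, gCToG_gCNegOne, B.act_one, S.act_one]
      exact ⟨rfl, rfl⟩

/-- The action of `-1` is properly discontinuous, since it changes the sign of a linear coordinate of
`Spinᶜ(n)` which does not vanish near the given point. -/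
theorem exists_isOpen_disjoint [IsManifold (𝓡 pc) ∞ Pc] (hn : 0 < n) (u : Pc) :
    ∃ V : Set Pc, IsOpen V ∧ u ∈ V ∧ ∀ v ∈ V, Bc.act v (gCNegOne hn) ∉ V := by
  obtain ⟨U, hU, hx, s, τ, hs, hps, hτ, hsτ⟩ := Bc.locally_trivial (Bc.proj u)
  have hne : spinCToAlgebra n (τ u).2 ≠ 0 := by
    intro h0
    have h1 : spinCToAlgebra n (τ u).2 * spinCToAlgebra n ((τ u).2)⁻¹ = 1 := by
      rw [← map_mul, mul_inv_cancel, map_one]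
    rw [h0, zero_mul] at h1
    exact zero_ne_one h1
  obtain ⟨l, hl⟩ : ∃ l : ℂ ⊗[ℝ] Cl n →ₗ[ℝ] ℝ, l (spinCToAlgebra n (τ u).2) ≠ 0 := by
    by_contra! hcon
    exact hne ((Module.forall_dual_apply_eq_zero_iff ℝ _).1 hcon)
  set c := l (spinCToAlgebra n (τ u).2)
  have hcont : ContMDiffOn (𝓡 pc) 𝓘(ℝ, ℝ) ∞ (fun v => l (spinCToAlgebra n (τ v).2))
      (Bc.proj ⁻¹' U) :=
    (GSmoothOn.snd (I := 𝓡 pc) (G := GLTwoPos) (K := SpinC n) hτ) _ ⟨l, rfl⟩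
  have hopen := (hcont.continuousOn.const_mul c : ContinuousOn (fun v => c * _) _).isOpen_inter_preimage
    (hU.preimage Bc.smooth_proj.continuous) (isOpen_Ioi (a := (0 : ℝ)))
  refine ⟨_, hopen, ⟨hx, ?_⟩, ?_⟩
  · exact mul_self_pos.2 hl
  · rintro v ⟨hv1, hv2⟩ ⟨hv3, hv4⟩
    have h1 : τ (Bc.act v (gCNegOne hn)) = τ v * gCNegOne hn := by
      refine Bc.act_inj (u := s (Bc.proj v)) ?_
      rw [Bc.act_mul, hsτ v hv1]
      have := hsτ _ hv3
      rwa [Bc.proj_act] at this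
    have hv2' : 0 < c * l (spinCToAlgebra n (τ v).2) := hv2
    have hv4' : 0 < c * l (spinCToAlgebra n (τ (Bc.act v (gCNegOne hn))).2) := hv4
    rw [h1, spinCToAlgebra_mul_gCNegOne, map_neg] at hv4'
    linarith

/-- The map from the `G₀ᶜ`-bundle to the fibre product of the circle bundle and the `G₀`-bundle has
smooth local sections. -/
theorem exists_local_lift (hn : 0 < n) [IsManifold (𝓡 e) ∞ N] [IsManifold (𝓡 p₀) ∞ P₀]
    [IsManifold (𝓡 pc) ∞ Pc]
    (ht : IsBundleMap Bc S (gCToG n) id t) (hδ : IsBundleMap Bc B (gCDet n) id δ) (u : Pc) :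
    ∃ W : Set (N × P₀), IsOpen W ∧ (δ u, t u) ∈ W ∧ ∃ Λ : N × P₀ → Pc,
      ContMDiffOn ((𝓡 e).prod (𝓡 p₀)) (𝓡 pc) ∞ Λ W ∧ Λ (δ u, t u) = u ∧
      ∀ y ∈ W, B.proj y.1 = S.proj y.2 → δ (Λ y) = y.1 ∧ t (Λ y) = y.2 := by
  obtain ⟨U, hU, hx, s, τ, hs, hps, hτ, hsτ⟩ := Bc.locally_trivial (Bc.proj u)
  obtain ⟨U₁, hU₁, hx₁, s₁, τ₁, hs₁, hps₁, hτ₁, hsτ₁⟩ := B.locally_trivial (Bc.proj u)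
  obtain ⟨U₀, hU₀, hx₀, s₀, τ₀, hs₀, hps₀, hτ₀, hsτ₀⟩ := S.locally_trivial (Bc.proj u)
  have hδp : ∀ v, B.proj (δ v) = Bc.proj v := hδ.covers
  have htp : ∀ v, S.proj (t v) = Bc.proj v := ht.covers
  set W : Set (N × P₀) := {y | B.proj y.1 ∈ U ∩ U₁ ∧ S.proj y.2 ∈ U ∩ U₀}
  have hW : IsOpen W :=
    (((hU.inter hU₁).preimage B.smooth_proj.continuous).preimage continuous_fst).inter
    (((hU.inter hU₀).preimage S.smooth_proj.continuous).preimage continuous_snd)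
  have hmem : (δ u, t u) ∈ W := by
    refine ⟨?_, ?_⟩
    · change B.proj (δ u) ∈ _
      rw [hδp]; exact ⟨hx, hx₁⟩
    · change S.proj (t u) ∈ _
      rw [htp]; exact ⟨hx, hx₀⟩
  have hs1 : ContMDiffOn ((𝓡 e).prod (𝓡 p₀)) (𝓡 pc) ∞ (fun y : N × P₀ => s (B.proj y.1)) W :=
    hs.comp (B.smooth_proj.comp_contMDiffOn contMDiffOn_fst) fun y hy => hy.1.1
  have hs2 : ContMDiffOn ((𝓡 e).prod (𝓡 p₀)) (𝓡 pc) ∞ (fun y : N × P₀ => s (S.proj y.2)) W :=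
    hs.comp (S.smooth_proj.comp_contMDiffOn contMDiffOn_snd) fun y hy => hy.2.1
  -- Over `m`, a point of `N` is `δ(s(m)) z` and a point of `𝒢₀` is `t(s(m)) g`. The smooth maps `z` and `g`
  -- lift to `G₀ᶜ`.
  have hz : GSmoothOn ((𝓡 e).prod (𝓡 p₀))
      (fun y : N × P₀ => (τ₁ (δ (s (B.proj y.1))))⁻¹ * τ₁ y.1) W := by
    refine GSmoothOn.circle_mul (GSmoothOn.circle_inv ?_) ?_
    · refine GSmoothOn.comp (I' := 𝓡 e) hτ₁ (hδ.smooth.comp_contMDiffOn hs1) fun y hy => ?_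
      change B.proj (δ (s (B.proj y.1))) ∈ U₁
      rw [hδp, hps _ hy.1.1]; exact hy.1.2
    · exact GSmoothOn.comp (I' := 𝓡 e) hτ₁ contMDiffOn_fst fun y hy => hy.1.2
  have hg : GSmoothOn ((𝓡 e).prod (𝓡 p₀))
      (fun y : N × P₀ => (τ₀ (t (s (S.proj y.2))))⁻¹ * τ₀ y.2) W := by
    refine GSmoothOn.gZero_mul (GSmoothOn.gZero_inv ?_) ?_
    · refine GSmoothOn.comp (I' := 𝓡 p₀) hτ₀ (ht.smooth.comp_contMDiffOn hs2) fun y hy => ?_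
      change S.proj (t (s (S.proj y.2))) ∈ U₀
      rw [htp, hps _ hy.2.1]; exact hy.2.2
    · exact GSmoothOn.comp (I' := 𝓡 p₀) hτ₀ contMDiffOn_snd fun y hy => hy.2.2
  have hz1 : ∀ x, B.proj x ∈ U ∩ U₁ →
      B.act (δ (s (B.proj x))) ((τ₁ (δ (s (B.proj x))))⁻¹ * τ₁ x) = x := by
    intro x hx
    have hm : B.proj (δ (s (B.proj x))) = B.proj x := by rw [hδp, hps _ hx.1]
    have h1 := hsτ₁ (δ (s (B.proj x))) (by rw [mem_preimage, hm]; exact hx.2)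
    rw [hm] at h1
    exact B.act_inv_mul h1 (hsτ₁ x hx.2)
  have hg1 : ∀ w, S.proj w ∈ U ∩ U₀ →
      S.act (t (s (S.proj w))) ((τ₀ (t (s (S.proj w))))⁻¹ * τ₀ w) = w := by
    intro w hw
    have hm : S.proj (t (s (S.proj w))) = S.proj w := by rw [htp, hps _ hw.1]
    have h1 := hsτ₀ (t (s (S.proj w))) (by rw [mem_preimage, hm]; exact hw.2)
    rw [hm] at h1
    exact S.act_inv_mul h1 (hsτ₀ w hw.2)
  have hz₀ : (τ₁ (δ (s (B.proj (δ u)))))⁻¹ * τ₁ (δ u) = gCDet n (τ u) := by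
    refine B.act_inj (u := δ (s (B.proj (δ u)))) ?_
    rw [hz1 _ hmem.1, ← hδ.equivariant, hδp, hsτ u hx]
  have hg₀ : (τ₀ (t (s (S.proj (t u)))))⁻¹ * τ₀ (t u) = gCToG n (τ u) := by
    refine S.act_inj (u := t (s (S.proj (t u)))) ?_
    rw [hg1 _ hmem.2, ← ht.equivariant, htp, hsτ u hx]
  obtain ⟨V, hV, hmV, hVW, h, hh, hh₀, hhV⟩ := exists_gC_lift hn hW hmem hz hg (τ u) hz₀ hg₀
  refine ⟨V, hV, hmV, fun y => Bc.act (s (B.proj y.1)) (h y),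
    Bc.contMDiffOn_act hV (hs1.mono hVW) hh, ?_, fun y hy hym => ⟨?_, ?_⟩⟩
  · change Bc.act (s (B.proj (δ u))) (h (δ u, t u)) = u
    rw [hh₀, hδp, hsτ u hx]
  · rw [hδ.equivariant, (hhV y hy).1, hz1 _ (hVW hy).1]
  · rw [ht.equivariant, (hhV y hy).2, hym, hg1 _ (hVW hy).2]

/-- The fibre product of the circle bundle and the `G₀`-bundle is the quotient of the `G₀ᶜ`-bundle
by the kernel of `G₀ᶜ → G₀ × U(1)`, which has two elements. -/
theorem exists_isFibreProduct (hn : 0 < n) [IsManifold (𝓡 e) ∞ N] [IsManifold (𝓡 p₀) ∞ P₀]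
    [IsManifold (𝓡 pc) ∞ Pc]
    (ht : IsBundleMap Bc S (gCToG n) id t) (hδ : IsBundleMap Bc B (gCDet n) id δ) :
    ∃ (P : Type w) (_ : TopologicalSpace P) (_ : ChartedSpace (EuclideanSpace ℝ (Fin pc)) P)
      (_ : IsManifold (𝓡 pc) ∞ P) (π : Pc → P) (δ' : P → N) (q₀ : P → P₀),
      IsFibreProduct pc e p₀ δ' q₀ B.proj S.proj ∧ ContMDiff (𝓡 pc) (𝓡 pc) ∞ π ∧
      Function.Surjective π ∧ (∀ u, δ' (π u) = δ u) ∧ ∀ u, q₀ (π u) = t u := by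
  have hδp : ∀ v, B.proj (δ v) = Bc.proj v := hδ.covers
  have htp : ∀ v, S.proj (t v) = Bc.proj v := ht.covers
  let r : Setoid Pc := ⟨fun u v => δ u = δ v ∧ t u = t v, fun _ => ⟨rfl, rfl⟩,
    fun h => ⟨h.1.symm, h.2.symm⟩, fun h h' => ⟨h.1.trans h'.1, h.2.trans h'.2⟩⟩
  let π : Pc → Quotient r := Quotient.mk r
  have hπ : ∀ u v, π u = π v ↔ δ u = δ v ∧ t u = t v := fun u v => Quotient.eq (r := r)
  have hπs : Function.Surjective π := Quotient.mk_surjective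
  have hε : ∀ u, π (Bc.act u (gCNegOne hn)) = π u := fun u =>
    ((hπ _ _).2 ((mem_fibre_iff ht hδ hn u _).2 (Or.inr rfl))).symm
  have hεs := Bc.contMDiff_act_const (gCNegOne hn)
  have hdeck : HasSmoothDeck pc π := by
    intro u v huv
    rcases (mem_fibre_iff ht hδ hn u v).1 ((hπ u v).1 huv) with rfl | rfl
    · exact ⟨id, contMDiff_id, rfl, fun _ => rfl⟩
    · exact ⟨_, hεs, rfl, hε⟩
  have hcont : Continuous π := continuous_quot_mk
  have hopen : IsOpenMap π := by
    intro V hV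
    have : π ⁻¹' (π '' V) = V ∪ (fun u => Bc.act u (gCNegOne hn)) ⁻¹' V := by
      ext u
      simp only [mem_preimage, mem_image, mem_union]
      constructor
      · rintro ⟨v, hv, hvu⟩
        rcases (mem_fibre_iff ht hδ hn u v).1 ((hπ u v).1 hvu.symm) with rfl | rfl
        · exact Or.inl hv
        · exact Or.inr hv
      · rintro (hu | hu)
        · exact ⟨u, hu, rfl⟩
        · exact ⟨_, hu, hε u⟩
    change IsOpen (π ⁻¹' (π '' V))
    rw [this]
    exact hV.union (hV.preimage hεs.continuous)
  have hloc : IsLocalHomeomorph π := by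
    rw [isLocalHomeomorph_iff_isOpenEmbedding_restrict]
    intro u
    obtain ⟨V, hV, huV, hdis⟩ := exists_isOpen_disjoint (Bc := Bc) hn u
    refine ⟨V, hV.mem_nhds huV, Topology.IsOpenEmbedding.of_continuous_injective_isOpenMap
      (hcont.comp continuous_subtype_val) ?_ (hopen.domRestrict hV)⟩
    rintro ⟨a, ha⟩ ⟨b, hb⟩ hab
    rcases (mem_fibre_iff ht hδ hn a b).1 ((hπ a b).1 hab) with rfl | rfl
    · rfl
    · exact absurd hb (hdis a ha)
  have hg := hπs.hasRightInverse.choose_spec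
  have hπsm := hdeck.contMDiff hloc hg
  let δ' : Quotient r → N := Quotient.lift δ fun _ _ h => h.1
  let q₀ : Quotient r → P₀ := Quotient.lift t fun _ _ h => h.2
  let := hloc.chartedSpaceOfRightInverse (H := EuclideanSpace ℝ (Fin pc)) hg
  refine ⟨Quotient r, _, inferInstance, hdeck.isManifold hloc hg, π, δ', q₀,
    ⟨?_, ?_, ?_, ?_, ?_, ?_⟩, hπsm, hπs, fun _ => rfl, fun _ => rfl⟩
  · exact hdeck.contMDiff_of_comp hloc hg hδ.smooth
  · exact hdeck.contMDiff_of_comp hloc hg ht.smooth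
  · intro u
    obtain ⟨u, rfl⟩ := hπs u
    exact (hδp u).trans (htp u).symm
  · intro u v h1 h2
    obtain ⟨u, rfl⟩ := hπs u
    obtain ⟨v, rfl⟩ := hπs v
    exact (hπ u v).2 ⟨h1, h2⟩
  · intro x w hxw
    obtain ⟨u, hu⟩ := Bc.surjective_proj (B.proj x)
    obtain ⟨z, hz, -⟩ := B.existsUnique_act (δ u) x ((hδp u).trans hu)
    obtain ⟨g, hg, -⟩ := S.existsUnique_act (t u) w ((htp u).trans (hu.trans hxw))
    obtain ⟨h, hh1, hh2⟩ := exists_gC_eq z g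
    refine ⟨π (Bc.act u h), ?_, ?_⟩
    · change δ (Bc.act u h) = x
      rw [hδ.equivariant, hh1, hz]
    · change t (Bc.act u h) = w
      rw [ht.equivariant, hh2, hg]
  · intro u
    obtain ⟨u, rfl⟩ := hπs u
    obtain ⟨W, hW, hmem, Λ, hΛ, -, hΛW⟩ := exists_local_lift hn ht hδ u
    refine ⟨fun y => π (Λ y), ?_, ?_⟩
    · exact hπsm.contMDiffAt.comp _ (hΛ.contMDiffAt (hW.mem_nhds hmem))
    · filter_upwards [hW.mem_nhds hmem]
      rintro _ hy v rfl
      obtain ⟨v, rfl⟩ := hπs v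
      have := hΛW (δ v, t v) hy ((hδp v).trans (htp v).symm)
      exact (hπ _ _).2 this

/-- `Spin(n)` has the smooth structure induced from `Spinᶜ(n)`: the map `Re ⊗ id` takes `1 ⊗ a` to
`a`. -/
theorem gSmoothOn_of_spinC {E : Type*} [NormedAddCommGroup E] [NormedSpace ℝ E] {H : Type*}
    [TopologicalSpace H] {I : ModelWithCorners ℝ E H} {X : Type*} [TopologicalSpace X]
    [ChartedSpace H X] {g : X → GZeroSpin n} {U : Set X}
    (hg : GSmoothOn I (fun x => gSpinToGC n (g x)) U) : GSmoothOn I g U := by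
  refine GSmoothOn.prodMk hg.fst ?_
  rintro _ ⟨l, rfl⟩
  refine (hg.snd _ ⟨l ∘ₗ (TensorProduct.lid ℝ (Cl n)).toLinearMap ∘ₗ
    (TensorProduct.map Complex.reLm LinearMap.id), rfl⟩).congr fun x _ => ?_
  change _ = l (TensorProduct.lid ℝ (Cl n) (TensorProduct.map Complex.reLm LinearMap.id
    (((1 : Circle) : ℂ) ⊗ₜ[ℝ] ((g x).2 : Cl n))))
  simp

theorem gSmoothOn_gSpinToGC {E : Type*} [NormedAddCommGroup E] [NormedSpace ℝ E] {H : Type*}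
    [TopologicalSpace H] {I : ModelWithCorners ℝ E H} {X : Type*} [TopologicalSpace X]
    [ChartedSpace H X] {g : X → GZeroSpin n} {U : Set X} (hg : GSmoothOn I g U) :
    GSmoothOn I (fun x => gSpinToGC n (g x)) U :=
  hg.fst.prodMk (gSmoothOn_spinC (gSmoothOn_const (1 : Circle) U) hg.snd)

theorem gSmoothOn_circle_mul_spinC {E : Type*} [NormedAddCommGroup E] [NormedSpace ℝ E]
    {H : Type*} [TopologicalSpace H] {I : ModelWithCorners ℝ E H} {X : Type*} [TopologicalSpace X]
    [ChartedSpace H X] {y : X → Circle} {k : X → SpinC n} {U : Set X} (hy : GSmoothOn I y U)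
    (hk : GSmoothOn I k U) :
    GSmoothOn I (fun x => (QuotientGroup.mk (y x, (1 : Spin n)) : SpinC n) * k x) U := by
  rintro _ ⟨l, rfl⟩
  rw [gSmoothOn_circle] at hy
  have h : ∀ x, l (spinCToAlgebra n (QuotientGroup.mk (y x, (1 : Spin n)) * k x)) =
      (y x : ℂ).re * l (spinCToAlgebra n (k x)) +
      (y x : ℂ).im * (l ∘ₗ LinearMap.mulLeft ℝ (Complex.I ⊗ₜ[ℝ] (1 : Cl n)))
        (spinCToAlgebra n (k x)) := by
    intro x
    have h1 : spinCToAlgebra n (QuotientGroup.mk (y x, (1 : Spin n))) =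
        (y x : ℂ).re • 1 + (y x : ℂ).im • (Complex.I ⊗ₜ[ℝ] (1 : Cl n)) := by
      change (y x : ℂ) ⊗ₜ[ℝ] (1 : Cl n) = _
      rw [Algebra.TensorProduct.one_def, TensorProduct.smul_tmul', TensorProduct.smul_tmul',
        ← TensorProduct.add_tmul, Complex.real_smul, Complex.real_smul, mul_one, Complex.re_add_im]
    rw [map_mul, h1, add_mul, smul_mul_assoc, smul_mul_assoc, one_mul, map_add, map_smul, map_smul]
    rfl
  simp only [h]
  exact (hy.1.mul (hk _ ⟨l, rfl⟩)).add (hy.2.mul (hk _ ⟨_, rfl⟩))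

/-- The projection from the `G₀ᶜ`-bundle to its determinant circle bundle is a `G̃₀`-bundle. -/
theorem exists_spin_bundle (hn : 0 < n) [IsManifold (𝓡 e) ∞ N] [IsManifold (𝓡 pc) ∞ Pc]
    (hδ : IsBundleMap Bc B (gCDet n) id δ) :
    ∃ L : PrincipalBundle (GZeroSpin n) pc Pc e N, L.proj = δ ∧
      ∀ u g, L.act u g = Bc.act u (gSpinToGC n g) := by
  have hδp : ∀ v, B.proj (δ v) = Bc.proj v := hδ.covers
  have hex : ∀ u v, δ u = δ v → ∃! g, Bc.act u (gSpinToGC n g) = v := by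
    intro u v huv
    obtain ⟨h, rfl, hu⟩ := Bc.existsUnique_act u v (by rw [← hδp, ← hδp, huv])
    rw [hδ.equivariant, ← B.act_one (δ u), ← B.act_mul, one_mul] at huv
    obtain ⟨g, rfl⟩ := exists_gSpin_eq hn h (B.act_inj huv).symm
    exact ⟨g, rfl, fun g' hg' => gSpinToGC_injective (Bc.act_inj hg')⟩
  refine ⟨⟨δ, fun u g => Bc.act u (gSpinToGC n g), hδ.smooth, fun k c hc => ?_, fun u => ?_,
    fun u g h => ?_, fun u g => ?_, hex, fun x => ?_⟩, rfl, fun _ _ => rfl⟩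
  · exact Bc.smooth_act k _ (gSmoothOn_gSpinToGC (I := 𝓡 k) hc)
  · rw [map_one, Bc.act_one]
  · rw [map_mul, Bc.act_mul]
  · rw [hδ.equivariant, gCDet_gSpinToGC, B.act_one]
  · obtain ⟨U, hU, hx, s, τ, hs, hps, hτ, hsτ⟩ := Bc.locally_trivial (B.proj x)
    obtain ⟨U₁, hU₁, hx₁, s₁, τ₁, hs₁, hps₁, hτ₁, hsτ₁⟩ := B.locally_trivial (B.proj x)
    set W : Set N := B.proj ⁻¹' (U ∩ U₁)
    have hW : IsOpen W := (hU.inter hU₁).preimage B.smooth_proj.continuous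
    have hs1 : ContMDiffOn (𝓡 e) (𝓡 pc) ∞ (fun y => s (B.proj y)) W :=
      hs.comp B.smooth_proj.contMDiffOn fun y hy => hy.1
    have hz : GSmoothOn (𝓡 e) (fun y => (τ₁ (δ (s (B.proj y))))⁻¹ * τ₁ y) W := by
      refine GSmoothOn.circle_mul (GSmoothOn.circle_inv ?_) ?_
      · refine GSmoothOn.comp (I' := 𝓡 e) hτ₁ (hδ.smooth.comp_contMDiffOn hs1) fun y hy => ?_
        change B.proj (δ (s (B.proj y))) ∈ U₁
        rw [hδp, hps _ hy.1]; exact hy.2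
      · exact GSmoothOn.mono (I := 𝓡 e) hτ₁ fun y hy => hy.2
    have hz1 : ∀ y ∈ W,
        B.act (δ (s (B.proj y))) ((τ₁ (δ (s (B.proj y))))⁻¹ * τ₁ y) = y := by
      intro y hy
      have hm : B.proj (δ (s (B.proj y))) = B.proj y := by rw [hδp, hps _ hy.1]
      have h1 := hsτ₁ (δ (s (B.proj y))) (by rw [mem_preimage, hm]; exact hy.2)
      rw [hm] at h1
      exact B.act_inv_mul h1 (hsτ₁ y hy.2)
    obtain ⟨z₀, hz₀⟩ : ∃ z₀ : Circle, (τ₁ (δ (s (B.proj x))))⁻¹ * τ₁ x = z₀ ^ 2 := by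
      obtain ⟨⟨A, k⟩, hk, -⟩ := exists_gC_eq (n := n) ((τ₁ (δ (s (B.proj x))))⁻¹ * τ₁ x) 1
      obtain ⟨⟨z, a⟩, rfl⟩ := QuotientGroup.mk_surjective k
      exact ⟨z, hk.symm⟩
    obtain ⟨V, hV, hxV, hVW, y, hy, -, hyz⟩ := exists_circle_lift hW ⟨hx, hx₁⟩ hz z₀ hz₀
    -- A local section of `Bc`, corrected by a square root of `z`, is a local section of `δ`.
    let σ : N → Pc := fun x => Bc.act (s (B.proj x)) (1, QuotientGroup.mk (y x, 1))
    have hσδ : ∀ x ∈ V, δ (σ x) = x := by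
      intro x hx
      change δ (Bc.act _ _) = x
      rw [hδ.equivariant]
      change B.act _ (y x ^ 2) = x
      rw [hyz x hx, hz1 x (hVW hx)]
    have hτex : ∀ u, ∃ g : GZeroSpin n, δ u ∈ V → Bc.act (σ (δ u)) (gSpinToGC n g) = u := by
      intro u
      by_cases hu : δ u ∈ V
      · obtain ⟨g, hg, -⟩ := hex (σ (δ u)) u (hσδ _ hu)
        exact ⟨g, fun _ => hg⟩
      · exact ⟨1, fun h => absurd h hu⟩
    choose g hg using hτex
    refine ⟨V, hV, hxV, σ, g, ?_, hσδ, ?_, hg⟩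
    · exact Bc.contMDiffOn_act hV (hs1.mono hVW) ((gSmoothOn_const _ V).prodMk
        (gSmoothOn_spinC hy (gSmoothOn_const _ V)))
    · refine gSmoothOn_of_spinC (I := 𝓡 pc) ?_
      have hmap : MapsTo δ (δ ⁻¹' V) V := fun u hu => hu
      have hτV : GSmoothOn (𝓡 pc) τ (δ ⁻¹' V) := GSmoothOn.mono (I := 𝓡 pc) hτ fun u hu => by
        rw [mem_preimage, ← hδp]
        exact (hVW hu).1
      have hyV : GSmoothOn (𝓡 pc) (fun u => (y (δ u))⁻¹) (δ ⁻¹' V) :=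
        (hy.comp hδ.smooth.contMDiffOn hmap).circle_inv
      refine GSmoothOn.congr (g := fun u => ((τ u).1,
        (QuotientGroup.mk ((y (δ u))⁻¹, (1 : Spin n)) : SpinC n) * (τ u).2))
        (hτV.fst.prodMk (gSmoothOn_circle_mul_spinC hyV hτV.snd)) fun u hu => ?_
      have h1 := hg u hu
      have hBu : Bc.proj u ∈ U := by
        rw [← hδp]
        exact (hVW hu).1
      have h2 := hsτ u hBu
      have h3 : ((1, QuotientGroup.mk (y (δ u), 1)) : GZeroC n) * gSpinToGC n (g u) = τ u := by
        refine Bc.act_inj (u := s (Bc.proj u)) ?_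
        rw [h2, Bc.act_mul, ← hδp u]
        exact h1
      rw [← h3, Prod.fst_mul, Prod.snd_mul, one_mul, ← mul_assoc]
      have h4 : (QuotientGroup.mk ((y (δ u))⁻¹, (1 : Spin n)) : SpinC n) *
          QuotientGroup.mk (y (δ u), 1) = 1 := by
        rw [← QuotientGroup.mk_mul, Prod.mk_mul_mk, inv_mul_cancel, one_mul]
        rfl
      rw [h4, one_mul]

end Induced

/-! ### The exterior derivative of one-forms -/

section Forms

open Set Filter Topology VectorField

theorem extDeriv_one_apply {E : Type*} [NormedAddCommGroup E] [NormedSpace ℝ E]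
    {η : E → E [⋀^Fin 1]→L[ℝ] ℝ} {V W : E → E} {z : E} (hη : DifferentiableAt ℝ η z)
    (hV : DifferentiableAt ℝ V z) (hW : DifferentiableAt ℝ W z) :
    extDeriv η z ![V z, W z] = fderiv ℝ (fun y => η y ![W y]) z (V z) -
      fderiv ℝ (fun y => η y ![V y]) z (W z) - η z ![lieBracket ℝ V W z] := by
  have h := extDeriv_apply_vectorField (n := 0) (V := ![V, W]) hη (by
    intro i; fin_cases i
    · exact hV
    · exact hW)
  have h0 : (fun i => (![V, W] : Fin 2 → E → E) i z) = ![V z, W z] := by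
    ext i; fin_cases i <;> rfl
  have e0 : ∀ y, (Fin.removeNth (0 : Fin 2) fun i => (![V, W] : Fin 2 → E → E) i y) = ![W y] := by
    intro y; ext i; fin_cases i; rfl
  have e1 : ∀ y, (Fin.removeNth (1 : Fin 2) fun i => (![V, W] : Fin 2 → E → E) i y) = ![V y] := by
    intro y; ext i; fin_cases i; rfl
  rw [h0] at h
  rw [h, Fin.sum_univ_two]
  simp only [e0, e1]
  have hs : ∀ a : E, ∀ f : Fin 0 → E, (Matrix.vecCons a f : Fin 1 → E) = ![a] := by
    intro a f; ext i; fin_cases i; rfl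
  simp [hs, sub_eq_add_neg]

variable {p e d : ℕ} {Q N M : Type*} [TopologicalSpace Q] [ChartedSpace (EuclideanSpace ℝ (Fin p)) Q]
  [TopologicalSpace N] [ChartedSpace (EuclideanSpace ℝ (Fin e)) N]

variable (p) in
/-- The derivative of the real function `g` in the direction of the tangent vector `v`, as a real
number. -/
noncomputable abbrev dirDeriv (g : Q → ℝ) (u : Q) (v : TangentSpace (𝓡 p) u) : ℝ :=
  mfderiv (𝓡 p) 𝓘(ℝ, ℝ) g u v

theorem mfderiv_eq_fderiv_of_chart [IsManifold (𝓡 p) ∞ Q] {u : Q} {g : Q → ℝ}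
    {h : EuclideanSpace ℝ (Fin p) → ℝ} (hg : g =ᶠ[𝓝 u] fun w => h (extChartAt (𝓡 p) u w))
    (hh : DifferentiableAt ℝ h (extChartAt (𝓡 p) u u)) (v : TangentSpace (𝓡 p) u) :
    MDifferentiableAt (𝓡 p) 𝓘(ℝ, ℝ) g u ∧
    dirDeriv p g u v = fderiv ℝ h (extChartAt (𝓡 p) u u) v := by
  have : IsManifold (𝓡 p) 1 Q := IsManifold.of_le (n := ∞) (by simp)
  have h1 : MDifferentiableAt (𝓡 p) 𝓘(ℝ, EuclideanSpace ℝ (Fin p)) (extChartAt (𝓡 p) u) u :=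
    mdifferentiableAt_extChartAt (mem_chart_source _ u)
  have h2 : MDifferentiableAt 𝓘(ℝ, EuclideanSpace ℝ (Fin p)) 𝓘(ℝ, ℝ) h (extChartAt (𝓡 p) u u) :=
    hh.mdifferentiableAt
  refine ⟨(h2.comp u h1).congr_of_eventuallyEq hg, ?_⟩
  have h3 := mfderiv_comp u h2 h1
  rw [mfderiv_extChartAt_self, mfderiv_eq_fderiv] at h3
  exact congrArg (fun L => L v) (hg.mfderiv_eq.trans h3)

/-- The Cartan formula for the exterior derivative of a one-form, for vector fields along a smooth map
which are images of vector fields on the source. -/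
theorem extD_toForm_apply_map [IsManifold (𝓡 p) ∞ Q] [IsManifold (𝓡 e) ∞ N] {α : OneForm e N}
    (hα : SmoothFormOn (toForm α) univ) {F : Q → N} (hF : ContMDiff (𝓡 p) (𝓡 e) ∞ F)
    {X Y : VField p Q} {u : Q}
    (hX : MDifferentiableAt (𝓡 p) (𝓡 p).tangent (fun w => (⟨w, X w⟩ : TangentBundle (𝓡 p) Q)) u)
    (hY : MDifferentiableAt (𝓡 p) (𝓡 p).tangent (fun w => (⟨w, Y w⟩ : TangentBundle (𝓡 p) Q)) u) :
    MDifferentiableAt (𝓡 p) 𝓘(ℝ, ℝ)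
      (fun w => α (F w) (mfderiv (𝓡 p) (𝓡 e) F w (Y w))) u ∧
    extD (toForm α) (F u) ![mfderiv (𝓡 p) (𝓡 e) F u (X u), mfderiv (𝓡 p) (𝓡 e) F u (Y u)] =
      dirDeriv p (fun w => α (F w) (mfderiv (𝓡 p) (𝓡 e) F w (Y w))) u (X u) -
      dirDeriv p (fun w => α (F w) (mfderiv (𝓡 p) (𝓡 e) F w (X w))) u (Y u) -
      α (F u) (mfderiv (𝓡 p) (𝓡 e) F u (mlieBracket (𝓡 p) X Y u)) := by
  have hQ1 : IsManifold (𝓡 p) 1 Q := IsManifold.of_le (n := ∞) (by simp)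
  have hN1 : IsManifold (𝓡 e) 1 N := IsManifold.of_le (n := ∞) (by simp)
  have hQ2 : IsManifold (𝓡 p) 2 Q := IsManifold.of_le (n := ∞) (by norm_cast)
  let φ := extChartAt (𝓡 p) u
  let ψ := extChartAt (𝓡 e) (F u)
  let z₀ := φ u
  have hφt : φ.target ∈ 𝓝 z₀ := extChartAt_target_mem_nhds (I := 𝓡 p) u
  have hφs : φ.symm z₀ = u := extChartAt_to_inv u
  -- In charts at `u` and `F u`: `G` is the local expression of `F`, and `ζ` that of the form `F^*α`.
  let G : EuclideanSpace ℝ (Fin p) → EuclideanSpace ℝ (Fin e) := fun z => ψ (F (φ.symm z))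
  let η := formInChart (toForm α) (F u)
  let ζ : EuclideanSpace ℝ (Fin p) → (EuclideanSpace ℝ (Fin p)) [⋀^Fin 1]→L[ℝ] ℝ := fun z =>
    (η (G z)).compContinuousLinearMap (fderiv ℝ G z)
  have hφsymm : ∀ᶠ z in 𝓝 z₀, z ∈ φ.target ∧ φ.symm z ∈ φ.source ∧ F (φ.symm z) ∈ ψ.source := by
    have h1 : Tendsto φ.symm (𝓝 z₀) (𝓝 u) := by
      have := continuousAt_extChartAt_symm (I := 𝓡 p) u
      rwa [ContinuousAt, hφs] at this
    filter_upwards [hφt, h1.eventually (hF.continuous.continuousAt.eventually_mem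
      (extChartAt_source_mem_nhds (I := 𝓡 e) (F u)))] with z h2 h3
    exact ⟨h2, φ.map_target h2, h3⟩
  have hGat : ∀ᶠ z in 𝓝 z₀, ContDiffAt ℝ ∞ G z := by
    filter_upwards [hφsymm.eventually_nhds] with z hz
    obtain ⟨h1, h2, h3⟩ := hz.self_of_nhds
    rw [← contMDiffAt_iff_contDiffAt]
    have e1 : ContMDiffAt 𝓘(ℝ, EuclideanSpace ℝ (Fin p)) (𝓡 p) ∞ φ.symm z :=
      (contMDiffOn_extChartAt_symm u).contMDiffAt
        ((isOpen_extChartAt_target u).mem_nhds h1)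
    have e2 : ContMDiffAt (𝓡 e) 𝓘(ℝ, EuclideanSpace ℝ (Fin e)) ∞ ψ (F (φ.symm z)) :=
      contMDiffAt_extChartAt' (by rwa [extChartAt_source] at h3)
    exact e2.comp z ((hF _).comp z e1)
  have hη : DifferentiableAt ℝ η (G z₀) := by
    have h1 := hα (F u)
    rw [preimage_univ, inter_univ] at h1
    have h2 : (extChartAt (𝓡 e) (F u)).target ∈ 𝓝 (G z₀) := by
      change _ ∈ 𝓝 (ψ (F (φ.symm z₀)))
      rw [hφs]
      exact extChartAt_target_mem_nhds (I := 𝓡 e) (F u)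
    exact (h1.contDiffAt h2).differentiableAt (by simp)
  have hζd : DifferentiableAt ℝ ζ z₀ := by
    have hG := hGat.self_of_nhds
    have h1 : DifferentiableAt ℝ (fun z => η (G z)) z₀ :=
      hη.comp z₀ (hG.differentiableAt (by simp))
    have h2 : DifferentiableAt ℝ (fderiv ℝ G) z₀ :=
      (hG.fderiv_right (m := 1) (by norm_cast)).differentiableAt (by simp)
    exact h1.continuousAlternatingMapCompContinuousLinearMap h2
  have hinv : ∀ (Z : VField p Q), ∀ z ∈ φ.target,
      mfderiv 𝓘(ℝ, EuclideanSpace ℝ (Fin p)) (𝓡 p) φ.symm z (mpullbackWithin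
        𝓘(ℝ, EuclideanSpace ℝ (Fin p)) (𝓡 p) φ.symm Z (range (𝓡 p)) z) = Z (φ.symm z) := by
    intro Z z hz
    have h1 := isInvertible_mfderivWithin_extChartAt_symm (I := 𝓡 p) hz
    rw [mpullbackWithin_apply]
    rw [ModelWithCorners.range_eq_univ, mfderivWithin_univ] at h1 ⊢
    exact h1.self_apply_inverse _
  have hval : ∀ (Z : VField p Q), ∀ᶠ z in 𝓝 z₀, ζ z ![mpullbackWithin
      𝓘(ℝ, EuclideanSpace ℝ (Fin p)) (𝓡 p) φ.symm Z (range (𝓡 p)) z] =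
      α (F (φ.symm z)) (mfderiv (𝓡 p) (𝓡 e) F (φ.symm z) (Z (φ.symm z))) := by
    intro Z
    filter_upwards [hφsymm.eventually_nhds, hGat] with z hz hGz
    obtain ⟨h1, h2, h3⟩ := hz.self_of_nhds
    have d1 : MDifferentiableAt 𝓘(ℝ, EuclideanSpace ℝ (Fin p)) (𝓡 p) φ.symm z :=
      ((contMDiffOn_extChartAt_symm (n := ∞) u).contMDiffAt
        ((isOpen_extChartAt_target u).mem_nhds h1)).mdifferentiableAt (by simp)
    have d2 : MDifferentiableAt 𝓘(ℝ, EuclideanSpace ℝ (Fin e)) (𝓡 e) ψ.symm (G z) :=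
      ((contMDiffOn_extChartAt_symm (n := ∞) (F u)).contMDiffAt
        ((isOpen_extChartAt_target (F u)).mem_nhds (ψ.map_source h3))).mdifferentiableAt (by simp)
    have c1 := mfderiv_comp z (hF.mdifferentiableAt (by simp) : MDifferentiableAt (𝓡 p) (𝓡 e) F _) d1
    have c2 := mfderiv_comp z d2 (hGz.differentiableAt (by simp)).mdifferentiableAt
    have c3 : ψ.symm ∘ G =ᶠ[𝓝 z] F ∘ φ.symm := by
      filter_upwards [hz] with y hy
      exact ψ.left_inv hy.2.2
    have c4 := c3.mfderiv_eq (I := 𝓘(ℝ, EuclideanSpace ℝ (Fin p))) (I' := 𝓡 e)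
    rw [c2, c1, mfderiv_eq_fderiv] at c4
    have key : ∀ (x x' : N), x = x' → ∀ v : EuclideanSpace ℝ (Fin e), α x v = α x' v := by
      rintro x _ rfl v; rfl
    refine (key _ _ (ψ.left_inv h3) _).trans ?_
    refine congrArg (α (F (φ.symm z))) ?_
    refine (congrArg (fun L => L (mpullbackWithin
      𝓘(ℝ, EuclideanSpace ℝ (Fin p)) (𝓡 p) φ.symm Z (range (𝓡 p)) z)) c4).trans ?_
    exact congrArg (mfderiv (𝓡 p) (𝓡 e) F (φ.symm z)) (hinv Z z h1)
  have hat : ∀ (Z : VField p Q), mpullbackWithin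
      𝓘(ℝ, EuclideanSpace ℝ (Fin p)) (𝓡 p) φ.symm Z (range (𝓡 p)) z₀ = Z u := by
    intro Z
    have h1 := mfderiv_extChartAt_comp_mfderivWithin_extChartAt_symm' (I := 𝓡 p)
      (mem_extChartAt_source (I := 𝓡 p) u)
    rw [ModelWithCorners.range_eq_univ, mfderivWithin_univ, mfderiv_extChartAt_self] at h1
    have key : ∀ (x x' : Q), x = x' → (Z x : EuclideanSpace ℝ (Fin p)) = Z x' := by
      rintro x _ rfl; rfl
    refine Eq.trans (congrArg (fun L => L (mpullbackWithin
      𝓘(ℝ, EuclideanSpace ℝ (Fin p)) (𝓡 p) φ.symm Z (range (𝓡 p)) z₀)) h1).symm ?_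
    exact (hinv Z z₀ (mem_of_mem_nhds hφt)).trans (key _ _ hφs)
  have hfun : ∀ Z : VField p Q, (fun w => α (F w) (mfderiv (𝓡 p) (𝓡 e) F w (Z w))) =ᶠ[𝓝 u]
      fun w => (fun z => ζ z ![mpullbackWithin
        𝓘(ℝ, EuclideanSpace ℝ (Fin p)) (𝓡 p) φ.symm Z (range (𝓡 p)) z]) (φ w) := by
    intro Z
    have h1 : Tendsto φ (𝓝 u) (𝓝 z₀) := continuousAt_extChartAt (I := 𝓡 p) u
    filter_upwards [h1.eventually (hval Z), extChartAt_source_mem_nhds (I := 𝓡 p) u] with w hw hws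
    have key : ∀ (x x' : Q), x = x' → α (F x) (mfderiv (𝓡 p) (𝓡 e) F x (Z x)) =
        α (F x') (mfderiv (𝓡 p) (𝓡 e) F x' (Z x')) := by
      rintro x _ rfl; rfl
    exact (hw.trans (key _ _ (φ.left_inv hws))).symm
  have hfield : ∀ Z : VField p Q,
      MDifferentiableAt (𝓡 p) (𝓡 p).tangent (fun w => (⟨w, Z w⟩ : TangentBundle (𝓡 p) Q)) u →
      DifferentiableAt ℝ (mpullbackWithin
        𝓘(ℝ, EuclideanSpace ℝ (Fin p)) (𝓡 p) φ.symm Z (range (𝓡 p))) z₀ := by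
    intro Z hZ
    have := MDifferentiableWithinAt.differentiableWithinAt_mpullbackWithin_vectorField
      (mdifferentiableWithinAt_univ.2 hZ)
    exact this.differentiableAt (by simp)
  have hXd := hfield X hX
  have hYd := hfield Y hY
  have happ : ∀ V : EuclideanSpace ℝ (Fin p) → EuclideanSpace ℝ (Fin p),
      DifferentiableAt ℝ V z₀ → DifferentiableAt ℝ (fun z => ζ z ![V z]) z₀ := by
    intro V hV
    exact hζd.continuousAlternatingMap_apply fun i => by
      fin_cases i
      exact hV
  have hdX := mfderiv_eq_fderiv_of_chart (hfun X) (happ _ hXd) (Y u)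
  have hdY := mfderiv_eq_fderiv_of_chart (hfun Y) (happ _ hYd) (X u)
  refine ⟨hdY.1, ?_⟩
  rw [hdX.2, hdY.2]
  have hext := extDeriv_one_apply hζd hXd hYd
  have hGF : ∀ v : EuclideanSpace ℝ (Fin p),
      (mfderiv (𝓡 p) (𝓡 e) F u v : EuclideanSpace ℝ (Fin e)) = fderiv ℝ G z₀ v := by
    intro v
    have h1 := (hF.mdifferentiableAt (by simp) : MDifferentiableAt (𝓡 p) (𝓡 e) F u).mfderiv
    rw [ModelWithCorners.range_eq_univ, fderivWithin_univ] at h1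
    exact congrArg (fun L => L v) h1
  have hG0 : G z₀ = ψ (F u) := congrArg (fun w => ψ (F w)) hφs
  have hbr : (mlieBracket (𝓡 p) X Y u : EuclideanSpace ℝ (Fin p)) = lieBracket ℝ
      (mpullbackWithin 𝓘(ℝ, EuclideanSpace ℝ (Fin p)) (𝓡 p) φ.symm X (range (𝓡 p)))
      (mpullbackWithin 𝓘(ℝ, EuclideanSpace ℝ (Fin p)) (𝓡 p) φ.symm Y (range (𝓡 p))) z₀ := by
    rw [← mlieBracketWithin_univ, mlieBracketWithin_apply]
    have h1 : ∀ v : EuclideanSpace ℝ (Fin p),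
        (mfderiv (𝓡 p) 𝓘(ℝ, EuclideanSpace ℝ (Fin p)) (extChartAt (𝓡 p) u) u).inverse v = v := by
      intro v
      rw [mfderiv_extChartAt_self]
      exact congrArg (fun L : EuclideanSpace ℝ (Fin p) →L[ℝ] EuclideanSpace ℝ (Fin p) => L v)
        ContinuousLinearMap.inverse_id
    refine (h1 _).trans ?_
    have h2 : (extChartAt (𝓡 p) u).symm ⁻¹' univ ∩ range (𝓡 p) = univ := by
      rw [ModelWithCorners.range_eq_univ, preimage_univ, inter_univ]
    have h3 : ∀ (V W : EuclideanSpace ℝ (Fin p) → EuclideanSpace ℝ (Fin p))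
        (s : Set (EuclideanSpace ℝ (Fin p))) (z : EuclideanSpace ℝ (Fin p)), s = univ →
        lieBracketWithin ℝ V W s z = lieBracket ℝ V W z := by
      rintro V W _ z rfl
      rw [lieBracketWithin_univ]
    exact h3 _ _ _ _ h2
  have hval0 := (hval (mlieBracket (𝓡 p) X Y)).self_of_nhds
  have hL : extD (toForm α) (F u) ![mfderiv (𝓡 p) (𝓡 e) F u (X u), mfderiv (𝓡 p) (𝓡 e) F u (Y u)] =
      extDeriv ζ z₀ ![mpullbackWithin
        𝓘(ℝ, EuclideanSpace ℝ (Fin p)) (𝓡 p) φ.symm X (range (𝓡 p)) z₀, mpullbackWithin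
        𝓘(ℝ, EuclideanSpace ℝ (Fin p)) (𝓡 p) φ.symm Y (range (𝓡 p)) z₀] := by
    rw [extDeriv_pullback (r := ∞) hη hGat.self_of_nhds (by simp; norm_cast), hG0]
    have h1 : ∀ v : EuclideanSpace ℝ (Fin e),
        mfderiv (𝓡 e) 𝓘(ℝ, EuclideanSpace ℝ (Fin e)) (extChartAt (𝓡 e) (F u)) (F u) v = v := by
      intro v; rw [mfderiv_extChartAt_self]; rfl
    refine congrArg (extDeriv η (ψ (F u))) ?_
    funext i
    fin_cases i
    · refine (h1 _).trans ((hGF _).trans ?_)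
      exact congrArg (fderiv ℝ G z₀) (hat X).symm
    · refine (h1 _).trans ((hGF _).trans ?_)
      exact congrArg (fderiv ℝ G z₀) (hat Y).symm
  rw [hL, hext]
  refine congrArg₂ _ (congrArg₂ _ (congrArg _ (hat X)) (congrArg _ (hat Y))) ?_
  have key : ∀ (x x' : Q), x = x' → α (F x) (mfderiv (𝓡 p) (𝓡 e) F x (mlieBracket (𝓡 p) X Y x)) =
      α (F x') (mfderiv (𝓡 p) (𝓡 e) F x' (mlieBracket (𝓡 p) X Y x')) := by
    rintro x _ rfl; rfl
  rw [← hbr]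
  refine Eq.trans ?_ (hval0.trans (key _ _ hφs))
  exact congrArg (fun v : EuclideanSpace ℝ (Fin p) => ζ z₀ ![v]) (hat _).symm

end Forms

/-! ### The soldering isomorphisms and the form `Ω` -/

section Soldering

open Set Filter Topology

theorem gBracket_apply {n : ℕ} (X Y : GNegOne n) :
    (gBracket X Y).1 0 1 = ∑ i, (Y i 0 * X i 1 - X i 0 * Y i 1) := by
  simp [gBracket, Matrix.mul_apply, Finset.sum_sub_distrib]

theorem gBracket_single {n : ℕ} (X : GNegOne n) (k : Fin n) :
    (gBracket X (Matrix.single k 0 1)).1 0 1 = X k 1 ∧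
      (gBracket X (Matrix.single k 1 1)).1 0 1 = -X k 0 := by
  rw [gBracket_apply, gBracket_apply]
  constructor <;> simp [Matrix.single_apply, Finset.sum_ite_eq]

/-- The bracket `𝔤₋₁ × 𝔤₋₁ → 𝔤₋₂` is non-degenerate. -/
theorem eq_zero_of_gBracket {n : ℕ} {X : GNegOne n} (h : ∀ Y, (gBracket X Y).1 0 1 = 0) : X = 0 := by
  ext i j
  have h1 := (gBracket_single X i).1.symm.trans (h _)
  have h2 := (gBracket_single X i).2.symm.trans (h _)
  fin_cases j
  · simpa using h2
  · simpa using h1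

/-- For `n ≥ 2`, the wedge product with the bracket is injective on linear functionals. -/
theorem eq_zero_of_wedge_gBracket {n : ℕ} (hn : 2 ≤ n) (l : GNegOne n →ₗ[ℝ] ℝ)
    (h : ∀ X Y Z, l X * (gBracket Y Z).1 0 1 - l Y * (gBracket X Z).1 0 1 +
      l Z * (gBracket X Y).1 0 1 = 0) : l = 0 := by
  have key : ∀ i j, l (Matrix.single i j 1) = 0 := by
    intro i j
    have : Nontrivial (Fin n) := Fin.nontrivial_iff_two_le.2 hn
    obtain ⟨k, hk⟩ := exists_ne i
    -- In a row `k ≠ i` the bracket is non-zero, while row `i` has zero bracket with row `k`.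
    have h1 := h (Matrix.single i j 1) (Matrix.single k 0 1) (Matrix.single k 1 1)
    rw [(gBracket_single _ k).2, (gBracket_single _ k).2, (gBracket_single _ k).1] at h1
    simpa [Matrix.single_apply, hk.symm] using h1
  apply LinearMap.ext
  intro X
  have hX : X = ∑ i, ∑ j, X i j • (Matrix.single i j 1 : GNegOne n) := by
    conv_lhs => rw [Matrix.matrix_eq_sum_single X]
    simp
  rw [hX]
  simp only [map_sum, map_smul, key, smul_zero, Finset.sum_const_zero, LinearMap.zero_apply]

variable {n p₀ : ℕ} {P₀ M : Type*} [TopologicalSpace P₀]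
  [ChartedSpace (EuclideanSpace ℝ (Fin p₀)) P₀] [IsManifold (𝓡 p₀) ∞ P₀]
  [TopologicalSpace M] [ChartedSpace (EuclideanSpace ℝ (Fin (2 * n))) M]
  [IsManifold (𝓡 (2 * n)) ∞ M]

/-- A strictly horizontal form factors through the surjection `T_uP₀ → T_xM`. -/
theorem PACSStructure.exists_solderEquiv (S : PACSStructure n p₀ P₀ M) (u : P₀) :
    ∃ σ : EuclideanSpace ℝ (Fin (2 * n)) ≃ₗ[ℝ] GNegOne n,
      ∀ v, σ (mfderiv (𝓡 p₀) (𝓡 (2 * n)) S.proj u v) = S.solder u v := by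
  let L : EuclideanSpace ℝ (Fin p₀) →ₗ[ℝ] EuclideanSpace ℝ (Fin (2 * n)) :=
    (mfderiv (𝓡 p₀) (𝓡 (2 * n)) S.proj u).toLinearMap
  let θ : EuclideanSpace ℝ (Fin p₀) →ₗ[ℝ] GNegOne n := S.solder u
  have hL : Function.Surjective L := S.surjective_mfderiv_proj u
  obtain ⟨R, hR⟩ := L.exists_rightInverse_of_surjective (LinearMap.range_eq_top.2 hL)
  have hR' : ∀ v, L (R v) = v := fun v => congrArg (fun f => f v) hR
  have hk : ∀ v, θ v = 0 ↔ L v = 0 := S.ker_solder u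
  have hinj : Function.Injective (θ ∘ₗ R) := by
    rw [← LinearMap.ker_eq_bot, LinearMap.ker_eq_bot']
    intro v hv
    rw [← hR' v]
    exact (hk _).1 hv
  refine ⟨LinearEquiv.ofInjectiveOfFinrankEq (θ ∘ₗ R) hinj ?_, fun v => ?_⟩
  · rw [finrank_euclideanSpace_fin, Module.finrank_matrix]
    simp [mul_comm]
  · have h1 : L (R (L v) - (show EuclideanSpace ℝ (Fin p₀) from v)) = 0 := by rw [map_sub, hR', sub_self]
    have h2 := (hk _).2 h1
    rw [map_sub, sub_eq_zero] at h2
    exact h2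

/-- The isomorphism `T_xM → 𝔤₋₁` that the soldering form induces at a point `u` over `x`. The tangent
space is written as the model space, so that its elements need no transport along equalities of base
points. -/
noncomputable def PACSStructure.solderEquiv (S : PACSStructure n p₀ P₀ M) (u : P₀) :
    EuclideanSpace ℝ (Fin (2 * n)) ≃ₗ[ℝ] GNegOne n :=
  (S.exists_solderEquiv u).choose

theorem PACSStructure.solderEquiv_mfderiv (S : PACSStructure n p₀ P₀ M) (u : P₀)
    (v : TangentSpace (𝓡 p₀) u) :
    S.solderEquiv u (mfderiv (𝓡 p₀) (𝓡 (2 * n)) S.proj u v) = S.solder u v :=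
  (S.exists_solderEquiv u).choose_spec v

theorem PACSStructure.solderEquiv_act (S : PACSStructure n p₀ P₀ M) (u : P₀) (g : GZero n)
    (v : EuclideanSpace ℝ (Fin (2 * n))) :
    S.solderEquiv (S.act u g) v = adNegOne g⁻¹ (S.solderEquiv u v) := by
  obtain ⟨x, rfl⟩ := S.surjective_mfderiv_proj u v
  rw [S.solderEquiv_mfderiv, ← S.solder_act, ← S.solderEquiv_mfderiv]
  congr 1
  have h1 := mfderiv_comp u (S.smooth_proj.mdifferentiableAt (by simp) :
    MDifferentiableAt (𝓡 p₀) (𝓡 (2 * n)) S.proj (S.act u g))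
    ((S.contMDiff_act_const g).mdifferentiableAt (by simp))
  have h2 : S.proj ∘ (fun w => S.act w g) = S.proj := funext fun w => S.proj_act w g
  rw [h2] at h1
  exact congrArg (fun L => L x) h1

/-- A section of `ℓ` is at each point a multiple of the bracket. -/
theorem PACSStructure.IsSectionOn.exists_eq {S : PACSStructure n p₀ P₀ M} {η : DForm (2 * n) M 2}
    {U : Set M} (h : S.IsSectionOn η U) {u : P₀} {x : M} (hx : S.proj u = x) (hxU : x ∈ U) :
    ∃ c : ℝ, ∀ v v' : EuclideanSpace ℝ (Fin (2 * n)),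
      η x ![v, v'] = c * (gBracket (S.solderEquiv u v) (S.solderEquiv u v')).1 0 1 := by
  subst hx
  obtain ⟨c, hc⟩ := h u hxU
  refine ⟨c, fun v v' => ?_⟩
  obtain ⟨x, rfl⟩ := S.surjective_mfderiv_proj u v
  obtain ⟨x', rfl⟩ := S.surjective_mfderiv_proj u v'
  rw [S.solderEquiv_mfderiv, S.solderEquiv_mfderiv, ← hc]
  refine congrArg (η (S.proj u)) ?_
  funext i
  fin_cases i <;> rfl

/-- The factor between a section `η` of `ℓ` and the bracket, at a point of `𝒢₀`. -/
noncomputable def PACSStructure.IsSectionOn.factor {S : PACSStructure n p₀ P₀ M}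
    {η : DForm (2 * n) M 2} (h : S.IsSectionOn η univ) (u : P₀) : ℝ :=
  (h.exists_eq rfl (mem_univ (S.proj u))).choose

theorem PACSStructure.IsSectionOn.factor_spec {S : PACSStructure n p₀ P₀ M}
    {η : DForm (2 * n) M 2} (h : S.IsSectionOn η univ) {u : P₀} {x : M} (hx : S.proj u = x)
    (v v' : EuclideanSpace ℝ (Fin (2 * n))) :
    η x ![v, v'] = h.factor u * (gBracket (S.solderEquiv u v) (S.solderEquiv u v')).1 0 1 := by
  subst hx
  exact (h.exists_eq rfl (mem_univ (S.proj u))).choose_spec v v'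

theorem dForm_two_ext {d : ℕ} {X : Type*} [TopologicalSpace X]
    [ChartedSpace (EuclideanSpace ℝ (Fin d)) X] {η ζ : DForm d X 2} {x : X}
    (h : ∀ v v' : EuclideanSpace ℝ (Fin d), η x ![v, v'] = ζ x ![v, v']) : η x = ζ x := by
  ext v
  have hv : v = ![v 0, v 1] := by ext i; fin_cases i <;> rfl
  rw [hv]
  exact h _ _

/-- Two sections of `ℓ` are proportional where one of them does not vanish. -/
theorem PACSStructure.IsSectionOn.exists_smul {S : PACSStructure n p₀ P₀ M}
    {η Ω : DForm (2 * n) M 2} {U : Set M} (hη : S.IsSectionOn η U) (hΩ : S.IsSectionOn Ω univ)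
    {x : M} (hx : x ∈ U) (h0 : η x ≠ 0) : ∃ f : ℝ, Ω x = f • η x := by
  obtain ⟨u, hu⟩ := S.surjective_proj x
  obtain ⟨c, hc⟩ := hη.exists_eq hu hx
  obtain ⟨c', hc'⟩ := hΩ.exists_eq hu (mem_univ x)
  have hc0 : c ≠ 0 := by
    rintro rfl
    refine h0 (dForm_two_ext (ζ := 0) fun v v' => ?_)
    rw [hc, zero_mul]
    rfl
  refine ⟨c' / c, dForm_two_ext (ζ := (c' / c) • η) fun v v' => ?_⟩
  have : ((c' / c) • η) x ![v, v'] = (c' / c) * η x ![v, v'] := rfl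
  rw [this, hc, hc', ← mul_assoc, div_mul_cancel₀ _ hc0]

/-- The wedge product of a linear functional with a non-zero element of `ℓ` is non-zero. -/
theorem PACSStructure.IsSectionOn.eq_zero_of_wedge (hn : 2 ≤ n) {S : PACSStructure n p₀ P₀ M}
    {η : DForm (2 * n) M 2} {U : Set M} (hη : S.IsSectionOn η U) {x : M} (hx : x ∈ U) (h0 : η x ≠ 0)
    (l : EuclideanSpace ℝ (Fin (2 * n)) →L[ℝ] ℝ)
    (h : ∀ a b c : EuclideanSpace ℝ (Fin (2 * n)),
      l a * η x ![b, c] - l b * η x ![a, c] + l c * η x ![a, b] = 0) : l = 0 := by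
  obtain ⟨u, hu⟩ := S.surjective_proj x
  obtain ⟨c, hc⟩ := hη.exists_eq hu hx
  have hc0 : c ≠ 0 := by
    rintro rfl
    refine h0 (dForm_two_ext (ζ := 0) fun v v' => ?_)
    rw [hc, zero_mul]
    rfl
  have h1 : l.toLinearMap ∘ₗ (S.solderEquiv u).symm.toLinearMap = 0 := by
    refine eq_zero_of_wedge_gBracket hn _ fun X Y Z => ?_
    have h2 := h ((S.solderEquiv u).symm X) ((S.solderEquiv u).symm Y) ((S.solderEquiv u).symm Z)
    simp only [hc, LinearEquiv.apply_symm_apply] at h2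
    refine mul_left_cancel₀ hc0 ?_
    rw [mul_zero, ← h2]
    simp only [LinearMap.comp_apply, LinearEquiv.coe_coe, ContinuousLinearMap.coe_coe]
    ring
  ext v
  have := congrArg (fun f => f (S.solderEquiv u v)) h1
  simpa using this

end Soldering

/-! ### Closed sections of `ℓ` -/

section ClosedForms

open Set Filter Topology

variable {d : ℕ} {M : Type*} [TopologicalSpace M] [ChartedSpace (EuclideanSpace ℝ (Fin d)) M]
  [IsManifold (𝓡 d) ∞ M]

theorem eventuallyEq_const_of_mfderiv_eq_zero {f : M → ℝ} {U : Set M} (hU : IsOpen U)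
    (hf : ∀ y ∈ U, MDifferentiableAt (𝓡 d) 𝓘(ℝ, ℝ) f y ∧ mfderiv (𝓡 d) 𝓘(ℝ, ℝ) f y = 0) {x : M}
    (hx : x ∈ U) : ∀ᶠ y in 𝓝 x, f y = f x := by
  let φ := extChartAt (𝓡 d) x
  have hφs : φ.symm (φ x) = x := extChartAt_to_inv x
  have h1 : ∀ᶠ z in 𝓝 (φ x), z ∈ φ.target ∧ φ.symm z ∈ U := by
    have h2 : Tendsto φ.symm (𝓝 (φ x)) (𝓝 x) := by
      have := continuousAt_extChartAt_symm (I := 𝓡 d) x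
      rwa [ContinuousAt, hφs] at this
    exact Filter.Eventually.and (p := fun z => z ∈ φ.target)
      (extChartAt_target_mem_nhds (I := 𝓡 d) x) (h2.eventually (hU.mem_nhds hx))
  obtain ⟨r, hr, hball⟩ := Metric.eventually_nhds_iff_ball.1 h1
  have h3 : ∀ z ∈ Metric.ball (φ x) r, HasFDerivAt (f ∘ φ.symm) (0 : _ →L[ℝ] ℝ) z := by
    intro z hz
    obtain ⟨hz1, hz2⟩ := hball z hz
    have d1 : MDifferentiableAt 𝓘(ℝ, EuclideanSpace ℝ (Fin d)) (𝓡 d) φ.symm z :=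
      ((contMDiffOn_extChartAt_symm (n := ∞) x).contMDiffAt
        ((isOpen_extChartAt_target x).mem_nhds hz1)).mdifferentiableAt (by simp)
    have h4 := (hf _ hz2).1.hasMFDerivAt.comp z d1.hasMFDerivAt
    rw [(hf _ hz2).2] at h4
    exact h4.hasFDerivAt
  have h5 : ∀ z ∈ Metric.ball (φ x) r, f (φ.symm z) = f x := by
    intro z hz
    have := Metric.isOpen_ball.is_const_of_fderiv_eq_zero
      ((convex_ball (φ x) r).isPreconnected)
      (fun z hz => (h3 z hz).differentiableAt.differentiableWithinAt) (fun z hz => (h3 z hz).fderiv)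
      hz (Metric.mem_ball_self hr)
    simpa [hφs] using this
  have h6 : ∀ᶠ y in 𝓝 x, φ y ∈ Metric.ball (φ x) r :=
    (continuousAt_extChartAt (I := 𝓡 d) x).eventually_mem (Metric.ball_mem_nhds _ hr)
  filter_upwards [h6, extChartAt_source_mem_nhds (I := 𝓡 d) x] with y hy hys
  rw [← h5 _ hy]
  exact congrArg f (φ.left_inv hys).symm

theorem mfderiv_extChartAt_symm_self (x : M) (v : EuclideanSpace ℝ (Fin d)) :
    mfderiv 𝓘(ℝ, EuclideanSpace ℝ (Fin d)) (𝓡 d) (extChartAt (𝓡 d) x).symm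
      (extChartAt (𝓡 d) x x) v = v := by
  have : IsManifold (𝓡 d) 1 M := IsManifold.of_le (n := ∞) (by simp)
  have h1 := mfderiv_extChartAt_comp_mfderivWithin_extChartAt_symm' (I := 𝓡 d)
    (mem_extChartAt_source (I := 𝓡 d) x)
  rw [ModelWithCorners.range_eq_univ, mfderivWithin_univ, mfderiv_extChartAt_self] at h1
  exact congrArg (fun L => L v) h1

theorem formInChart_self {k : ℕ} (η : DForm d M k) (x : M) (v : Fin k → EuclideanSpace ℝ (Fin d)) :
    formInChart η x (extChartAt (𝓡 d) x x) v = η x v := by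
  have key : ∀ (y y' : M), y = y' → ∀ v : Fin k → EuclideanSpace ℝ (Fin d), η y v = η y' v := by
    rintro y _ rfl v; rfl
  refine Eq.trans ?_ (key _ _ (extChartAt_to_inv (I := 𝓡 d) x) v)
  refine congrArg (η _) (funext fun i => mfderiv_extChartAt_symm_self x (v i))

theorem extD_apply {k : ℕ} (η : DForm d M k) (x : M) (v : Fin (k + 1) → EuclideanSpace ℝ (Fin d)) :
    extD η x v = extDeriv (formInChart η x) (extChartAt (𝓡 d) x x) v := by
  have : IsManifold (𝓡 d) 1 M := IsManifold.of_le (n := ∞) (by simp)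
  refine congrArg (extDeriv (formInChart η x) (extChartAt (𝓡 d) x x)) (funext fun i => ?_)
  have : ∀ v : EuclideanSpace ℝ (Fin d),
      mfderiv (𝓡 d) 𝓘(ℝ, EuclideanSpace ℝ (Fin d)) (extChartAt (𝓡 d) x) x v = v := by
    intro v
    rw [mfderiv_extChartAt_self]
    rfl
  exact this (v i)

omit [IsManifold (𝓡 d) ∞ M] in
theorem SmoothFormOn.contDiffAt {k : ℕ} {η : DForm d M k} {U : Set M} (h : SmoothFormOn η U)
    (hU : IsOpen U) {x y : M} (hx : y ∈ U) (hy : y ∈ (extChartAt (𝓡 d) x).source) :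
    ContDiffAt ℝ ∞ (formInChart η x) (extChartAt (𝓡 d) x y) := by
  refine (h x).contDiffAt (((continuousOn_extChartAt_symm x).isOpen_inter_preimage
    (isOpen_extChartAt_target x) hU).mem_nhds ⟨(extChartAt (𝓡 d) x).map_source hy, ?_⟩)
  rw [mem_preimage, (extChartAt (𝓡 d) x).left_inv hy]
  exact hx

/-- If `η` and `f η` are both closed, then `df ∧ η = 0`. -/
theorem wedge_eq_zero_of_closed {η Ω : DForm d M 2} {U : Set M} (hU : IsOpen U)
    (hη : SmoothFormOn η U) (hΩ : SmoothFormOn Ω U) {f : M → ℝ} (hf : ∀ y ∈ U, Ω y = f y • η y)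
    {x : M} (hx : x ∈ U) (h0 : η x ≠ 0) (hηx : extD η x = 0) (hΩx : extD Ω x = 0) :
    MDifferentiableAt (𝓡 d) 𝓘(ℝ, ℝ) f x ∧ ∀ a b c : EuclideanSpace ℝ (Fin d),
      dirDeriv d f x a * η x ![b, c] - dirDeriv d f x b * η x ![a, c] +
        dirDeriv d f x c * η x ![a, b] = 0 := by
  let φ := extChartAt (𝓡 d) x
  let ηh := formInChart η x
  let Ωh := formInChart Ω x
  have hφs : φ.symm (φ x) = x := extChartAt_to_inv x
  have hxs : x ∈ φ.source := mem_extChartAt_source x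
  have hηd : DifferentiableAt ℝ ηh (φ x) := (hη.contDiffAt hU hx hxs).differentiableAt (by simp)
  have hΩd : DifferentiableAt ℝ Ωh (φ x) := (hΩ.contDiffAt hU hx hxs).differentiableAt (by simp)
  have h1 : ∀ᶠ z in 𝓝 (φ x), Ωh z = f (φ.symm z) • ηh z := by
    have h2 : Tendsto φ.symm (𝓝 (φ x)) (𝓝 x) := by
      have := continuousAt_extChartAt_symm (I := 𝓡 d) x
      rwa [ContinuousAt, hφs] at this
    filter_upwards [h2.eventually (hU.mem_nhds hx)] with z hz
    ext v
    exact DFunLike.congr_fun (hf _ hz)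
      (fun i => mfderiv 𝓘(ℝ, EuclideanSpace ℝ (Fin d)) (𝓡 d) φ.symm z (v i))
  obtain ⟨a, b, hab⟩ : ∃ a b : EuclideanSpace ℝ (Fin d), ηh (φ x) ![a, b] ≠ 0 := by
    by_contra! hcon
    exact h0 (dForm_two_ext (ζ := 0) fun v v' => (formInChart_self η x _).symm.trans (hcon v v'))
  have hηab : DifferentiableAt ℝ (fun z => ηh z ![a, b]) (φ x) :=
    hηd.continuousAlternatingMap_apply fun i => differentiableAt_const _
  have hΩab : DifferentiableAt ℝ (fun z => Ωh z ![a, b]) (φ x) :=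
    hΩd.continuousAlternatingMap_apply fun i => differentiableAt_const _
  -- `f` is differentiable, as a quotient of coefficients of `Ω` and `η`.
  have hfd : DifferentiableAt ℝ (fun z => f (φ.symm z)) (φ x) := by
    refine (hΩab.mul (hηab.inv hab)).congr_of_eventuallyEq ?_
    filter_upwards [h1, hηab.continuousAt.eventually_ne hab] with z hz hz0
    rw [Pi.mul_apply, hz]
    exact (mul_inv_cancel_right₀ hz0 _).symm
  have h3 : f =ᶠ[𝓝 x] fun y => (fun z => f (φ.symm z)) (φ y) := by
    filter_upwards [extChartAt_source_mem_nhds (I := 𝓡 d) x] with y hy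
    exact congrArg f (φ.left_inv hy).symm
  have h4 := fun v => mfderiv_eq_fderiv_of_chart h3 hfd v
  refine ⟨(h4 0).1, fun a b c => ?_⟩
  have h5 : fderiv ℝ Ωh (φ x) = f (φ.symm (φ x)) • fderiv ℝ ηh (φ x) +
      (fderiv ℝ (fun z => f (φ.symm z)) (φ x)).smulRight (ηh (φ x)) := by
    rw [EventuallyEq.fderiv_eq h1]
    exact fderiv_fun_smul hfd hηd
  have h6 : extDeriv Ωh (φ x) ![a, b, c] = 0 := by
    rw [← extD_apply, hΩx]; rfl
  have h7 : extDeriv ηh (φ x) ![a, b, c] = 0 := by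
    rw [← extD_apply, hηx]; rfl
  rw [extDeriv, h5, ContinuousAlternatingMap.alternatizeUncurryFin_add,
    ContinuousAlternatingMap.alternatizeUncurryFin_smul] at h6
  have h8 : ContinuousAlternatingMap.alternatizeUncurryFin
      ((fderiv ℝ (fun z => f (φ.symm z)) (φ x)).smulRight (ηh (φ x))) ![a, b, c] = 0 := by
    have h9 : ContinuousAlternatingMap.alternatizeUncurryFin (fderiv ℝ ηh (φ x)) ![a, b, c] = 0 := h7
    simpa [h9] using h6
  rw [ContinuousAlternatingMap.alternatizeUncurryFin_apply, Fin.sum_univ_three] at h8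
  have e0 : Fin.removeNth (0 : Fin 3) ![a, b, c] = ![b, c] := by
    ext1 i; fin_cases i <;> rfl
  have e1 : Fin.removeNth (1 : Fin 3) ![a, b, c] = ![a, c] := by
    ext1 i; fin_cases i <;> rfl
  have e2 : Fin.removeNth (2 : Fin 3) ![a, b, c] = ![a, b] := by
    ext1 i; fin_cases i <;> rfl
  rw [e0, e1, e2] at h8
  have e : ∀ v w : EuclideanSpace ℝ (Fin d), η x ![v, w] = ηh (φ x) ![v, w] := fun v w =>
    (formInChart_self η x _).symm
  rw [(h4 a).2, (h4 b).2, (h4 c).2, e, e, e, ← h8]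
  simp [φ]
  ring

theorem extD_zero {k : ℕ} : extD (0 : DForm d M k) = 0 := by
  funext x
  have h1 : formInChart (0 : DForm d M k) x = fun _ => 0 := by
    funext z
    ext v
    rfl
  have h2 : extDeriv (formInChart (0 : DForm d M k) x) (extChartAt (𝓡 d) x x) = 0 := by
    rw [h1, extDeriv, fderiv_fun_const]
    ext v
    simp [ContinuousAlternatingMap.alternatizeUncurryFin_apply]
  ext v
  refine (extD_apply _ x v).trans ?_
  rw [h2]
  rfl

variable {n p₀ e : ℕ} {P₀ N M : Type*} [TopologicalSpace P₀]
  [ChartedSpace (EuclideanSpace ℝ (Fin p₀)) P₀] [IsManifold (𝓡 p₀) ∞ P₀]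
  [TopologicalSpace M] [ChartedSpace (EuclideanSpace ℝ (Fin (2 * n))) M]
  [IsManifold (𝓡 (2 * n)) ∞ M] [TopologicalSpace N] [ChartedSpace (EuclideanSpace ℝ (Fin e)) N]

/-- A closed global section `Ω` of `ℓ` is locally a constant multiple of any nowhere zero closed
section: if `Ω = f η`, then `df ∧ η = 0`, so that `df = 0`. Hence it vanishes either everywhere or
nowhere. -/
theorem PACSStructure.IsParallelSection.eq_zero_or (hn : 2 ≤ n) [PreconnectedSpace M]
    {S : PACSStructure n p₀ P₀ M} (hS : S.IsPCS) {Ω : DForm (2 * n) M 2}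
    (hΩ : S.IsParallelSection Ω) : (∀ x, Ω x = 0) ∨ ∀ x, Ω x ≠ 0 := by
  have hloc : ∀ x, (∀ᶠ y in 𝓝 x, Ω y = 0) ∨ ∀ᶠ y in 𝓝 x, Ω y ≠ 0 := by
    intro x
    obtain ⟨U, hU, hxU, η, hη, hsec, hcl⟩ := hS x
    have hex : ∀ y, ∃ f : ℝ, y ∈ U → Ω y = f • η y := by
      intro y
      by_cases hy : y ∈ U
      · obtain ⟨f, hf⟩ := hsec.exists_smul hΩ.2.1 hy (hcl y hy).1
        exact ⟨f, fun _ => hf⟩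
      · exact ⟨0, fun h => absurd h hy⟩
    choose f hf using hex
    have hΩU : SmoothFormOn Ω U := fun x₀ => (hΩ.1 x₀).mono fun z hz => ⟨hz.1, mem_univ _⟩
    have hdf : ∀ y ∈ U, MDifferentiableAt (𝓡 (2 * n)) 𝓘(ℝ, ℝ) f y ∧
        mfderiv (𝓡 (2 * n)) 𝓘(ℝ, ℝ) f y = 0 := by
      intro y hy
      obtain ⟨h1, h2⟩ := wedge_eq_zero_of_closed hU hη hΩU hf hy (hcl y hy).1 (hcl y hy).2
        (by rw [hΩ.2.2]; rfl)
      exact ⟨h1, hsec.eq_zero_of_wedge hn hy (hcl y hy).1 _ h2⟩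
    have h3 := eventuallyEq_const_of_mfderiv_eq_zero hU hdf hxU
    rcases eq_or_ne (f x) 0 with h0 | h0
    · left
      filter_upwards [h3, hU.mem_nhds hxU] with y hy hyU
      rw [hf y hyU, hy, h0, zero_smul]
    · right
      filter_upwards [h3, hU.mem_nhds hxU] with y hy hyU
      rw [hf y hyU, hy]
      exact smul_ne_zero h0 (hcl y hyU).1
  have hclopen : IsClopen {x | Ω x = 0} := by
    constructor
    · rw [← isOpen_compl_iff, isOpen_iff_mem_nhds]
      intro x hx
      rcases hloc x with h | h
      · exact absurd h.self_of_nhds hx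
      · exact h
    · rw [isOpen_iff_mem_nhds]
      intro x hx
      rcases hloc x with h | h
      · exact h
      · exact absurd hx h.self_of_nhds
  rcases isClopen_iff.1 hclopen with h | h
  · exact Or.inr fun x hx => (h ▸ (show x ∈ {x | Ω x = 0} from hx) : x ∈ (∅ : Set M))
  · exact Or.inl fun x => (h ▸ mem_univ x : x ∈ {x | Ω x = 0})

/-- A compatible connection on a circle bundle with non-vanishing real Chern class has a nowhere zero
curvature. -/
theorem PACSStructure.IsParallelSection.ne_zero (hn : 2 ≤ n) [PreconnectedSpace M]
    {S : PACSStructure n p₀ P₀ M} (hS : S.IsPCS) {Ω : DForm (2 * n) M 2}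
    (hΩ : S.IsParallelSection Ω) {B : PrincipalBundle Circle e N (2 * n) M} {α : OneForm e N}
    (hα : B.IsConnection α) (hdα : extD (toForm α) = formPullback (2 * n) e B.proj Ω)
    (hc : (0 : DForm (2 * n) M 2) ∉ B.chernClass) (x : M) : Ω x ≠ 0 := by
  refine (hΩ.eq_zero_or hn hS).resolve_left (fun h => hc ⟨α, Ω, hα, hΩ.1, hdα, 0, ?_, ?_⟩) x
  · have h1 : toForm (0 : OneForm (2 * n) M) = 0 := by
      funext y; ext v; rfl
    rw [h1]
    intro x₀
    refine (contDiffOn_const (c := 0)).congr fun z _ => ?_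
    ext v
    rfl
  · have h1 : toForm (0 : OneForm (2 * n) M) = 0 := by
      funext y; ext v; rfl
    have h2 : Ω = 0 := funext h
    rw [h1, extD_zero, h2, smul_zero, sub_zero]

end ClosedForms

/-! ### Smooth vector fields along maps -/

section Along

open Set Filter Topology

variable {E : Type*} [NormedAddCommGroup E] [NormedSpace ℝ E]
  {H : Type*} [TopologicalSpace H] {I : ModelWithCorners ℝ E H}
  {X : Type*} [TopologicalSpace X] [ChartedSpace H X]
  {p e d : ℕ} {Q N M : Type*} [TopologicalSpace Q] [ChartedSpace (EuclideanSpace ℝ (Fin p)) Q]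
  [TopologicalSpace N] [ChartedSpace (EuclideanSpace ℝ (Fin e)) N] [IsManifold (𝓡 e) ∞ N]
  [TopologicalSpace M] [ChartedSpace (EuclideanSpace ℝ (Fin d)) M] [IsManifold (𝓡 d) ∞ M]

theorem ContMDiffOn.contMDiffAt_tangentMap_comp {h : N → M} {U : Set N} (hU : IsOpen U)
    (hh : ContMDiffOn (𝓡 e) (𝓡 d) ∞ h U) {V : X → TangentBundle (𝓡 e) N} {x₀ : X}
    (hV : ContMDiffAt I (𝓡 e).tangent ∞ V x₀) (hx : (V x₀).1 ∈ U) :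
    ContMDiffAt I (𝓡 d).tangent ∞ (fun x => (⟨h (V x).1, mfderiv (𝓡 e) (𝓡 d) h (V x).1 (V x).2⟩ :
      TangentBundle (𝓡 d) M)) x₀ := by
  have : IsManifold (𝓡 e) 1 N := IsManifold.of_le (n := ∞) (by simp)
  have : IsManifold (𝓡 d) 1 M := IsManifold.of_le (n := ∞) (by simp)
  have h1 := hh.contMDiffOn_tangentMapWithin (m := ∞) (by simp) hU.uniqueMDiffOn
  have hO : IsOpen ((fun v : TangentBundle (𝓡 e) N => v.1) ⁻¹' U) :=
    hU.preimage (FiberBundle.continuous_proj (EuclideanSpace ℝ (Fin e)) (TangentSpace (𝓡 e)))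
  have h2 := (h1.contMDiffAt (hO.mem_nhds hx)).comp x₀ hV
  refine h2.congr_of_eventuallyEq ?_
  filter_upwards [hV.continuousAt.eventually_mem (hO.mem_nhds hx)] with x hxU
  rw [Function.comp_apply, tangentMapWithin, mfderivWithin_of_isOpen hU hxU]

theorem trivializationAt_snd {x₀ x : N} (hx : x ∈ (chartAt (EuclideanSpace ℝ (Fin e)) x₀).source)
    (v : TangentSpace (𝓡 e) x) :
    (trivializationAt (EuclideanSpace ℝ (Fin e)) (TangentSpace (𝓡 e)) x₀ ⟨x, v⟩).2 =
      mfderiv (𝓡 e) 𝓘(ℝ, EuclideanSpace ℝ (Fin e)) (extChartAt (𝓡 e) x₀) x v := by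
  have : IsManifold (𝓡 e) 1 N := IsManifold.of_le (n := ∞) (by simp)
  refine Eq.trans ?_
    (congrArg (fun L => L v) (TangentBundle.continuousLinearMapAt_trivializationAt (I := 𝓡 e) hx))
  exact (congrFun (Bundle.Trivialization.coe_linearMapAt_of_mem
    (trivializationAt (EuclideanSpace ℝ (Fin e)) (TangentSpace (𝓡 e)) x₀) (by simpa using hx)) v).symm

/-- A map `x ↦ v x` to the tangent bundle is smooth if its base point and its components in a chart
are. -/
theorem contMDiffAt_tangentBundle_iff {y : X → N} {v : ∀ x, TangentSpace (𝓡 e) (y x)} {x₀ : X}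
    (hy : ContMDiffAt I (𝓡 e) ∞ y x₀) :
    ContMDiffAt I (𝓡 e).tangent ∞ (fun x => (⟨y x, v x⟩ : TangentBundle (𝓡 e) N)) x₀ ↔
      ContMDiffAt I 𝓘(ℝ, EuclideanSpace ℝ (Fin e)) ∞ (fun x =>
        (mfderiv (𝓡 e) 𝓘(ℝ, EuclideanSpace ℝ (Fin e)) (extChartAt (𝓡 e) (y x₀)) (y x) (v x) :
          EuclideanSpace ℝ (Fin e))) x₀ := by
  rw [Bundle.contMDiffAt_totalSpace, and_iff_right hy]
  refine Filter.EventuallyEq.contMDiffAt_iff ?_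
  filter_upwards [hy.continuousAt.eventually_mem (chart_source_mem_nhds (EuclideanSpace ℝ (Fin e)) (y x₀))] with x hx
  exact trivializationAt_snd hx _

/-- The vector field on the domain of the chart at `x₀` which is constant in this chart. -/
noncomputable def coordField (x₀ : N) (a : EuclideanSpace ℝ (Fin e)) : VField e N := fun y =>
  (mfderiv 𝓘(ℝ, EuclideanSpace ℝ (Fin e)) (𝓡 e) (extChartAt (𝓡 e) x₀).symm
    (extChartAt (𝓡 e) x₀ y) a : EuclideanSpace ℝ (Fin e))

theorem coordField_self (x₀ : N) (a : EuclideanSpace ℝ (Fin e)) : coordField x₀ a x₀ = a :=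
  mfderiv_extChartAt_symm_self x₀ a

theorem mfderiv_extChartAt_coordField {x₀ y : N} (hy : y ∈ (extChartAt (𝓡 e) x₀).source)
    (a : EuclideanSpace ℝ (Fin e)) :
    mfderiv (𝓡 e) 𝓘(ℝ, EuclideanSpace ℝ (Fin e)) (extChartAt (𝓡 e) x₀) y (coordField x₀ a y) = a := by
  have : IsManifold (𝓡 e) 1 N := IsManifold.of_le (n := ∞) (by simp)
  have h1 := mfderiv_extChartAt_comp_mfderivWithin_extChartAt_symm' (I := 𝓡 e) hy
  rw [ModelWithCorners.range_eq_univ, mfderivWithin_univ] at h1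
  exact congrArg (fun L => L a) h1

theorem coordField_mfderiv_extChartAt {x₀ y : N} (hy : y ∈ (extChartAt (𝓡 e) x₀).source)
    (v : TangentSpace (𝓡 e) y) :
    coordField x₀ (mfderiv (𝓡 e) 𝓘(ℝ, EuclideanSpace ℝ (Fin e)) (extChartAt (𝓡 e) x₀) y v) y = v := by
  have : IsManifold (𝓡 e) 1 N := IsManifold.of_le (n := ∞) (by simp)
  have h1 := mfderivWithin_extChartAt_symm_comp_mfderiv_extChartAt' (I := 𝓡 e) hy
  rw [ModelWithCorners.range_eq_univ, mfderivWithin_univ] at h1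
  exact congrArg (fun L => L v) h1

theorem contMDiffAt_coordField {x₀ y : N} (hy : y ∈ (extChartAt (𝓡 e) x₀).source)
    (a : EuclideanSpace ℝ (Fin e)) :
    ContMDiffAt (𝓡 e) (𝓡 e).tangent ∞
      (fun x => (⟨x, coordField x₀ a x⟩ : TangentBundle (𝓡 e) N)) y := by
  have : IsManifold (𝓡 e) 1 N := IsManifold.of_le (n := ∞) (by simp)
  rw [extChartAt_source] at hy
  have h1 := (trivializationAt (EuclideanSpace ℝ (Fin e)) (TangentSpace (𝓡 e))
    x₀).contMDiffOn_section_baseSet_iff (IB := 𝓡 e) (n := ∞) (s := coordField (e := e) x₀ a)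
  have h2 := h1.2 ((contMDiffOn_const (c := a)).congr fun x hx => ?_)
  · exact h2.contMDiffAt ((trivializationAt (EuclideanSpace ℝ (Fin e)) (TangentSpace (𝓡 e))
      x₀).open_baseSet.mem_nhds hy)
  · rw [trivializationAt_snd (by simpa using hx)]
    exact mfderiv_extChartAt_coordField (by simpa using hx) a

theorem SmoothFormOn.contMDiffAt_apply_coordField {k : ℕ} {η : DForm e N k} {U : Set N}
    (h : SmoothFormOn η U) (hU : IsOpen U) {x₀ y : N} (hyU : y ∈ U)
    (hy : y ∈ (extChartAt (𝓡 e) x₀).source) (a : Fin k → EuclideanSpace ℝ (Fin e)) :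
    ContMDiffAt (𝓡 e) 𝓘(ℝ, ℝ) ∞ (fun x => η x fun i => coordField x₀ (a i) x) y := by
  have h1 : ContDiffAt ℝ ∞ (fun z => formInChart η x₀ z a) (extChartAt (𝓡 e) x₀ y) :=
    ((ContinuousAlternatingMap.apply ℝ (EuclideanSpace ℝ (Fin e)) ℝ a).contDiff.contDiffAt).comp _
      (h.contDiffAt hU hyU hy)
  have h2 := h1.contMDiffAt.comp y (contMDiffAt_extChartAt' (n := ∞) (by simpa using hy))
  refine h2.congr_of_eventuallyEq ?_
  filter_upwards [(isOpen_extChartAt_source (I := 𝓡 e) x₀).mem_nhds hy] with x hx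
  have key : ∀ (y y' : N), y = y' → ∀ v : Fin k → EuclideanSpace ℝ (Fin e), η y v = η y' v := by
    rintro y _ rfl v; rfl
  exact key _ _ ((extChartAt (𝓡 e) x₀).left_inv hx).symm _

/-- The solution `v` of a smooth family of invertible linear equations `Φ x v = b x` is smooth. -/
theorem contMDiffAt_of_apply_eq {F : Type*} [NormedAddCommGroup F] [NormedSpace ℝ F] {m : ℕ}
    {Φ : X → EuclideanSpace ℝ (Fin m) →L[ℝ] F} {v : X → EuclideanSpace ℝ (Fin m)} {b : X → F} {x₀ : X}
    (hΦ : ∀ a, ContMDiffAt I 𝓘(ℝ, F) ∞ (fun x => Φ x a) x₀) (hinv : (Φ x₀).IsInvertible)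
    (hb : ContMDiffAt I 𝓘(ℝ, F) ∞ b x₀) (hv : ∀ᶠ x in 𝓝 x₀, Φ x (v x) = b x) :
    ContMDiffAt I 𝓘(ℝ, EuclideanSpace ℝ (Fin m)) ∞ v x₀ := by
  have h1 : ContMDiffAt I 𝓘(ℝ, EuclideanSpace ℝ (Fin m) →L[ℝ] F) ∞ Φ x₀ := by
    have h2 : ∀ x, Φ x = ∑ i, ContinuousLinearMap.smulRightL ℝ (EuclideanSpace ℝ (Fin m)) F
        (EuclideanSpace.proj i) (Φ x (EuclideanSpace.single i 1)) := by
      intro x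
      ext w
      conv_lhs => rw [← (EuclideanSpace.basisFun (Fin m) ℝ).sum_repr w]
      simp
    rw [funext h2]
    exact contMDiffAt_finsetSum fun i _ =>
      (ContinuousLinearMap.contDiff _).contMDiff.contMDiffAt.comp x₀ (hΦ _)
  obtain ⟨T, hT⟩ := hinv
  have h3 : ContDiffAt ℝ ∞ ContinuousLinearMap.inverse (Φ x₀) := by
    rw [← hT]
    exact contDiffAt_map_inverse T
  have h4 := (h3.contMDiffAt.comp x₀ h1).clm_apply hb
  refine h4.congr_of_eventuallyEq ?_
  have h5 : ∀ᶠ x in 𝓝 x₀, (Φ x).IsInvertible := by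
    have h6 := T.nhds
    rw [hT] at h6
    exact h1.continuousAt.eventually_mem h6
  filter_upwards [hv, h5] with x hx hx'
  rw [← hx]
  exact (hx'.inverse_apply_self _).symm

/-- The generator of a smooth one-parameter family of maps starting at the identity is a smooth vector
field. -/
theorem contMDiff_generator {Φ : ℝ → N → N}
    (hΦ : ContMDiff (𝓘(ℝ, ℝ).prod (𝓡 e)) (𝓡 e) ∞ (fun y : ℝ × N => Φ y.1 y.2))
    (h0 : ∀ x, Φ 0 x = x) : ContMDiff (𝓡 e) (𝓡 e).tangent ∞ (fun x =>
      (⟨x, (mfderiv 𝓘(ℝ, ℝ) (𝓡 e) (fun t => Φ t x) 0 (1 : ℝ) : EuclideanSpace ℝ (Fin e))⟩ :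
        TangentBundle (𝓡 e) N)) := by
  have : IsManifold (𝓡 e) 1 N := IsManifold.of_le (n := ∞) (by simp)
  have h1 := hΦ.contMDiff_tangentMap (m := ∞) (by simp)
  have h2 := contMDiff_equivTangentBundleProd_symm (I := 𝓘(ℝ, ℝ)) (M := ℝ) (I' := 𝓡 e) (M' := N)
    (n := ∞)
  have h3 : ContMDiff (𝓡 e) (𝓘(ℝ, ℝ).tangent.prod (𝓡 e).tangent) ∞ (fun x : N =>
      ((⟨0, (1 : ℝ)⟩ : TangentBundle 𝓘(ℝ, ℝ) ℝ), (⟨x, 0⟩ : TangentBundle (𝓡 e) N))) :=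
    contMDiff_const.prodMk (Bundle.contMDiff_zeroSection ℝ (TangentSpace (𝓡 e)))
  have key : ∀ (y x : N) (v w : EuclideanSpace ℝ (Fin e)), x = y → w = v →
      (⟨x, w⟩ : TangentBundle (𝓡 e) N) = ⟨y, v⟩ := by
    rintro y _ v _ rfl rfl; rfl
  refine ((h1.comp h2).comp h3).congr fun x => key _ _ _ _ (h0 x).symm ?_
  have d1 : MDifferentiableAt (𝓘(ℝ, ℝ).prod (𝓡 e)) (𝓡 e) (fun y : ℝ × N => Φ y.1 y.2) (0, x) :=
    hΦ.mdifferentiableAt (by simp)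
  have d2 : HasMFDerivAt 𝓘(ℝ, ℝ) (𝓘(ℝ, ℝ).prod (𝓡 e)) (fun t : ℝ => (t, x)) 0
      ((ContinuousLinearMap.id ℝ ℝ).prod 0) :=
    (hasMFDerivAt_id (I := 𝓘(ℝ, ℝ)) (0 : ℝ)).prodMk (hasMFDerivAt_const x (0 : ℝ))
  have d3 := d1.hasMFDerivAt.comp (0 : ℝ) d2
  exact congrArg (fun L => L (1 : ℝ)) d3.mfderiv

end Along

/-! ### The contact form and its Reeb field -/

section Contact

open Set Filter Topology

variable {E : Type*} [NormedAddCommGroup E] [NormedSpace ℝ E]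
  {H : Type*} [TopologicalSpace H] {I : ModelWithCorners ℝ E H}
  {X : Type*} [TopologicalSpace X] [ChartedSpace H X]
  {n p₀ e d : ℕ} {P₀ N M : Type*} [TopologicalSpace P₀]
  [ChartedSpace (EuclideanSpace ℝ (Fin p₀)) P₀] [IsManifold (𝓡 p₀) ∞ P₀]

/-- The soldering form applied to a smooth vector field along a map is smooth: over the domain of a
section `s`, the isomorphism at `s(y) g` is `Ad(g⁻¹)` applied to `v ↦ θ(T_ys v)`. -/
theorem PACSStructure.contMDiffAt_solderEquiv [TopologicalSpace M]
    [ChartedSpace (EuclideanSpace ℝ (Fin (2 * n))) M] [IsManifold (𝓡 (2 * n)) ∞ M]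
    (S : PACSStructure n p₀ P₀ M) {V : X → TangentBundle (𝓡 (2 * n)) M} {w : X → P₀} {x₀ : X}
    (hV : ContMDiffAt I (𝓡 (2 * n)).tangent ∞ V x₀) (hw : ContMDiffAt I (𝓡 p₀) ∞ w x₀)
    (hwV : ∀ᶠ x in 𝓝 x₀, S.proj (w x) = (V x).1) (i : Fin n) (j : Fin 2) :
    ContMDiffAt I 𝓘(ℝ, ℝ) ∞ (fun x => S.solderEquiv (w x) (V x).2 i j) x₀ := by
  obtain ⟨U, hU, hx, s, τ, hs, hps, hτ, hsτ⟩ := S.locally_trivial (S.proj (w x₀))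
  have hx' : (V x₀).1 ∈ U := by rwa [← hwV.self_of_nhds]
  have hO : IsOpen (S.proj ⁻¹' U) := hU.preimage S.smooth_proj.continuous
  have hτ' : GSmoothOn (𝓡 p₀) τ (S.proj ⁻¹' U) := hτ
  have c1 : ∀ k l, ContMDiffAt I 𝓘(ℝ, ℝ) ∞ (fun x => ((τ (w x)).2⁻¹).1 k l) x₀ := fun k l =>
    ((gSmoothOn_so.1 hτ'.snd.so_inv k l).contMDiffAt (hO.mem_nhds hx)).comp x₀ hw
  have c2 : ∀ k l, ContMDiffAt I 𝓘(ℝ, ℝ) ∞ (fun x => glMat (τ (w x)).1 k l) x₀ := fun k l =>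
    ((gSmoothOn_gl.1 hτ'.fst k l).contMDiffAt (hO.mem_nhds hx)).comp x₀ hw
  have c3 : ∀ k l, ContMDiffAt I 𝓘(ℝ, ℝ) ∞ (fun x => S.solder (s (V x).1)
      (mfderiv (𝓡 (2 * n)) (𝓡 p₀) s (V x).1 (V x).2) k l) x₀ := fun k l =>
    (S.smooth_solder k l).contMDiffAt.comp x₀ (hs.contMDiffAt_tangentMap_comp hU hV hx')
  have key : ∀ y ∈ U, ∀ v : TangentSpace (𝓡 (2 * n)) y,
      S.solderEquiv (s y) v = S.solder (s y) (mfderiv (𝓡 (2 * n)) (𝓡 p₀) s y v) := by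
    intro y hy v
    rw [← S.solderEquiv_mfderiv]
    congr 1
    have hsd : MDifferentiableAt (𝓡 (2 * n)) (𝓡 p₀) s y :=
      (hs.contMDiffAt (hU.mem_nhds hy)).mdifferentiableAt (by simp)
    have h := mfderiv_comp y (S.smooth_proj.mdifferentiableAt (by simp) :
      MDifferentiableAt (𝓡 p₀) (𝓡 (2 * n)) S.proj (s y)) hsd
    have h2 : mfderiv (𝓡 (2 * n)) (𝓡 (2 * n)) (S.proj ∘ s) y = ContinuousLinearMap.id ℝ _ := by
      rw [← mfderiv_id (I := 𝓡 (2 * n)) (x := y)]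
      refine Filter.EventuallyEq.mfderiv_eq ?_
      filter_upwards [hU.mem_nhds hy] with z hz using hps z hz
    exact (congrArg (fun L => L v) (h.symm.trans h2)).symm
  have h1 : ContMDiffAt I 𝓘(ℝ, ℝ) ∞ (fun x => ∑ l, (∑ k, ((τ (w x)).2⁻¹).1 i k * S.solder (s (V x).1)
      (mfderiv (𝓡 (2 * n)) (𝓡 p₀) s (V x).1 (V x).2) k l) * glMat (τ (w x)).1 l j) x₀ :=
    contMDiffAt_finsetSum fun l _ => ContMDiffAt.mul (contMDiffAt_finsetSum fun k _ =>
      (c1 i k).mul (c3 k l)) (c2 l j)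
  refine h1.congr_of_eventuallyEq ?_
  filter_upwards [hwV, (hw.continuousAt).eventually_mem (hO.mem_nhds hx)] with x hxV hxU
  have hyU : (V x).1 ∈ U := by rw [← hxV]; exact hxU
  have h3 : S.act (s (V x).1) (τ (w x)) = w x := by rw [← hxV]; exact hsτ _ hxU
  have h4 : ∀ v : TangentSpace (𝓡 (2 * n)) (V x).1, S.solderEquiv (w x) v =
      adNegOne (τ (w x))⁻¹ (S.solder (s (V x).1) (mfderiv (𝓡 (2 * n)) (𝓡 p₀) s (V x).1 v)) := by
    intro v
    rw [← key _ hyU]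
    refine Eq.trans ?_ (S.solderEquiv_act _ _ _)
    rw [h3]
  refine (congrFun (congrFun (h4 _) i) j).trans ?_
  change (((τ (w x))⁻¹).2.1 * (_ : GNegOne n) * glMat (((τ (w x))⁻¹).1)⁻¹) i j = _
  rw [Prod.fst_inv, inv_inv, Matrix.mul_apply]
  simp only [Matrix.mul_apply]
  rfl

section Fundamental

variable [TopologicalSpace N] [ChartedSpace (EuclideanSpace ℝ (Fin e)) N] [TopologicalSpace M]
  [ChartedSpace (EuclideanSpace ℝ (Fin d)) M]

/-- The fundamental vector field `∂ₜ` of a circle bundle. -/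
noncomputable def PrincipalBundle.fundamentalField (B : PrincipalBundle Circle e N d M) :
    VField e N := fun x =>
  (mfderiv 𝓘(ℝ, ℝ) (𝓡 e) (fun t : ℝ => B.act x (Circle.exp t)) 0 (1 : ℝ) :
    EuclideanSpace ℝ (Fin e))

theorem PrincipalBundle.act_circleExp_zero (B : PrincipalBundle Circle e N d M) (x : N) :
    B.act x (Circle.exp 0) = x := by rw [Circle.exp_zero, B.act_one]

theorem PrincipalBundle.contMDiff_act_circleExp [IsManifold (𝓡 e) ∞ N]
    (B : PrincipalBundle Circle e N d M) :
    ContMDiff (𝓘(ℝ, ℝ).prod (𝓡 e)) (𝓡 e) ∞ (fun y : ℝ × N => B.act y.2 (Circle.exp y.1)) :=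
  contMDiffOn_univ.1 (B.contMDiffOn_act isOpen_univ contMDiffOn_snd
    (gSmoothOn_circleExp contMDiffOn_fst))

theorem PrincipalBundle.smooth_fundamentalField [IsManifold (𝓡 e) ∞ N]
    (B : PrincipalBundle Circle e N d M) : SmoothVFieldOn B.fundamentalField univ :=
  (contMDiff_generator (Φ := fun t x => B.act x (Circle.exp t)) B.contMDiff_act_circleExp
    B.act_circleExp_zero).contMDiffOn

theorem PrincipalBundle.mfderiv_proj_fundamentalField [IsManifold (𝓡 e) ∞ N]
    (B : PrincipalBundle Circle e N d M) (x : N) :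
    mfderiv (𝓡 e) (𝓡 d) B.proj x (B.fundamentalField x) = 0 := by
  have d1 : MDifferentiableAt 𝓘(ℝ, ℝ) (𝓡 e) (fun t : ℝ => B.act x (Circle.exp t)) 0 :=
    (B.contMDiff_act_circleExp.comp (contMDiff_id.prodMk contMDiff_const) :
      ContMDiff 𝓘(ℝ, ℝ) (𝓡 e) ∞ (fun t : ℝ => B.act x (Circle.exp t))).mdifferentiableAt (by simp)
  have key : ∀ y, B.act x (Circle.exp 0) = y →
      mfderiv (𝓡 e) (𝓡 d) B.proj y (B.fundamentalField x : EuclideanSpace ℝ (Fin e)) = 0 := by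
    rintro _ rfl
    have h1 := mfderiv_comp (0 : ℝ) (B.smooth_proj.mdifferentiableAt (by simp) :
      MDifferentiableAt (𝓡 e) (𝓡 d) B.proj (B.act x (Circle.exp 0))) d1
    have h2 : B.proj ∘ (fun t : ℝ => B.act x (Circle.exp t)) = fun _ => B.proj x :=
      funext fun t => B.proj_act _ _
    rw [h2, mfderiv_const] at h1
    exact (congrArg (fun L => L (1 : ℝ)) h1).symm
  exact key x (B.act_circleExp_zero x)

theorem PrincipalBundle.IsConnection.apply_fundamentalField {B : PrincipalBundle Circle e N d M}
    {α : OneForm e N} (h : B.IsConnection α) (x : N) : α x (B.fundamentalField x) = 1 := by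
  have key : ∀ y, B.act x (Circle.exp 0) = y →
      α y (B.fundamentalField x : EuclideanSpace ℝ (Fin e)) = 1 := by
    rintro _ rfl
    exact h.2.2 x
  exact key x (B.act_circleExp_zero x)

end Fundamental

variable [TopologicalSpace N] [ChartedSpace (EuclideanSpace ℝ (Fin (2 * n + 1))) N]
  [TopologicalSpace M] [ChartedSpace (EuclideanSpace ℝ (Fin (2 * n))) M]

/-- `iα` is a compatible connection, the curvature of which is given by the nowhere zero section `Ω` of
`ℓ`. -/
structure IsContactConnection (S : PACSStructure n p₀ P₀ M)
    (B : PrincipalBundle Circle (2 * n + 1) N (2 * n) M) (α : OneForm (2 * n + 1) N)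
    (Ω : DForm (2 * n) M 2) : Prop where
  connection : B.IsConnection α
  parallel : S.IsParallelSection Ω
  extD_eq : extD (toForm α) = formPullback (2 * n) (2 * n + 1) B.proj Ω
  ne_zero : ∀ x, Ω x ≠ 0

namespace IsContactConnection

variable {S : PACSStructure n p₀ P₀ M} {B : PrincipalBundle Circle (2 * n + 1) N (2 * n) M}
  {α : OneForm (2 * n + 1) N} {Ω : DForm (2 * n) M 2}

theorem extD_apply (h : IsContactConnection S B α Ω) (x : N)
    (v w : EuclideanSpace ℝ (Fin (2 * n + 1))) :
    extD (toForm α) x ![v, w] = Ω (B.proj x) ![mfderiv (𝓡 (2 * n + 1)) (𝓡 (2 * n)) B.proj x v,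
      mfderiv (𝓡 (2 * n + 1)) (𝓡 (2 * n)) B.proj x w] := by
  rw [h.extD_eq]
  refine congrArg (Ω (B.proj x)) (funext fun i => ?_)
  fin_cases i <;> rfl

variable [IsManifold (𝓡 (2 * n)) ∞ M]

theorem factor_ne_zero (h : IsContactConnection S B α Ω) (u : P₀) :
    h.parallel.2.1.factor u ≠ 0 := by
  intro h0
  refine h.ne_zero (S.proj u) (dForm_two_ext (ζ := 0) fun v v' => ?_)
  rw [h.parallel.2.1.factor_spec rfl, h0, zero_mul]
  rfl

theorem eq_zero_of_form (h : IsContactConnection S B α Ω) {x : M}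
    {v : EuclideanSpace ℝ (Fin (2 * n))} (hv : ∀ v', Ω x ![v, v'] = 0) : v = 0 := by
  obtain ⟨u, hu⟩ := S.surjective_proj x
  refine (S.solderEquiv u).injective ?_
  rw [map_zero]
  refine eq_zero_of_gBracket fun Y => ?_
  have h1 := hv ((S.solderEquiv u).symm Y)
  rw [h.parallel.2.1.factor_spec hu, LinearEquiv.apply_symm_apply] at h1
  exact (mul_eq_zero.1 h1).resolve_left (h.factor_ne_zero u)

variable [IsManifold (𝓡 (2 * n + 1)) ∞ N]

theorem exists_horizontal (h : IsContactConnection S B α Ω) (x : N) (a : ℝ)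
    (m : EuclideanSpace ℝ (Fin (2 * n))) : ∃ v : EuclideanSpace ℝ (Fin (2 * n + 1)),
      α x v = a ∧ mfderiv (𝓡 (2 * n + 1)) (𝓡 (2 * n)) B.proj x v = m := by
  obtain ⟨v, hv⟩ := B.surjective_mfderiv_proj x m
  refine ⟨v + (a - α x v) • B.fundamentalField x, ?_, ?_⟩
  · refine (map_add (α x) v _).trans ?_
    rw [map_smul, h.connection.apply_fundamentalField, smul_eq_mul, mul_one, add_sub_cancel]
  · refine (map_add (mfderiv (𝓡 (2 * n + 1)) (𝓡 (2 * n)) B.proj x) v _).trans ?_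
    rw [map_smul, B.mfderiv_proj_fundamentalField, smul_zero, add_zero]
    exact hv

theorem mfderiv_proj_eq_zero_of (h : IsContactConnection S B α Ω) {x : N}
    {v : EuclideanSpace ℝ (Fin (2 * n + 1))}
    (hv : ∀ w, α x w = 0 → extD (toForm α) x ![v, w] = 0) :
    mfderiv (𝓡 (2 * n + 1)) (𝓡 (2 * n)) B.proj x v = 0 := by
  refine h.eq_zero_of_form (x := B.proj x) fun m => ?_
  obtain ⟨w, hw0, rfl⟩ := h.exists_horizontal x 0 m
  exact (h.extD_apply x v w).symm.trans (hv w hw0)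

/-- The isomorphism `T_xN → ℝ × T_{q(x)}M`, `v ↦ (α(v), T_xq v)`. -/
noncomputable def split (h : IsContactConnection S B α Ω) (x : N) :
    EuclideanSpace ℝ (Fin (2 * n + 1)) ≃ₗ[ℝ] ℝ × EuclideanSpace ℝ (Fin (2 * n)) :=
  let L : EuclideanSpace ℝ (Fin (2 * n + 1)) →ₗ[ℝ] ℝ × EuclideanSpace ℝ (Fin (2 * n)) :=
    LinearMap.prod (α x).toLinearMap
      (mfderiv (𝓡 (2 * n + 1)) (𝓡 (2 * n)) B.proj x).toLinearMap
  have hs : Function.Surjective L := fun y => by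
    obtain ⟨v, h1, h2⟩ := h.exists_horizontal x y.1 y.2
    exact ⟨v, Prod.ext h1 h2⟩
  LinearEquiv.ofBijective L ⟨(LinearMap.injective_iff_surjective_of_finrank_eq_finrank
    (by simp [add_comm])).2 hs, hs⟩

theorem split_apply (h : IsContactConnection S B α Ω) (x : N)
    (v : EuclideanSpace ℝ (Fin (2 * n + 1))) : h.split x v =
      (α x v, (mfderiv (𝓡 (2 * n + 1)) (𝓡 (2 * n)) B.proj x v : EuclideanSpace ℝ (Fin (2 * n)))) :=
  rfl

theorem eq_zero_of (h : IsContactConnection S B α Ω) {x : N}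
    {v : EuclideanSpace ℝ (Fin (2 * n + 1))} (h1 : α x v = 0)
    (h2 : mfderiv (𝓡 (2 * n + 1)) (𝓡 (2 * n)) B.proj x v = 0) : v = 0 :=
  (h.split x).injective ((h.split_apply x v).trans ((Prod.ext h1 h2).trans (map_zero _).symm))

theorem isContactForm (h : IsContactConnection S B α Ω) : IsContactForm α := by
  refine ⟨h.connection.1, fun x => ⟨fun h0 => ?_, fun v hv hvw => h.eq_zero_of hv ?_⟩⟩
  · have h1 := h.connection.apply_fundamentalField x
    rw [h0] at h1
    exact zero_ne_one h1
  · exact h.mfderiv_proj_eq_zero_of hvw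

omit [IsManifold (𝓡 (2 * n)) ∞ M] in
theorem isReebField (h : IsContactConnection S B α Ω) : IsReebField α B.fundamentalField := by
  refine fun x => ⟨h.connection.apply_fundamentalField x, fun v => ?_⟩
  exact (h.extD_apply x _ v).trans
    ((Ω (B.proj x)).map_coord_zero 0 (B.mfderiv_proj_fundamentalField x))

theorem isReebField_unique (h : IsContactConnection S B α Ω) {ξ : VField (2 * n + 1) N}
    (hξ : IsReebField α ξ) : ξ = B.fundamentalField := by
  funext x
  refine sub_eq_zero.1 (h.eq_zero_of (x := x) ?_ ?_)
  · exact (map_sub (α x) _ _).trans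
      (by rw [(hξ x).1, h.connection.apply_fundamentalField, sub_self])
  · refine (map_sub (mfderiv (𝓡 (2 * n + 1)) (𝓡 (2 * n)) B.proj x) _ _).trans ?_
    rw [B.mfderiv_proj_fundamentalField, sub_zero]
    exact h.mfderiv_proj_eq_zero_of fun w _ => (hξ x).2 w

end IsContactConnection

end Contact

/-! ### Graded frames -/

section Frames

open Set Filter Topology

variable {n p₀ p e d : ℕ} {P₀ P N M : Type*} [TopologicalSpace P₀]
  [ChartedSpace (EuclideanSpace ℝ (Fin p₀)) P₀] [IsManifold (𝓡 p₀) ∞ P₀]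

theorem SmoothVFieldOn.mdifferentiableAt [TopologicalSpace N]
    [ChartedSpace (EuclideanSpace ℝ (Fin e)) N] [IsManifold (𝓡 e) ∞ N] {V : VField e N} {U : Set N}
    (hV : SmoothVFieldOn V U) (hU : IsOpen U) {x : N} (hx : x ∈ U) :
    MDifferentiableAt (𝓡 e) (𝓡 e).tangent (fun w => (⟨w, V w⟩ : TangentBundle (𝓡 e) N)) x :=
  (hV.contMDiffAt (hU.mem_nhds hx)).mdifferentiableAt (by simp)

theorem dirDeriv_eq_zero [TopologicalSpace N] [ChartedSpace (EuclideanSpace ℝ (Fin e)) N] {g : N → ℝ}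
    {x : N} {c : ℝ} (hg : ∀ᶠ y in 𝓝 x, g y = c) (v : TangentSpace (𝓡 e) x) : dirDeriv e g x v = 0 := by
  have h1 : g =ᶠ[𝓝 x] fun _ => c := hg
  have h2 := h1.mfderiv_eq (I := 𝓡 e) (I' := 𝓘(ℝ, ℝ))
  rw [mfderiv_const] at h2
  exact congrArg (fun L => L v) h2

/-- On sections `V`, `W` of `ker α`, the exterior derivative is `dα(V, W) = -α([V, W])`. -/
theorem apply_mlieBracket_of_mem_ker [TopologicalSpace N] [ChartedSpace (EuclideanSpace ℝ (Fin e)) N]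
    [IsManifold (𝓡 e) ∞ N] {α : OneForm e N} (hα : SmoothFormOn (toForm α) univ) {V W : VField e N}
    {U : Set N} (hU : IsOpen U) (hV : SmoothVFieldOn V U) (hW : SmoothVFieldOn W U)
    (hVW : ∀ y ∈ U, α y (V y) = 0 ∧ α y (W y) = 0) {x : N} (hx : x ∈ U) :
    α x (VectorField.mlieBracket (𝓡 e) V W x) = -extD (toForm α) x ![V x, W x] := by
  have h1 := (extD_toForm_apply_map hα (contMDiff_id (I := 𝓡 e) (M := N)) (hV.mdifferentiableAt hU hx)
    (hW.mdifferentiableAt hU hx)).2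
  have h2 : ∀ (y : N) (v : TangentSpace (𝓡 e) y), mfderiv (𝓡 e) (𝓡 e) (id : N → N) y v = v := by
    intro y v
    rw [mfderiv_id]
    rfl
  have h3 := h1.trans (congrArg₂ (· - ·) (congrArg₂ (· - ·)
    (dirDeriv_eq_zero (c := 0) ?_ (V x)) (dirDeriv_eq_zero (c := 0) ?_ (W x)))
    (congrArg (α x) (h2 x _)))
  · have h4 : extD (toForm α) x ![V x, W x] = 0 - 0 - α x (VectorField.mlieBracket (𝓡 e) V W x) := by
      refine Eq.trans ?_ h3
      refine congrArg (extD (toForm α) x) (funext fun i => ?_)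
      fin_cases i
      · exact (h2 x _).symm
      · exact (h2 x _).symm
    rw [h4]
    ring
  · filter_upwards [hU.mem_nhds hx] with y hy
    exact (congrArg (α y) (h2 y _)).trans (hVW y hy).2
  · filter_upwards [hU.mem_nhds hx] with y hy
    exact (congrArg (α y) (h2 y _)).trans (hVW y hy).1

/-- The isomorphism `𝔤₋₂ ≅ ℝ`. -/
def negTwoEntry : GNegTwo →ₗ[ℝ] ℝ where
  toFun Y := Y.1 0 1
  map_add' _ _ := rfl
  map_smul' _ _ := rfl

theorem negTwoEntry_injective : Function.Injective negTwoEntry := by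
  rw [← LinearMap.ker_eq_bot, LinearMap.ker_eq_bot']
  intro Y (hY : Y.1 0 1 = 0)
  have h1 : (Y.1)ᵀ = -Y.1 := Y.2
  have h2 : ∀ i j, Y.1 j i = -Y.1 i j := fun i j => congrFun (congrFun h1 i) j
  apply Subtype.ext
  ext i j
  fin_cases i <;> fin_cases j
  · have := h2 0 0
    change Y.1 0 0 = 0
    linarith
  · exact hY
  · have := h2 0 1
    change Y.1 1 0 = 0
    rw [this, hY, neg_zero]
  · have := h2 1 1
    change Y.1 1 1 = 0
    linarith

theorem exists_gBracket_eq (hn : 0 < n) (Y : GNegTwo) : ∃ X X' : GNegOne n, gBracket X X' = Y := by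
  refine ⟨Matrix.single ⟨0, hn⟩ 1 (Y.1 0 1), Matrix.single ⟨0, hn⟩ 0 1, negTwoEntry_injective ?_⟩
  refine (gBracket_single _ _).1.trans ?_
  rw [Matrix.single_apply_same]
  rfl

variable [TopologicalSpace N] [ChartedSpace (EuclideanSpace ℝ (Fin (2 * n + 1))) N]
  [TopologicalSpace M] [ChartedSpace (EuclideanSpace ℝ (Fin (2 * n))) M]
  [IsManifold (𝓡 (2 * n)) ∞ M] [IsManifold (𝓡 (2 * n + 1)) ∞ N]

namespace IsContactConnection

variable {S : PACSStructure n p₀ P₀ M} {B : PrincipalBundle Circle (2 * n + 1) N (2 * n) M}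
  {α : OneForm (2 * n + 1) N} {Ω : DForm (2 * n) M 2}

/-- The isomorphism `H_x → 𝔤₋₁` given by a point of `𝒢₀` over `q(x)`. -/
noncomputable def negOneEquiv (h : IsContactConnection S B α Ω) (x : N) (w : P₀) :
    kerDistribution α x ≃ₗ[ℝ] GNegOne n :=
  let L : TangentSpace (𝓡 (2 * n + 1)) x →ₗ[ℝ] EuclideanSpace ℝ (Fin (2 * n)) :=
    (mfderiv (𝓡 (2 * n + 1)) (𝓡 (2 * n)) B.proj x).toLinearMap
  LinearEquiv.ofBijective ((S.solderEquiv w).toLinearMap ∘ₗ L ∘ₗ (kerDistribution α x).subtype) <| by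
    constructor
    · rw [← LinearMap.ker_eq_bot, LinearMap.ker_eq_bot']
      intro v hv
      exact Subtype.ext (h.eq_zero_of v.2 ((S.solderEquiv w).map_eq_zero_iff.1 hv))
    · intro X
      obtain ⟨v, hv, hv'⟩ := h.exists_horizontal x 0 ((S.solderEquiv w).symm X)
      exact ⟨⟨v, hv⟩, (congrArg (S.solderEquiv w) hv').trans ((S.solderEquiv w).apply_symm_apply X)⟩

theorem negOneEquiv_apply (h : IsContactConnection S B α Ω) (x : N) (w : P₀)
    (v : kerDistribution α x) : h.negOneEquiv x w v = S.solderEquiv w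
      (mfderiv (𝓡 (2 * n + 1)) (𝓡 (2 * n)) B.proj x v.1) := rfl

/-- The isomorphism `𝔤₋₂ → T_xN/H_x` that corresponds to a point of `𝒢₀` over `q(x)`. -/
noncomputable def negTwoEquiv (h : IsContactConnection S B α Ω) (x : N) (w : P₀) :
    GNegTwo ≃ₗ[ℝ] (TangentSpace (𝓡 (2 * n + 1)) x ⧸ kerDistribution α x) :=
  LinearEquiv.ofBijective ((kerDistribution α x).mkQ ∘ₗ
    LinearMap.toSpanSingleton ℝ (TangentSpace (𝓡 (2 * n + 1)) x) (B.fundamentalField x) ∘ₗ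
      ((-h.parallel.2.1.factor w) • negTwoEntry : GNegTwo →ₗ[ℝ] ℝ)) <| by
    have hα : ∀ a : ℝ, α x (a • B.fundamentalField x) = a := fun a => by
      rw [map_smul, h.connection.apply_fundamentalField, smul_eq_mul, mul_one]
    constructor
    · rw [← LinearMap.ker_eq_bot, LinearMap.ker_eq_bot']
      intro Y hY
      have h1 : ((-h.parallel.2.1.factor w) * negTwoEntry Y) • B.fundamentalField x ∈
          kerDistribution α x := (Submodule.Quotient.mk_eq_zero _).1 hY
      have h2 := (hα _).symm.trans h1
      refine negTwoEntry_injective (((mul_eq_zero.1 h2).resolve_left ?_).trans (map_zero _).symm)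
      exact neg_ne_zero.2 (h.factor_ne_zero w)
    · intro v
      obtain ⟨v, rfl⟩ := Submodule.Quotient.mk_surjective _ v
      refine ⟨⟨!![0, α x v / (-h.parallel.2.1.factor w); -(α x v / (-h.parallel.2.1.factor w)), 0],
        ?_⟩, ?_⟩
      · change _ᵀ = -_
        ext i j
        fin_cases i <;> fin_cases j <;> simp
      · refine (Submodule.Quotient.eq (kerDistribution α x)).2 ?_
        change α x (((-h.parallel.2.1.factor w) * (α x v / (-h.parallel.2.1.factor w))) •
          B.fundamentalField x - v) = 0
        rw [map_sub, hα, mul_div_cancel₀ _ (neg_ne_zero.2 (h.factor_ne_zero w)), sub_self]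

/-- The graded frame at `x` which corresponds to a point `w` of `𝒢₀` over `q(x)`. On `H_x ≅ T_{q(x)}M`
it is given by the soldering form, and this determines it on `T_xN/H_x`, which is spanned by the Reeb
field, since the Levi bracket is `-dα = -q^*Ω`. -/
noncomputable def frame (h : IsContactConnection S B α Ω) {x : N} {w : P₀}
    (hx : B.proj x = S.proj w) : GradedFrame n (kerDistribution α) x where
  negTwo := h.negTwoEquiv x w
  negOne := (h.negOneEquiv x w).symm
  bracket U V W hU hxU hV hW hVW X Y hX hY := by
    have h1 := apply_mlieBracket_of_mem_ker h.connection.1 hU hV hW hVW hxU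
    have h2 : S.solderEquiv w (mfderiv (𝓡 (2 * n + 1)) (𝓡 (2 * n)) B.proj x (V x)) = X := by
      rw [← hX, ← h.negOneEquiv_apply, LinearEquiv.apply_symm_apply]
    have h3 : S.solderEquiv w (mfderiv (𝓡 (2 * n + 1)) (𝓡 (2 * n)) B.proj x (W x)) = Y := by
      rw [← hY, ← h.negOneEquiv_apply, LinearEquiv.apply_symm_apply]
    have h4 : extD (toForm α) x ![V x, W x] = h.parallel.2.1.factor w * (gBracket X Y).1 0 1 := by
      refine (h.extD_apply x _ _).trans ((h.parallel.2.1.factor_spec hx.symm _ _).trans ?_)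
      exact congrArg₂ (fun X Y => h.parallel.2.1.factor w * (gBracket X Y).1 0 1) h2 h3
    refine (Submodule.Quotient.eq (kerDistribution α x)).2 ?_
    refine (map_sub (α x) (((-h.parallel.2.1.factor w) * (gBracket X Y).1 0 1) •
      B.fundamentalField x) _).trans ?_
    rw [map_smul, h.connection.apply_fundamentalField, h1, h4, smul_eq_mul]
    ring

end IsContactConnection

end Frames

/-! ### Lie contact structures over the circle bundle -/

section Determined

open Set Filter Topology

variable {n p₀ p e d : ℕ} {P₀ P Q N M : Type*} [TopologicalSpace P₀]
  [ChartedSpace (EuclideanSpace ℝ (Fin p₀)) P₀] [IsManifold (𝓡 p₀) ∞ P₀]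
  [TopologicalSpace N] [ChartedSpace (EuclideanSpace ℝ (Fin (2 * n + 1))) N]
  [TopologicalSpace M] [ChartedSpace (EuclideanSpace ℝ (Fin (2 * n))) M]
  [IsManifold (𝓡 (2 * n)) ∞ M] [IsManifold (𝓡 (2 * n + 1)) ∞ N]
  [TopologicalSpace P] [ChartedSpace (EuclideanSpace ℝ (Fin p)) P] [IsManifold (𝓡 p) ∞ P]
  {S : PACSStructure n p₀ P₀ M} {B : PrincipalBundle Circle (2 * n + 1) N (2 * n) M}
  {α : OneForm (2 * n + 1) N} {Ω : DForm (2 * n) M 2}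

namespace IsContactConnection

omit [IsManifold (𝓡 (2 * n)) ∞ M] in
/-- Every element of `H` extends to a local section of `H`. -/
theorem exists_field (h : IsContactConnection S B α Ω) {x : N} (v : TangentSpace (𝓡 (2 * n + 1)) x)
    (hv : α x v = 0) : ∃ (U : Set N) (V : VField (2 * n + 1) N), IsOpen U ∧ x ∈ U ∧
      SmoothVFieldOn V U ∧ (∀ y ∈ U, α y (V y) = 0) ∧ V x = v := by
  have hα : ∀ a : ℝ, ∀ y, α y (a • B.fundamentalField y) = a := fun a y => by
    rw [map_smul, h.connection.apply_fundamentalField, smul_eq_mul, mul_one]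
  refine ⟨(extChartAt (𝓡 (2 * n + 1)) x).source,
    fun y => coordField x v y - (α y (coordField x v y)) • B.fundamentalField y,
    isOpen_extChartAt_source x, mem_extChartAt_source x, fun y hy => ?_, fun y _ => ?_, ?_⟩
  · refine ContMDiffAt.contMDiffWithinAt ?_
    have h1 := h.connection.1.contMDiffAt_apply_coordField isOpen_univ (mem_univ y) hy ![v]
    exact (contMDiffAt_coordField hy v).sub_section (ContMDiffAt.smul_section h1
      (B.smooth_fundamentalField.contMDiffAt univ_mem))
  · rw [map_sub, hα, sub_self]
  · have h1 : α x (coordField x v x) = 0 := (congrArg (α x) (coordField_self x v)).trans hv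
    have key : ∀ a b c : EuclideanSpace ℝ (Fin (2 * n + 1)), ∀ r : ℝ, a = c → r = 0 → a - r • b = c := by
      rintro a b _ _ rfl rfl
      rw [zero_smul, sub_zero]
    exact key _ _ _ _ (coordField_self x v) h1

/-- A graded frame is determined by its component on `𝔤₋₁`, since the bracket of `𝔤₋` generates
`𝔤₋₂`. -/
theorem gradedFrame_ext (h : IsContactConnection S B α Ω) (hn : 0 < n) {x : N}
    {φ ψ : GradedFrame n (kerDistribution α) x} (hφ : φ.negOne = ψ.negOne) : φ = ψ := by
  refine GradedFrame.ext (LinearEquiv.ext fun Z => ?_) hφ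
  obtain ⟨X, Y, rfl⟩ := exists_gBracket_eq hn Z
  obtain ⟨U, V, hU, hxU, hV, hV0, hVx⟩ := h.exists_field (φ.negOne X).1 (φ.negOne X).2
  obtain ⟨U', W, hU', hxU', hW, hW0, hWx⟩ := h.exists_field (φ.negOne Y).1 (φ.negOne Y).2
  have hV' : SmoothVFieldOn V (U ∩ U') := ContMDiffOn.mono hV inter_subset_left
  have hW' : SmoothVFieldOn W (U ∩ U') := ContMDiffOn.mono hW inter_subset_right
  have hVW : ∀ y ∈ U ∩ U', V y ∈ kerDistribution α y ∧ W y ∈ kerDistribution α y :=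
    fun y hy => ⟨hV0 y hy.1, hW0 y hy.2⟩
  rw [φ.bracket _ V W (hU.inter hU') ⟨hxU, hxU'⟩ hV' hW' hVW X Y hVx.symm hWx.symm,
    ψ.bracket _ V W (hU.inter hU') ⟨hxU, hxU'⟩ hV' hW' hVW X Y (by rw [← hφ, hVx])
      (by rw [← hφ, hWx])]

/-- The frame at `x` that corresponds to `w` is the only one that induces `θ` on `H_x`. -/
theorem eq_frame (h : IsContactConnection S B α Ω) (hn : 0 < n) {x : N} {w : P₀}
    (hx : B.proj x = S.proj w) {φ : GradedFrame n (kerDistribution α) x}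
    (hφ : ∀ v, φ.negOne.symm v = h.negOneEquiv x w v) : φ = h.frame hx := by
  refine h.gradedFrame_ext hn (LinearEquiv.ext fun X => ?_)
  change φ.negOne X = (h.negOneEquiv x w).symm X
  rw [LinearEquiv.eq_symm_apply, ← hφ, LinearEquiv.symm_apply_apply]

theorem frame_act (h : IsContactConnection S B α Ω) (hn : 0 < n) {x : N} {w : P₀} {g : GZero n}
    (hx : B.proj x = S.proj w) (hx' : B.proj x = S.proj (S.act w g)) :
    h.frame hx' = (h.frame hx).act g := by
  refine (h.eq_frame hn hx' fun v => ?_).symm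
  rw [h.negOneEquiv_apply]
  refine Eq.trans ?_ (S.solderEquiv_act w g _).symm
  change (adNegOne g).symm (h.negOneEquiv x w v) = _
  rw [LinearEquiv.symm_apply_eq, ← h.negOneEquiv_apply]
  refine ((adNegOne g).apply_symm_apply _).symm.trans (congrArg (adNegOne g) ?_)
  change (g⁻¹).2.1 * (_ : GNegOne n) * glMat g.1 = (g⁻¹).2.1 * (_ : GNegOne n) * glMat (g⁻¹.1)⁻¹
  rw [Prod.fst_inv, inv_inv]

theorem frame_congr (h : IsContactConnection S B α Ω) {x x' : N} {w w' : P₀}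
    (hx : B.proj x = S.proj w) (hx' : B.proj x' = S.proj w') (h1 : x = x') (h2 : w = w') :
    (⟨x, h.frame hx⟩ : FrameBundle n (kerDistribution α)) = ⟨x', h.frame hx'⟩ := by
  subst h1 h2
  rfl

omit [IsManifold (𝓡 p) ∞ P] in
/-- The graded frames given by smooth maps to `N` and to `𝒢₀` depend smoothly on the parameter: the image
of `X` solves the linear equations `α(v) = 0` and `θ(Tq v) = X`, the coefficients of which are
smooth. -/
theorem contMDiff_frame (h : IsContactConnection S B α Ω) {δ : P → N} {t : P → P₀}
    (hδ : ContMDiff (𝓡 p) (𝓡 (2 * n + 1)) ∞ δ) (ht : ContMDiff (𝓡 p) (𝓡 p₀) ∞ t)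
    (hx : ∀ u, B.proj (δ u) = S.proj (t u)) (X : GNegOne n) :
    ContMDiff (𝓡 p) (𝓡 (2 * n + 1)).tangent ∞ (fun u => (⟨δ u, ((h.frame (hx u)).negOne X :
      TangentSpace (𝓡 (2 * n + 1)) (δ u))⟩ : TangentBundle (𝓡 (2 * n + 1)) N)) := by
  intro u₀
  rw [contMDiffAt_tangentBundle_iff hδ.contMDiffAt]
  let L : N → EuclideanSpace ℝ (Fin (2 * n + 1)) →ₗ[ℝ] EuclideanSpace ℝ (Fin (2 * n + 1)) := fun y =>
    (mfderiv 𝓘(ℝ, EuclideanSpace ℝ (Fin (2 * n + 1))) (𝓡 (2 * n + 1))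
      (extChartAt (𝓡 (2 * n + 1)) (δ u₀)).symm (extChartAt (𝓡 (2 * n + 1)) (δ u₀) y)).toLinearMap
  let T : P → EuclideanSpace ℝ (Fin (2 * n + 1)) →ₗ[ℝ] ℝ × (Fin n → Fin 2 → ℝ) := fun u =>
    LinearMap.prodMap LinearMap.id
      ((Matrix.ofLinearEquiv ℝ).symm.toLinearMap ∘ₗ (S.solderEquiv (t u)).toLinearMap) ∘ₗ
      (h.split (δ u)).toLinearMap
  have hT : ∀ u v, T u v = (α (δ u) v, (S.solderEquiv (t u)
      (mfderiv (𝓡 (2 * n + 1)) (𝓡 (2 * n)) B.proj (δ u) v) : Fin n → Fin 2 → ℝ)) := fun _ _ => rfl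
  have hLapp : ∀ y a, L y a = coordField (δ u₀) a y := fun _ _ => rfl
  refine contMDiffAt_of_apply_eq (Φ := fun u => (T u ∘ₗ L (δ u)).toContinuousLinearMap)
    (b := fun _ => (0, X)) ?_ ?_ contMDiffAt_const ?_
  · intro a
    have hs : δ u₀ ∈ (extChartAt (𝓡 (2 * n + 1)) (δ u₀)).source := mem_extChartAt_source _
    have hV : ContMDiffAt (𝓡 p) (𝓡 (2 * n + 1)).tangent ∞
        (fun u => (⟨δ u, coordField (δ u₀) a (δ u)⟩ : TangentBundle (𝓡 (2 * n + 1)) N)) u₀ :=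
      (contMDiffAt_coordField hs a).comp u₀ hδ.contMDiffAt
    refine ContMDiffAt.prodMk_space ?_ ?_
    · exact (h.connection.1.contMDiffAt_apply_coordField isOpen_univ (mem_univ _) hs ![a]).comp u₀
        hδ.contMDiffAt
    · refine contMDiffAt_pi_space.2 fun i => contMDiffAt_pi_space.2 fun j => ?_
      exact S.contMDiffAt_solderEquiv
        (B.smooth_proj.contMDiffOn.contMDiffAt_tangentMap_comp isOpen_univ hV (mem_univ _))
        ht.contMDiffAt (Eventually.of_forall fun u => (hx u).symm) i j
  · have h1 : ∀ a, (T u₀ ∘ₗ L (δ u₀)) a = T u₀ a := fun a =>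
      congrArg (T u₀) ((hLapp _ a).trans (coordField_self (δ u₀) a))
    let e : EuclideanSpace ℝ (Fin (2 * n + 1)) ≃ₗ[ℝ] ℝ × (Fin n → Fin 2 → ℝ) :=
      (h.split (δ u₀)).trans ((LinearEquiv.refl ℝ ℝ).prodCongr
        ((S.solderEquiv (t u₀)).trans (Matrix.ofLinearEquiv ℝ).symm))
    refine ⟨e.toContinuousLinearEquiv, ContinuousLinearMap.ext fun a => ?_⟩
    exact (h1 a).symm
  · have h2 : ∀ᶠ u in 𝓝 u₀, δ u ∈ (extChartAt (𝓡 (2 * n + 1)) (δ u₀)).source :=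
      hδ.continuous.continuousAt.eventually_mem (extChartAt_source_mem_nhds _)
    filter_upwards [h2] with u hu
    refine (congrArg (T u) ((hLapp _ _).trans (coordField_mfderiv_extChartAt hu _))).trans ?_
    refine (hT u _).trans ?_
    refine Prod.ext ((h.frame (hx u)).negOne X).2 ?_
    refine (h.negOneEquiv_apply (δ u) (t u) ((h.frame (hx u)).negOne X)).symm.trans ?_
    exact (h.negOneEquiv (δ u) (t u)).apply_symm_apply X

/-- The Lie contact structure on `N` with the pullback of `𝒢₀` as its bundle. -/
noncomputable def lieContactStructure (h : IsContactConnection S B α Ω) (hn : 0 < n) {δ : P → N}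
    {t : P → P₀} (hF : IsFibreProduct p (2 * n + 1) p₀ δ t B.proj S.proj) :
    LieContactStructure n p P (kerDistribution α) where
  toPrincipalBundle := hF.bundle B.smooth_proj
  frame u := ⟨δ u, h.frame (hF.comm u)⟩
  reduction :=
    { fst_eq := fun _ => rfl
      equivariant := fun u g => by
        have h1 : δ ((hF.bundle B.smooth_proj).act u g) = δ u :=
          (hF.bundle B.smooth_proj).proj_act u g
        have h2 := hF.snd_act B.smooth_proj u g
        have h3 : B.proj (δ u) = S.proj (S.act (t u) g) := (hF.comm u).trans (S.proj_act _ _).symm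
        rw [MonoidHom.id_apply, h.frame_congr _ h3 h1 h2, h.frame_act hn (hF.comm u) h3]
      smooth := h.contMDiff_frame hF.smooth_fst hF.smooth_snd hF.comm }

/-- The frames of a Lie contact structure are determined by a PCS-quotient. -/
theorem frame_eq_of_isPCSQuotient (h : IsContactConnection S B α Ω) (hn : 0 < n)
    {L : LieContactStructure n p P (kerDistribution α)} {ξ : VField (2 * n + 1) N} {q₀ : P → P₀}
    (hL : IsPCSQuotient L ξ S B.proj q₀) (u : P) {x : N} (h1 : L.proj u = x)
    (hx : B.proj x = S.proj (q₀ u)) : L.frame u = ⟨x, h.frame hx⟩ := by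
  have hfst : (L.frame u).1 = x := (L.reduction.fst_eq u).trans h1
  have hx' : B.proj (L.frame u).1 = S.proj (q₀ u) := by rw [hfst, hx]
  have hF : (fun w => (L.frame w).1) = L.proj := funext L.reduction.fst_eq
  have h2 : (L.frame u).2 = h.frame hx' := by
    refine h.eq_frame hn hx' fun v => ?_
    have hsurj : ∀ f : P → N, f = L.proj → ∀ v : EuclideanSpace ℝ (Fin (2 * n + 1)),
        ∃ y : TangentSpace (𝓡 p) u, mfderiv (𝓡 p) (𝓡 (2 * n + 1)) f u y = v := by
      rintro f rfl v
      exact L.surjective_mfderiv_proj u v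
    obtain ⟨y, hy⟩ := hsurj _ hF v.1
    have hyT : InTNegOne L.frame u y := by
      refine (congrArg (fun z => z ∈ kerDistribution α (L.frame u).1) hy).mpr v.2
    have h3 := hL.solder u y hyT
    rw [tautNegOne, dif_pos hyT] at h3
    have h4 : (⟨_, hyT⟩ : kerDistribution α (L.frame u).1) = v := Subtype.ext hy
    rw [h4] at h3
    rw [← h3, h.negOneEquiv_apply, ← S.solderEquiv_mfderiv]
    refine congrArg (S.solderEquiv (q₀ u)) ?_
    have hq : MDifferentiable (𝓡 p) (𝓡 p₀) q₀ := hL.bundleMap.smooth.mdifferentiable (by simp)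
    have hp : MDifferentiable (𝓡 p₀) (𝓡 (2 * n)) S.proj := S.smooth_proj.mdifferentiable (by simp)
    have hB : MDifferentiable (𝓡 (2 * n + 1)) (𝓡 (2 * n)) B.proj :=
      B.smooth_proj.mdifferentiable (by simp)
    have hFd : MDifferentiable (𝓡 p) (𝓡 (2 * n + 1)) (fun w => (L.frame w).1) := by
      rw [hF]
      exact L.smooth_proj.mdifferentiable (by simp)
    have c1 := mfderiv_comp u (hp (q₀ u)) (hq u)
    have c2 := mfderiv_comp u (hB (L.frame u).1) (hFd u)
    have c3 : S.proj ∘ q₀ = B.proj ∘ (fun w => (L.frame w).1) := by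
      rw [hF]
      exact funext hL.bundleMap.covers
    rw [c3] at c1
    refine (congrArg (fun A => A y) (c1.symm.trans c2)).trans ?_
    exact congrArg (mfderiv (𝓡 (2 * n + 1)) (𝓡 (2 * n)) B.proj (L.frame u).1) hy
  calc L.frame u = ⟨(L.frame u).1, (L.frame u).2⟩ := rfl
    _ = ⟨(L.frame u).1, h.frame hx'⟩ := by rw [h2]
    _ = ⟨x, h.frame hx⟩ := h.frame_congr _ _ hfst rfl

end IsContactConnection

end Determined

/-! ### Infinitesimal symmetries -/

section Symmetry

open Set Filter Topology

variable {n p₀ p e d : ℕ} {P₀ P Q N M : Type*} [TopologicalSpace P₀]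
  [ChartedSpace (EuclideanSpace ℝ (Fin p₀)) P₀] [IsManifold (𝓡 p₀) ∞ P₀]
  [TopologicalSpace Q] [ChartedSpace (EuclideanSpace ℝ (Fin p)) Q] [IsManifold (𝓡 p) ∞ Q]

/-- A one-form which is smooth as a function on the tangent bundle is smooth in charts. -/
theorem smoothFormOn_toForm [TopologicalSpace N] [ChartedSpace (EuclideanSpace ℝ (Fin e)) N]
    [IsManifold (𝓡 e) ∞ N] {σ : OneForm e N} (h : ContMDiff (𝓡 e).tangent 𝓘(ℝ, ℝ) ∞
      (fun v : TangentBundle (𝓡 e) N => σ v.1 v.2)) : SmoothFormOn (toForm σ) univ := by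
  intro x₀
  rw [preimage_univ, inter_univ]
  let A : EuclideanSpace ℝ (Fin e) → EuclideanSpace ℝ (Fin e) →L[ℝ] EuclideanSpace ℝ (Fin e) :=
    fun y => mfderiv 𝓘(ℝ, EuclideanSpace ℝ (Fin e)) (𝓡 e) (extChartAt (𝓡 e) x₀).symm y
  let τ : EuclideanSpace ℝ (Fin e) → EuclideanSpace ℝ (Fin e) →L[ℝ] ℝ := fun y =>
    σ ((extChartAt (𝓡 e) x₀).symm y)
  have h1 : ContDiffOn ℝ ∞ (fun y => (τ y).comp (A y)) (extChartAt (𝓡 e) x₀).target := by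
    rw [contDiffOn_clm_apply]
    intro a y hy
    refine ContDiffAt.contDiffWithinAt ?_
    rw [← contMDiffAt_iff_contDiffAt]
    have h2 : ContMDiffAt 𝓘(ℝ, EuclideanSpace ℝ (Fin e)) (𝓡 e).tangent ∞ (fun z =>
        (⟨(extChartAt (𝓡 e) x₀).symm z, A z a⟩ : TangentBundle (𝓡 e) N)) y := by
      have h3 := (contMDiffAt_coordField (N := N) ((extChartAt (𝓡 e) x₀).map_target hy) a).comp y
        ((contMDiffOn_extChartAt_symm (n := ∞) (I := 𝓡 e) x₀).contMDiffAt
          ((isOpen_extChartAt_target x₀).mem_nhds hy))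
      refine h3.congr_of_eventuallyEq ?_
      filter_upwards [(isOpen_extChartAt_target (I := 𝓡 e) x₀).mem_nhds hy] with z hz
      have key : ∀ z z', z = z' → A z a = A z' a := by
        rintro z _ rfl; rfl
      exact congrArg (fun v : EuclideanSpace ℝ (Fin e) =>
        (⟨(extChartAt (𝓡 e) x₀).symm z, v⟩ : TangentBundle (𝓡 e) N))
        (key _ _ ((extChartAt (𝓡 e) x₀).right_inv hz).symm)
    exact h.contMDiffAt.comp y h2
  exact (ContinuousAlternatingMap.ofSubsingletonLIE (𝕜 := ℝ) (E := EuclideanSpace ℝ (Fin e)) (F := ℝ)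
    (0 : Fin 1)).contDiff.comp_contDiffOn h1

variable [TopologicalSpace N] [ChartedSpace (EuclideanSpace ℝ (Fin (2 * n + 1))) N]
  [TopologicalSpace M] [ChartedSpace (EuclideanSpace ℝ (Fin (2 * n))) M]
  [IsManifold (𝓡 (2 * n)) ∞ M]

/-- An entry of the soldering form, as a one-form. -/
noncomputable def PACSStructure.solderEntry (S : PACSStructure n p₀ P₀ M) (i : Fin n) (j : Fin 2) :
    OneForm p₀ P₀ := fun w =>
  let l : EuclideanSpace ℝ (Fin p₀) →ₗ[ℝ] ℝ := Matrix.entryLinearMap ℝ ℝ i j ∘ₗ S.solder w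
  l.toContinuousLinearMap

omit [IsManifold (𝓡 (2 * n)) ∞ M] in
theorem PACSStructure.smoothFormOn_solderEntry (S : PACSStructure n p₀ P₀ M) (i : Fin n) (j : Fin 2) :
    SmoothFormOn (toForm (S.solderEntry i j)) univ :=
  smoothFormOn_toForm (S.smooth_solder i j)

variable {S : PACSStructure n p₀ P₀ M}

/-- The factor is the quotient of `η(V, W)` by the bracket of `V` and `W`, for smooth vector fields with
non-zero bracket. -/
theorem PACSStructure.IsSectionOn.contMDiff_factor (hn : 0 < n) {η : DForm (2 * n) M 2}
    (h : S.IsSectionOn η univ) (hη : SmoothFormOn η univ) :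
    ContMDiff (𝓡 p₀) 𝓘(ℝ, ℝ) ∞ h.factor := by
  intro w₀
  obtain ⟨X, hX⟩ : ∃ X : Fin 2 → GNegOne n, (gBracket (X 0) (X 1)).1 0 1 = 1 := by
    refine ⟨![Matrix.single ⟨0, hn⟩ 1 1, Matrix.single ⟨0, hn⟩ 0 1], ?_⟩
    refine (gBracket_single _ _).1.trans ?_
    rw [Matrix.cons_val_zero, Matrix.single_apply_same]
  have hs : S.proj w₀ ∈ (extChartAt (𝓡 (2 * n)) (S.proj w₀)).source := mem_extChartAt_source _
  let a : Fin 2 → EuclideanSpace ℝ (Fin (2 * n)) := fun k => (S.solderEquiv w₀).symm (X k)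
  let V : Fin 2 → VField (2 * n) M := fun k => coordField (S.proj w₀) (a k)
  let Y : Fin 2 → P₀ → GNegOne n := fun k w => S.solderEquiv w (V k (S.proj w))
  have hY : ∀ k i j, ContMDiffAt (𝓡 p₀) 𝓘(ℝ, ℝ) ∞ (fun w => Y k w i j) w₀ := fun k i j =>
    S.contMDiffAt_solderEquiv ((contMDiffAt_coordField hs (a k)).comp w₀ S.smooth_proj.contMDiffAt)
      contMDiffAt_id (Eventually.of_forall fun _ => rfl) i j
  have hY0 : ∀ k, Y k w₀ = X k := fun k =>
    (congrArg (S.solderEquiv w₀) (coordField_self (S.proj w₀) (a k))).trans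
      ((S.solderEquiv w₀).apply_symm_apply _)
  have hg : ContMDiffAt (𝓡 p₀) 𝓘(ℝ, ℝ) ∞ (fun w => (gBracket (Y 0 w) (Y 1 w)).1 0 1) w₀ := by
    simp only [gBracket_apply]
    exact contMDiffAt_finsetSum fun i _ => ((hY 1 i 0).mul (hY 0 i 1)).sub ((hY 0 i 0).mul (hY 1 i 1))
  have hg0 : (gBracket (Y 0 w₀) (Y 1 w₀)).1 0 1 ≠ 0 := by
    rw [hY0, hY0, hX]
    exact one_ne_zero
  have hf : ContMDiffAt (𝓡 p₀) 𝓘(ℝ, ℝ) ∞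
      (fun w => η (S.proj w) fun k => V k (S.proj w)) w₀ :=
    (hη.contMDiffAt_apply_coordField isOpen_univ (mem_univ _) hs a).comp w₀
      S.smooth_proj.contMDiffAt
  refine (hf.mul (hg.inv₀ hg0)).congr_of_eventuallyEq ?_
  filter_upwards [hg.continuousAt.eventually_ne hg0] with w hw
  have h1 := h.factor_spec (u := w) rfl (V 0 (S.proj w)) (V 1 (S.proj w))
  have h2 : (fun k => V k (S.proj w)) = ![V 0 (S.proj w), V 1 (S.proj w)] := by
    funext k
    fin_cases k <;> rfl
  exact ((congrArg (fun r => r * ((gBracket (Y 0 w) (Y 1 w)).1 0 1)⁻¹)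
    ((congrArg (η (S.proj w)) h2).trans h1)).trans (mul_inv_cancel_right₀ hw _)).symm

variable [IsManifold (𝓡 (2 * n + 1)) ∞ N]

namespace IsContactConnection

variable {B : PrincipalBundle Circle (2 * n + 1) N (2 * n) M}
  {α : OneForm (2 * n + 1) N} {Ω : DForm (2 * n) M 2}

omit [IsManifold (𝓡 (2 * n + 1)) ∞ N] in
theorem negTwoEquiv_symm_apply (h : IsContactConnection S B α Ω) (x : N) (w : P₀)
    (v : TangentSpace (𝓡 (2 * n + 1)) x) (i j : Fin 2) :
    ((h.negTwoEquiv x w).symm ((kerDistribution α x).mkQ v)).1 i j =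
      α x v * ((!![0, 1; -1, 0] : Matrix (Fin 2) (Fin 2) ℝ) i j / (-h.parallel.2.1.factor w)) := by
  obtain ⟨Y, hY⟩ := (h.negTwoEquiv x w).surjective ((kerDistribution α x).mkQ v)
  rw [← hY, LinearEquiv.symm_apply_apply]
  have h1 := (Submodule.Quotient.eq (kerDistribution α x)).1 hY
  have h2 : α x (((-h.parallel.2.1.factor w) * negTwoEntry Y) • B.fundamentalField x - v) = 0 := h1
  have hc := h.factor_ne_zero w
  rw [map_sub, map_smul, h.connection.apply_fundamentalField, smul_eq_mul, mul_one, sub_eq_zero] at h2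
  rw [← h2]
  have h3 : (Y.1)ᵀ = -Y.1 := Y.2
  have h4 : ∀ i j, Y.1 j i = -Y.1 i j := fun i j => congrFun (congrFun h3 i) j
  have h5 : Y.1 i j = negTwoEntry Y * (!![0, 1; -1, 0] : Matrix (Fin 2) (Fin 2) ℝ) i j := by
    change _ = Y.1 0 1 * _
    fin_cases i <;> fin_cases j
    · have := h4 0 0
      change Y.1 0 0 = Y.1 0 1 * 0
      linarith
    · exact (mul_one _).symm
    · have := h4 0 1
      change Y.1 1 0 = Y.1 0 1 * -1
      linarith
    · have := h4 1 1
      change Y.1 1 1 = Y.1 0 1 * 0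
      linarith
  rw [h5]
  field_simp

variable {δ : Q → N} {t : Q → P₀}

omit [IsManifold (𝓡 p) ∞ Q] in
/-- On the preimage of `H`, the tautological form `θ₋₁` is the pullback of the soldering form. -/
theorem tautNegOne_frame (h : IsContactConnection S B α Ω)
    (hδ : ContMDiff (𝓡 p) (𝓡 (2 * n + 1)) ∞ δ) (ht : ContMDiff (𝓡 p) (𝓡 p₀) ∞ t)
    (hx : ∀ u, B.proj (δ u) = S.proj (t u)) {u : Q} {v : TangentSpace (𝓡 p) u}
    (hv : α (δ u) (mfderiv (𝓡 p) (𝓡 (2 * n + 1)) δ u v) = 0) :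
    tautNegOne (fun w => (⟨δ w, h.frame (hx w)⟩ : FrameBundle n (kerDistribution α))) u v =
      S.solder (t u) (mfderiv (𝓡 p) (𝓡 p₀) t u v) := by
  have hv' : InTNegOne (fun w => (⟨δ w, h.frame (hx w)⟩ : FrameBundle n (kerDistribution α))) u v := hv
  rw [tautNegOne, dif_pos hv']
  change h.negOneEquiv (δ u) (t u) _ = _
  rw [h.negOneEquiv_apply, ← S.solderEquiv_mfderiv]
  refine congrArg (S.solderEquiv (t u)) ?_
  have c1 := mfderiv_comp u (S.smooth_proj.mdifferentiableAt (by simp) :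
    MDifferentiableAt (𝓡 p₀) (𝓡 (2 * n)) S.proj (t u)) (ht.mdifferentiableAt (by simp))
  have c2 := mfderiv_comp u (B.smooth_proj.mdifferentiableAt (by simp) :
    MDifferentiableAt (𝓡 (2 * n + 1)) (𝓡 (2 * n)) B.proj (δ u)) (hδ.mdifferentiableAt (by simp))
  have c3 : S.proj ∘ t = B.proj ∘ δ := funext fun u => (hx u).symm
  rw [c3] at c1
  exact congrArg (fun L => L v) (c2.symm.trans c1)

/-- A vector field over the Reeb field which is vertical for the map to `𝒢₀` preserves the
tautological forms: `θ₋₂` is a function on `𝒢₀` times the pullback of `α`, and `θ₋₁` is the restriction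
of the pullback of `θ`. -/
theorem isSymmetryLift {K : Type} [Group K] [EmbeddedGroup K] (h : IsContactConnection S B α Ω)
    (hn : 0 < n) (hδ : ContMDiff (𝓡 p) (𝓡 (2 * n + 1)) ∞ δ) (ht : ContMDiff (𝓡 p) (𝓡 p₀) ∞ t)
    (hx : ∀ u, B.proj (δ u) = S.proj (t u)) {L : PrincipalBundle K p Q (2 * n + 1) N}
    (hL : L.proj = δ) {ξ₀ : VField p Q} (hξ : SmoothVFieldOn ξ₀ univ)
    (hequiv : ∀ u k, mfderiv (𝓡 p) (𝓡 p) (fun w => L.act w k) u (ξ₀ u) = ξ₀ (L.act u k))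
    (hξδ : ∀ u, mfderiv (𝓡 p) (𝓡 (2 * n + 1)) δ u (ξ₀ u) = B.fundamentalField (δ u))
    (hξt : ∀ u, mfderiv (𝓡 p) (𝓡 p₀) t u (ξ₀ u) = 0) :
    IsSymmetryLift L (fun w => (⟨δ w, h.frame (hx w)⟩ : FrameBundle n (kerDistribution α)))
      B.fundamentalField ξ₀ := by
  subst hL
  -- Cartan's formula for `α`, with `dα(ξ, ·) = 0` and `α(ξ) = 1`.
  have hα : ∀ (U : Set Q) (Y : VField p Q), IsOpen U → SmoothVFieldOn Y U → ∀ u ∈ U,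
      MDifferentiableAt (𝓡 p) 𝓘(ℝ, ℝ)
        (fun w => α (L.proj w) (mfderiv (𝓡 p) (𝓡 (2 * n + 1)) L.proj w (Y w))) u ∧
      dirDeriv p (fun w => α (L.proj w) (mfderiv (𝓡 p) (𝓡 (2 * n + 1)) L.proj w (Y w))) u (ξ₀ u) =
        α (L.proj u) (mfderiv (𝓡 p) (𝓡 (2 * n + 1)) L.proj u
          (VectorField.mlieBracket (𝓡 p) ξ₀ Y u)) := by
    intro U Y hU hY u hu
    have h1 := extD_toForm_apply_map h.connection.1 hδ (hξ.mdifferentiableAt isOpen_univ (mem_univ u))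
      (hY.mdifferentiableAt hU hu)
    refine ⟨h1.1, ?_⟩
    have h2 : dirDeriv p (fun w => α (L.proj w) (mfderiv (𝓡 p) (𝓡 (2 * n + 1)) L.proj w (ξ₀ w))) u
        (Y u) = 0 := dirDeriv_eq_zero (c := 1) (Eventually.of_forall fun w =>
          (congrArg (α (L.proj w)) (hξδ w)).trans (h.connection.apply_fundamentalField _)) _
    have h3 : extD (toForm α) (L.proj u) ![mfderiv (𝓡 p) (𝓡 (2 * n + 1)) L.proj u (ξ₀ u),
        mfderiv (𝓡 p) (𝓡 (2 * n + 1)) L.proj u (Y u)] = 0 :=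
      (congrArg (fun v => extD (toForm α) (L.proj u) ![v,
        mfderiv (𝓡 p) (𝓡 (2 * n + 1)) L.proj u (Y u)]) (hξδ u)).trans ((h.isReebField _).2 _)
    have h4 := h3.symm.trans h1.2
    rw [h2] at h4
    linarith
  refine ⟨hξ, hequiv, hξδ, fun U Y hU hY u hu i j => ?_, fun U Y hU hY hYT u hu => ?_⟩
  · obtain ⟨h1, h2⟩ := hα U Y hU hY u hu
    -- The entry of `θ₋₂` is the pullback of `α` times `κ ∘ t`, which is constant along `ξ₀`.
    let κ : P₀ → ℝ := fun w =>
      (!![0, 1; -1, 0] : Matrix (Fin 2) (Fin 2) ℝ) i j / (-h.parallel.2.1.factor w)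
    have hκ : MDifferentiableAt (𝓡 p₀) 𝓘(ℝ, ℝ) κ (t u) := by
      have h3 := (h.parallel.2.1.contMDiff_factor hn h.parallel.1).contMDiffAt (x := t u)
      have h4 : ContMDiffAt (𝓡 p₀) 𝓘(ℝ, ℝ) ∞ κ (t u) := by
        have h5 := (contMDiffAt_const (I := 𝓡 p₀) (I' := 𝓘(ℝ, ℝ)) (n := ∞) (x := t u)
          (c := (!![0, 1; -1, 0] : Matrix (Fin 2) (Fin 2) ℝ) i j)).mul
            (h3.neg.inv₀ (neg_ne_zero.2 (h.factor_ne_zero (t u))))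
        refine h5.congr_of_eventuallyEq (Eventually.of_forall fun w => ?_)
        exact div_eq_mul_inv _ _
      exact h4.mdifferentiableAt (by simp)
    have htd : MDifferentiableAt (𝓡 p) (𝓡 p₀) t u := ht.mdifferentiableAt (by simp)
    have hκt := mfderiv_comp u hκ htd
    have h3 : dirDeriv p (κ ∘ t) u (ξ₀ u) = 0 :=
      (congrArg (fun L => L (ξ₀ u)) hκt).trans
        ((congrArg (mfderiv (𝓡 p₀) 𝓘(ℝ, ℝ) κ (t u)) (hξt u)).trans (map_zero _))
    have h4 := h1.hasMFDerivAt.mul (hκ.comp u htd).hasMFDerivAt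
    have h5 : (fun w => (tautNegTwo (fun w => (⟨L.proj w, h.frame (hx w)⟩ :
        FrameBundle n (kerDistribution α))) w (Y w)).1 i j) =
        (fun w => α (L.proj w) (mfderiv (𝓡 p) (𝓡 (2 * n + 1)) L.proj w (Y w))) * (κ ∘ t) :=
      funext fun w => h.negTwoEquiv_symm_apply _ _ _ i j
    rw [h5, h4.mfderiv]
    refine Eq.trans ?_ (h.negTwoEquiv_symm_apply _ _ _ i j).symm
    rw [← h2]
    change α (L.proj u) _ * dirDeriv p (κ ∘ t) u (ξ₀ u) + κ (t u) * dirDeriv p _ u (ξ₀ u) = _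
    rw [h3]
    change _ = _ * κ (t u)
    ring
  · obtain ⟨h1, h2⟩ := hα U Y hU hY u hu
    have hT : α (L.proj u) (mfderiv (𝓡 p) (𝓡 (2 * n + 1)) L.proj u
        (VectorField.mlieBracket (𝓡 p) ξ₀ Y u)) = 0 := by
      rw [← h2]
      refine dirDeriv_eq_zero (c := 0) ?_ _
      filter_upwards [hU.mem_nhds hu] with w hw using hYT w hw
    refine ⟨hT, fun i j => ?_⟩
    -- Cartan's formula for the entries of `θ`, along `t` and with `Tt(ξ₀) = 0`.
    have h3 := (extD_toForm_apply_map (S.smoothFormOn_solderEntry i j) ht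
      (hξ.mdifferentiableAt isOpen_univ (mem_univ u)) (hY.mdifferentiableAt hU hu)).2
    have h4 : dirDeriv p (fun w => S.solderEntry i j (t w) (mfderiv (𝓡 p) (𝓡 p₀) t w (ξ₀ w))) u
        (Y u) = 0 := dirDeriv_eq_zero (c := 0) (Eventually.of_forall fun w =>
          (congrArg (S.solderEntry i j (t w)) (hξt w)).trans (map_zero _)) _
    have h5 : extD (toForm (S.solderEntry i j)) (t u) ![mfderiv (𝓡 p) (𝓡 p₀) t u (ξ₀ u),
        mfderiv (𝓡 p) (𝓡 p₀) t u (Y u)] = 0 :=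
      (extD (toForm (S.solderEntry i j)) (t u)).map_coord_zero 0 (hξt u)
    have h6 := h5.symm.trans h3
    rw [h4] at h6
    rw [h.tautNegOne_frame hδ ht hx hT]
    have h7 : (fun w => tautNegOne (fun w => (⟨L.proj w, h.frame (hx w)⟩ :
        FrameBundle n (kerDistribution α))) w (Y w) i j) =ᶠ[𝓝 u]
        fun w => S.solderEntry i j (t w) (mfderiv (𝓡 p) (𝓡 p₀) t w (Y w)) := by
      filter_upwards [hU.mem_nhds hu] with w hw
      rw [h.tautNegOne_frame hδ ht hx (hYT w hw)]
      rfl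
    rw [h7.mfderiv_eq]
    change dirDeriv p _ u (ξ₀ u) = S.solderEntry i j (t u) _
    linarith

end IsContactConnection

end Symmetry

/-! ### The flow over the Reeb flow and the quotient -/

section Quotient

open Set Filter Topology

variable {n p₀ p p' pc e d : ℕ} {P₀ P P' Pc Q N M : Type*} [TopologicalSpace P₀]
  [ChartedSpace (EuclideanSpace ℝ (Fin p₀)) P₀] [IsManifold (𝓡 p₀) ∞ P₀]
  [TopologicalSpace Q] [ChartedSpace (EuclideanSpace ℝ (Fin p)) Q] [IsManifold (𝓡 p) ∞ Q]

section Generator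

variable [TopologicalSpace N] [ChartedSpace (EuclideanSpace ℝ (Fin e)) N]

/-- The generator `d/ds Φ(s, x)` at `s = 0` of a one-parameter family `Φ` of maps. -/
noncomputable def flowGenerator (Φ : ℝ → Q → Q) : VField p Q := fun x =>
  (mfderiv 𝓘(ℝ, ℝ) (𝓡 p) (fun s => Φ s x) 0 (1 : ℝ) : EuclideanSpace ℝ (Fin p))

omit [IsManifold (𝓡 p) ∞ Q] in
theorem mfderiv_flowGenerator {Φ : ℝ → Q → Q}
    (hΦ : ContMDiff (𝓘(ℝ, ℝ).prod (𝓡 p)) (𝓡 p) ∞ (fun y : ℝ × Q => Φ y.1 y.2))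
    (h0 : ∀ x, Φ 0 x = x) {f : Q → N} (hf : ContMDiff (𝓡 p) (𝓡 e) ∞ f) (x : Q) :
    (mfderiv (𝓡 p) (𝓡 e) f x (flowGenerator Φ x) : EuclideanSpace ℝ (Fin e)) =
      mfderiv 𝓘(ℝ, ℝ) (𝓡 e) (fun s => f (Φ s x)) 0 (1 : ℝ) := by
  have d1 : MDifferentiableAt 𝓘(ℝ, ℝ) (𝓡 p) (fun s => Φ s x) 0 :=
    (hΦ.comp (contMDiff_id.prodMk contMDiff_const) :
      ContMDiff 𝓘(ℝ, ℝ) (𝓡 p) ∞ (fun s => Φ s x)).mdifferentiableAt (by simp)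
  have key : ∀ y, Φ 0 x = y →
      (mfderiv (𝓡 p) (𝓡 e) f y (flowGenerator Φ x : EuclideanSpace ℝ (Fin p)) :
        EuclideanSpace ℝ (Fin e)) = mfderiv 𝓘(ℝ, ℝ) (𝓡 e) (fun s => f (Φ s x)) 0 (1 : ℝ) := by
    rintro _ rfl
    have h1 := mfderiv_comp (0 : ℝ) (hf.mdifferentiableAt (by simp) :
      MDifferentiableAt (𝓡 p) (𝓡 e) f (Φ 0 x)) d1
    exact (congrArg (fun L => L (1 : ℝ)) h1).symm
  exact key x (h0 x)

end Generator

section Flows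

variable [TopologicalSpace N] [ChartedSpace (EuclideanSpace ℝ (Fin e)) N] [IsManifold (𝓡 e) ∞ N]
  [TopologicalSpace M] [ChartedSpace (EuclideanSpace ℝ (Fin d)) M]
  {B : PrincipalBundle Circle e N d M} {δ : Q → N} {t : Q → P₀}

variable (p B δ t) in
/-- `Φ` is a smooth one-parameter family of maps of `Q`, starting at the identity, which covers the flow
of the circle action on `N` and preserves the map `t`. -/
structure IsFlowOver (Φ : ℝ → Q → Q) : Prop where
  smooth : ContMDiff (𝓘(ℝ, ℝ).prod (𝓡 p)) (𝓡 p) ∞ (fun y : ℝ × Q => Φ y.1 y.2)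
  zero : ∀ u, Φ 0 u = u
  fst : ∀ s u, δ (Φ s u) = B.act (δ u) (Circle.exp s)
  snd : ∀ s u, t (Φ s u) = t u

omit [IsManifold (𝓡 p₀) ∞ P₀] [IsManifold (𝓡 p) ∞ Q] in
/-- On the fibre product, the circle acts on the factor `N`. -/
theorem IsFibreProduct.exists_isFlowOver {π : P₀ → M} (h : IsFibreProduct p e p₀ δ t B.proj π) :
    ∃ Φ : ℝ → Q → Q, IsFlowOver p B δ t Φ := by
  choose Φ hΦ using fun (s : ℝ) (u : Q) => h.surj (B.act (δ u) (Circle.exp s)) (t u)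
    ((B.proj_act _ _).trans (h.comm u))
  refine ⟨Φ, h.contMDiff ?_ ?_, fun u => h.inj _ _ ?_ (hΦ 0 u).2, fun s u => (hΦ s u).1,
    fun s u => (hΦ s u).2⟩
  · refine (B.contMDiff_act_circleExp.comp
      (contMDiff_fst.prodMk (h.smooth_fst.comp contMDiff_snd))).congr fun y => ?_
    exact (hΦ y.1 y.2).1
  · exact (h.smooth_snd.comp contMDiff_snd).congr fun y => (hΦ y.1 y.2).2
  · rw [(hΦ 0 u).1, B.act_circleExp_zero]

omit [IsManifold (𝓡 p₀) ∞ P₀] [IsManifold (𝓡 e) ∞ N] in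
/-- On `𝒢₀ᶜ`, the flow over the circle action is given by the central one-parameter group
`⟨exp(is/2), 1⟩` of `Spinᶜ(n)`. -/
theorem exists_isFlowOver_gZeroC {Bc : PrincipalBundle (GZeroC n) p Q d M}
    {S : PrincipalBundle (GZero n) p₀ P₀ d M} (ht : IsBundleMap Bc S (gCToG n) id t)
    (hδ : IsBundleMap Bc B (gCDet n) id δ) : ∃ Φ : ℝ → Q → Q, IsFlowOver p B δ t Φ ∧
      ∀ s u g, Φ s (Bc.act u (gSpinToGC n g)) = Bc.act (Φ s u) (gSpinToGC n g) := by
  let z : ℝ → GZeroC n := fun s => (1, QuotientGroup.mk (Circle.exp (s / 2), 1))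
  have hz1 : ∀ s, gCDet n (z s) = Circle.exp s := fun s => by
    change Circle.exp (s / 2) ^ 2 = _
    rw [sq, ← Circle.exp_add, add_halves]
  have hz2 : ∀ s, gCToG n (z s) = 1 := fun s => Prod.ext rfl (map_one (spinRho n))
  have hz3 : ∀ s g, z s * gSpinToGC n g = gSpinToGC n g * z s := by
    rintro s ⟨A, a⟩
    refine Prod.ext ((one_mul A).trans (mul_one A).symm) ?_
    have h1 : ((Circle.exp (s / 2), 1) * (1, a) : Circle × Spin n) = (1, a) * (Circle.exp (s / 2), 1) :=
      Prod.ext (mul_comm _ _) ((one_mul a).trans (mul_one a).symm)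
    exact congrArg (fun y => (QuotientGroup.mk y : SpinC n)) h1
  refine ⟨fun s u => Bc.act u (z s), ⟨?_, fun u => ?_, fun s u => ?_, fun s u => ?_⟩, fun s u g => ?_⟩
  · refine contMDiffOn_univ.1 (Bc.contMDiffOn_act isOpen_univ contMDiffOn_snd ?_)
    refine (gSmoothOn_const 1 univ).prodMk (gSmoothOn_spinC (gSmoothOn_circleExp ?_)
      (gSmoothOn_const 1 univ))
    exact (contDiff_id.div_const 2).contMDiff.comp_contMDiffOn contMDiffOn_fst
  · have h1 : z 0 = 1 := by
      refine Prod.ext rfl ?_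
      change (QuotientGroup.mk (Circle.exp (0 / 2), 1) : SpinC n) = _
      rw [zero_div, Circle.exp_zero]
      rfl
    rw [h1, Bc.act_one]
  · rw [hδ.equivariant, hz1]
  · rw [ht.equivariant, hz2, S.act_one]
  · change Bc.act (Bc.act u (gSpinToGC n g)) (z s) = Bc.act (Bc.act u (z s)) (gSpinToGC n g)
    rw [← Bc.act_mul, ← Bc.act_mul, hz3]

end Flows

variable [TopologicalSpace N] [ChartedSpace (EuclideanSpace ℝ (Fin (2 * n + 1))) N]
  [TopologicalSpace M] [ChartedSpace (EuclideanSpace ℝ (Fin (2 * n))) M]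
  [IsManifold (𝓡 (2 * n)) ∞ M] [IsManifold (𝓡 (2 * n + 1)) ∞ N]
  [TopologicalSpace P'] [ChartedSpace (EuclideanSpace ℝ (Fin p')) P'] [IsManifold (𝓡 p') ∞ P']
  {S : PACSStructure n p₀ P₀ M} {B : PrincipalBundle Circle (2 * n + 1) N (2 * n) M}
  {α : OneForm (2 * n + 1) N} {Ω : DForm (2 * n) M 2} {δ : Q → N} {t : Q → P₀}

omit [IsManifold (𝓡 p) ∞ Q] [IsManifold (𝓡 (2 * n)) ∞ M] [IsManifold (𝓡 (2 * n + 1)) ∞ N] [IsManifold (𝓡 p₀) ∞ P₀]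
  [ChartedSpace (EuclideanSpace ℝ (Fin p₀)) P₀] [TopologicalSpace P₀] in
theorem IsFlowOver.mfderiv_fst {Φ : ℝ → Q → Q} (h : IsFlowOver p B δ t Φ)
    (hδ : ContMDiff (𝓡 p) (𝓡 (2 * n + 1)) ∞ δ) (u : Q) :
    mfderiv (𝓡 p) (𝓡 (2 * n + 1)) δ u (flowGenerator Φ u) = B.fundamentalField (δ u) := by
  refine (mfderiv_flowGenerator h.smooth h.zero hδ u).trans ?_
  have key : ∀ f : ℝ → N, f = (fun s => B.act (δ u) (Circle.exp s)) →
      (mfderiv 𝓘(ℝ, ℝ) (𝓡 (2 * n + 1)) f 0 (1 : ℝ) : EuclideanSpace ℝ (Fin (2 * n + 1))) =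
        B.fundamentalField (δ u) := by
    rintro _ rfl
    rfl
  exact key _ (funext fun s => h.fst s u)

omit [IsManifold (𝓡 p) ∞ Q] [IsManifold (𝓡 (2 * n)) ∞ M] [IsManifold (𝓡 (2 * n + 1)) ∞ N]
  [IsManifold (𝓡 p₀) ∞ P₀] in
theorem IsFlowOver.mfderiv_snd {Φ : ℝ → Q → Q} (h : IsFlowOver p B δ t Φ)
    (ht : ContMDiff (𝓡 p) (𝓡 p₀) ∞ t) (u : Q) :
    mfderiv (𝓡 p) (𝓡 p₀) t u (flowGenerator Φ u) = 0 := by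
  refine (mfderiv_flowGenerator h.smooth h.zero ht u).trans ?_
  have key : ∀ f : ℝ → P₀, f = (fun _ => t u) →
      (mfderiv 𝓘(ℝ, ℝ) (𝓡 p₀) f 0 (1 : ℝ) : EuclideanSpace ℝ (Fin p₀)) = 0 := by
    rintro _ rfl
    rw [mfderiv_const]
    rfl
  exact key _ (funext fun s => h.snd s u)

namespace IsContactConnection

/-- The generator of a family over the Reeb flow which commutes with the principal action is a lift of the
Reeb field to an infinitesimal symmetry. -/
theorem isSymmetryLift_flowGenerator {K : Type} [Group K] [EmbeddedGroup K]
    (h : IsContactConnection S B α Ω) (hn : 0 < n) (hδ : ContMDiff (𝓡 p) (𝓡 (2 * n + 1)) ∞ δ)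
    (ht : ContMDiff (𝓡 p) (𝓡 p₀) ∞ t) (hx : ∀ u, B.proj (δ u) = S.proj (t u))
    {L : PrincipalBundle K p Q (2 * n + 1) N} (hL : L.proj = δ) {Φ : ℝ → Q → Q}
    (hΦ : IsFlowOver p B δ t Φ) (hact : ∀ s u k, Φ s (L.act u k) = L.act (Φ s u) k) :
    IsSymmetryLift L (fun w => (⟨δ w, h.frame (hx w)⟩ : FrameBundle n (kerDistribution α)))
      B.fundamentalField (flowGenerator Φ) := by
  refine h.isSymmetryLift hn hδ ht hx hL (contMDiff_generator hΦ.smooth hΦ.zero).contMDiffOn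
    (fun u k => ?_) (hΦ.mfderiv_fst hδ) (hΦ.mfderiv_snd ht)
  refine (mfderiv_flowGenerator hΦ.smooth hΦ.zero (L.contMDiff_act_const k) u).trans ?_
  have key : ∀ f : ℝ → Q, f = (fun s => Φ s (L.act u k)) → (mfderiv 𝓘(ℝ, ℝ) (𝓡 p) f 0 (1 : ℝ) :
      EuclideanSpace ℝ (Fin p)) = flowGenerator Φ (L.act u k) := by
    rintro _ rfl
    rfl
  exact key _ (funext fun s => (hact s u k).symm)

omit [IsManifold (𝓡 (2 * n)) ∞ M] in
theorem isTransversalSymmetry {K : Type} [Group K] [EmbeddedGroup K]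
    (h : IsContactConnection S B α Ω) {L : PrincipalBundle K p Q (2 * n + 1) N}
    {F : Q → FrameBundle n (kerDistribution α)} {ξ₀ : VField p Q}
    (hξ : IsSymmetryLift L F B.fundamentalField ξ₀) :
    IsTransversalSymmetry L F B.fundamentalField := by
  refine ⟨B.smooth_fundamentalField, ⟨ξ₀, hξ⟩, fun x hx => ?_⟩
  exact one_ne_zero ((h.connection.apply_fundamentalField x).symm.trans hx)

/-- The projection from the fibre product to `𝒢₀` is a PCS-quotient by the Reeb field. -/
theorem isPCSQuotient (h : IsContactConnection S B α Ω) (hn : 0 < n)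
    (hF : IsFibreProduct p (2 * n + 1) p₀ δ t B.proj S.proj) :
    IsPCSQuotient (h.lieContactStructure hn hF) B.fundamentalField S B.proj t := by
  obtain ⟨Φ, hΦ⟩ := hF.exists_isFlowOver
  have hproj : ∀ u g, δ ((hF.bundle B.smooth_proj).act u g) = δ u :=
    (hF.bundle B.smooth_proj).proj_act
  have hξ : IsSymmetryLift (hF.bundle B.smooth_proj)
      (fun w => (⟨δ w, h.frame (hF.comm w)⟩ : FrameBundle n (kerDistribution α)))
      B.fundamentalField (flowGenerator Φ) := by
    refine h.isSymmetryLift_flowGenerator hn hF.smooth_fst hF.smooth_snd hF.comm rfl hΦ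
      fun s u g => hF.inj _ _ ?_ ?_
    · rw [hΦ.fst, hproj, hproj, hΦ.fst]
    · rw [hΦ.snd, hF.snd_act, hF.snd_act, hΦ.snd]
  have hsurj : Function.Surjective t := fun w => by
    obtain ⟨x, hx⟩ := B.surjective_proj (S.proj w)
    obtain ⟨u, -, hu⟩ := hF.surj x w hx
    exact ⟨u, hu⟩
  refine ⟨h.isTransversalSymmetry hξ, hF.isBundleMap B.smooth_proj, hsurj, fun w => ?_,
    ⟨_, hξ, fun u => ?_⟩, fun u v hv => (h.tautNegOne_frame hF.smooth_fst hF.smooth_snd hF.comm hv).symm⟩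
  · -- The fibres are the orbits of the flow.
    obtain ⟨u₀, rfl⟩ := hsurj w
    have h1 : t ⁻¹' {t u₀} = range fun s => Φ s u₀ := by
      ext u
      refine ⟨fun hu => ?_, ?_⟩
      · have hu' : t u = t u₀ := hu
        obtain ⟨z, hz, -⟩ := B.existsUnique_act (δ u₀) (δ u) (by rw [hF.comm, hF.comm, hu'])
        refine ⟨Complex.arg z, hF.inj _ _ ?_ ((hΦ.snd _ _).trans hu'.symm)⟩
        rw [hΦ.fst, Circle.exp_arg, hz]
      · rintro ⟨s, rfl⟩
        exact hΦ.snd s u₀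
    rw [h1]
    exact isConnected_range (hΦ.smooth.continuous.comp (continuous_id.prodMk continuous_const))
  · refine le_antisymm (fun v hv => ?_) ?_
    · have hv' : mfderiv (𝓡 p) (𝓡 p₀) t u v = 0 := hv
      let D : EuclideanSpace ℝ (Fin p) →L[ℝ] EuclideanSpace ℝ (Fin (2 * n + 1)) :=
        mfderiv (𝓡 p) (𝓡 (2 * n + 1)) δ u
      let v₀ : EuclideanSpace ℝ (Fin p) := v
      let x₀ : EuclideanSpace ℝ (Fin p) := flowGenerator Φ u
      have hD : D x₀ = B.fundamentalField (δ u) := hΦ.mfderiv_fst hF.smooth_fst u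
      have hq : mfderiv (𝓡 (2 * n + 1)) (𝓡 (2 * n)) B.proj (δ u) (D v₀) = 0 := by
        have c1 := mfderiv_comp u (S.smooth_proj.mdifferentiableAt (by simp) :
          MDifferentiableAt (𝓡 p₀) (𝓡 (2 * n)) S.proj (t u))
          (hF.smooth_snd.mdifferentiableAt (by simp))
        have c2 := mfderiv_comp u (B.smooth_proj.mdifferentiableAt (by simp) :
          MDifferentiableAt (𝓡 (2 * n + 1)) (𝓡 (2 * n)) B.proj (δ u))
          (hF.smooth_fst.mdifferentiableAt (by simp))
        have c3 : S.proj ∘ t = B.proj ∘ δ := funext fun u => (hF.comm u).symm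
        rw [c3] at c1
        refine (congrArg (fun L => L v) (c2.symm.trans c1)).trans ?_
        exact (congrArg (mfderiv (𝓡 p₀) (𝓡 (2 * n)) S.proj (t u)) hv').trans (map_zero _)
      -- `v₀ - a x₀` is annihilated by the derivatives of both components.
      let a : ℝ := α (δ u) (D v₀)
      have h1 : D (v₀ - a • x₀) = 0 := by
        rw [map_sub, map_smul, hD]
        refine h.eq_zero_of (x := δ u) ?_ ?_
        · refine (map_sub (α (δ u)) _ _).trans ?_
          refine (congrArg (fun r => a - r) (map_smul (α (δ u)) a _)).trans ?_
          rw [h.connection.apply_fundamentalField, smul_eq_mul, mul_one, sub_self]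
        · refine (map_sub (mfderiv (𝓡 (2 * n + 1)) (𝓡 (2 * n)) B.proj (δ u)) _ _).trans ?_
          refine (congrArg₂ (fun r r' : EuclideanSpace ℝ (Fin (2 * n)) => r - r') hq
            (map_smul (mfderiv (𝓡 (2 * n + 1)) (𝓡 (2 * n)) B.proj (δ u)) a _)).trans ?_
          refine (zero_sub _).trans (neg_eq_zero.2 ?_)
          exact (congrArg (fun r : EuclideanSpace ℝ (Fin (2 * n)) => a • r)
            (B.mfderiv_proj_fundamentalField (δ u))).trans (smul_zero a)
      have h2 : mfderiv (𝓡 p) (𝓡 p₀) t u (v₀ - a • x₀) = 0 := by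
        refine (map_sub (mfderiv (𝓡 p) (𝓡 p₀) t u) _ _).trans ?_
        refine (congrArg₂ (fun r r' : EuclideanSpace ℝ (Fin p₀) => r - r') hv'
          (map_smul (mfderiv (𝓡 p) (𝓡 p₀) t u) a _)).trans ?_
        refine (zero_sub _).trans (neg_eq_zero.2 ?_)
        exact (congrArg (fun r : EuclideanSpace ℝ (Fin p₀) => a • r)
          (hΦ.mfderiv_snd hF.smooth_snd u)).trans (smul_zero a)
      exact Submodule.mem_span_singleton.2 ⟨a, (sub_eq_zero.1 (hF.mfderiv_eq_zero h1 h2)).symm⟩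
    · rw [Submodule.span_singleton_le_iff_mem]
      exact hΦ.mfderiv_snd hF.smooth_snd u

omit [IsManifold (𝓡 p) ∞ Q] in
/-- A Lie contact structure is determined by a PCS-quotient: both total spaces are the fibre product
of `N` and `𝒢₀` over `M`, and the frames are determined by `α` and `θ`. -/
theorem existsUnique_isLieContactIso (h : IsContactConnection S B α Ω) (hn : 0 < n)
    (hF : IsFibreProduct p (2 * n + 1) p₀ δ t B.proj S.proj)
    {L' : LieContactStructure n p' P' (kerDistribution α)} {q₀' : P' → P₀} {ξ : VField (2 * n + 1) N}
    (hL' : IsPCSQuotient L' ξ S B.proj q₀') :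
    ∃! f : Diffeomorph (𝓡 p) (𝓡 p') Q P' ∞,
      IsLieContactIso (h.lieContactStructure hn hF) L' f ∧ ∀ u, q₀' (f u) = t u := by
  have hF' := hL'.bundleMap.isFibreProduct B.smooth_proj.continuous
  obtain ⟨f, hf⟩ := hF.exists_diffeomorph hF'
  refine ⟨f, ⟨⟨fun u g => hF'.inj _ _ ?_ ?_, fun u => ?_⟩, fun u => (hf u).2⟩, ?_⟩
  · rw [(hf _).1, L'.proj_act, (hf _).1]
    exact (hF.bundle B.smooth_proj).proj_act u g
  · rw [(hf _).2, hL'.bundleMap.equivariant, (hf _).2]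
    exact hF.snd_act B.smooth_proj u g
  · rw [h.frame_eq_of_isPCSQuotient hn hL' (f u) (hf u).1
      ((hF.comm u).trans (congrArg S.proj (hf u).2.symm))]
    exact h.frame_congr _ _ rfl (hf u).2
  · rintro g ⟨hg, hgq⟩
    refine Diffeomorph.ext fun u => hF'.inj _ _ ?_ ((hgq u).trans (hf u).2.symm)
    rw [(hf u).1, ← L'.reduction.fst_eq, hg.2 u]
    rfl

end IsContactConnection

end Quotient

/-! ### The induced Lie contact structure -/

theorem mainTheorem3 {n : ℕ} (hn : 3 ≤ n)
    {M : Type*} [TopologicalSpace M] [T2Space M] [SecondCountableTopology M] [ConnectedSpace M]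
    [ChartedSpace (EuclideanSpace ℝ (Fin (2 * n))) M] [IsManifold (𝓡 (2 * n)) ∞ M]
    {p₀ : ℕ} {P₀ : Type*} [TopologicalSpace P₀] [ChartedSpace (EuclideanSpace ℝ (Fin p₀)) P₀]
    [IsManifold (𝓡 p₀) ∞ P₀] (S : PACSStructure n p₀ P₀ M) (hS : S.IsPCS)
    {pc : ℕ} {Pc : Type w} [TopologicalSpace Pc] [ChartedSpace (EuclideanSpace ℝ (Fin pc)) Pc]
    [IsManifold (𝓡 pc) ∞ Pc] (Bc : PrincipalBundle (GZeroC n) pc Pc (2 * n) M)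
    (t : Pc → P₀) (ht : IsGCLift Bc S t)
    {N : Type*} [TopologicalSpace N] [ChartedSpace (EuclideanSpace ℝ (Fin (2 * n + 1))) N]
    [IsManifold (𝓡 (2 * n + 1)) ∞ N] (B : PrincipalBundle Circle (2 * n + 1) N (2 * n) M)
    (δ : Pc → N) (hδ : IsDeterminantBundle Bc B δ)
    (α : OneForm (2 * n + 1) N) (hα : IsCompatibleConnection S B α)
    (hc : (0 : DForm (2 * n) M 2) ∉ B.chernClass) :
    IsContactForm α ∧
    ∃ ξ : VField (2 * n + 1) N, IsReebField α ξ ∧ (∀ ξ', IsReebField α ξ' → ξ' = ξ) ∧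
    ∃ (P : Type w) (_ : TopologicalSpace P) (_ : ChartedSpace (EuclideanSpace ℝ (Fin pc)) P)
      (_ : IsManifold (𝓡 pc) ∞ P)
      (L : SpinLieContactStructure n pc P (kerDistribution α) pc Pc) (q₀ : P → P₀),
      IsInducedLieContact Bc S t B δ ξ L q₀ ∧
      (∀ (p' : ℕ) (P' : Type w) [TopologicalSpace P'] [ChartedSpace (EuclideanSpace ℝ (Fin p')) P']
        [IsManifold (𝓡 p') ∞ P'] (L' : SpinLieContactStructure n p' P' (kerDistribution α) pc Pc)
        (q₀' : P' → P₀), IsInducedLieContact Bc S t B δ ξ L' q₀' →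
        ∃! f : Diffeomorph (𝓡 pc) (𝓡 p') P P' ∞,
          IsLieContactIso L.base L'.base f ∧ ∀ u, f (L.lift u) = L'.lift u) ∧
      ∀ (p' : ℕ) (P' : Type w) [TopologicalSpace P'] [ChartedSpace (EuclideanSpace ℝ (Fin p')) P']
        [IsManifold (𝓡 p') ∞ P'] (L' : LieContactStructure n p' P' (kerDistribution α))
        (q₀' : P' → P₀), IsPCSQuotient L' ξ S B.proj q₀' →
        ∃! f : Diffeomorph (𝓡 pc) (𝓡 p') P P' ∞,
          IsLieContactIso L.base L' f ∧ ∀ u, q₀' (f u) = q₀ u := by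
  have hn0 : 0 < n := by omega
  obtain ⟨Ω, hΩ, hdα⟩ := hα.2
  have h : IsContactConnection S B α Ω :=
    ⟨hα.1, hΩ, hdα, hΩ.ne_zero (by omega) hS hα.1 hdα hc⟩
  refine ⟨h.isContactForm, B.fundamentalField, h.isReebField, fun ξ' => h.isReebField_unique, ?_⟩
  obtain ⟨P, _, _, _, π, δ', q₀, hF, hπ, hπs, hπδ, hπt⟩ := exists_isFibreProduct hn0 ht hδ
  obtain ⟨Lb, hLb, hLact⟩ := exists_spin_bundle hn0 hδ
  let L : SpinLieContactStructure n pc P (kerDistribution α) pc Pc :=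
    { base := h.lieContactStructure hn0 hF
      bundle := Lb
      lift := π
      isLift :=
        { smooth := hπ
          covers := fun u => (hπδ u).trans (congrFun hLb u).symm
          equivariant := fun u g => by
            refine hF.inj _ _ ?_ ?_
            · refine Eq.trans ?_ ((hF.bundle B.smooth_proj).proj_act (π u) (gSpinToG n g)).symm
              refine (hπδ _).trans (Eq.trans ?_ (hπδ u).symm)
              rw [← hLb, Lb.proj_act]
            · refine Eq.trans ?_ (hF.snd_act B.smooth_proj (π u) (gSpinToG n g)).symm
              rw [hπt, hπt, hLact, ht.equivariant, gCToG_gSpinToGC] } }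
  have hind : IsInducedLieContact Bc S t B δ B.fundamentalField L q₀ := by
    refine ⟨hLb, hLact, ?_, h.isPCSQuotient hn0 hF, hπt⟩
    obtain ⟨Φ, hΦ, hact⟩ := exists_isFlowOver_gZeroC ht hδ
    have hx : ∀ u, B.proj (δ u) = S.proj (t u) := fun u => (hδ.covers u).trans (ht.covers u).symm
    have h1 : (fun u => L.base.frame (L.lift u)) =
        fun u => (⟨δ u, h.frame (hx u)⟩ : FrameBundle n (kerDistribution α)) :=
      funext fun u => h.frame_congr _ _ (hπδ u) (hπt u)
    rw [h1]
    refine h.isTransversalSymmetry (h.isSymmetryLift_flowGenerator hn0 hδ.smooth ht.smooth hx hLb hΦ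
      fun s u g => ?_)
    exact (congrArg (Φ s) (hLact u g)).trans ((hact s u g).trans (hLact _ g).symm)
  refine ⟨P, _, _, _, L, q₀, hind, fun p' P' _ _ _ L' q₀' hL' => ?_,
    fun p' P' _ _ _ L' q₀' hL' => h.existsUnique_isLieContactIso hn0 hF hL'⟩
  -- The isomorphism determined by the PCS-quotients is compatible with the maps from `𝒢₀ᶜ`.
  have hF' := hL'.quotient.bundleMap.isFibreProduct B.smooth_proj.continuous
  obtain ⟨f, ⟨hf, hfq⟩, -⟩ := h.existsUnique_isLieContactIso hn0 hF hL'.quotient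
  have hlift : ∀ u, f (L.lift u) = L'.lift u := fun u => by
    refine hF'.inj _ _ ?_ ?_
    · rw [← L'.base.reduction.fst_eq, hf.2, L'.isLift.covers, hL'.proj_eq]
      exact hπδ u
    · rw [hfq, hL'.lift_eq]
      exact hπt u
  -- The map from `𝒢₀ᶜ` is surjective, so this isomorphism is the only one.
  refine ⟨f, ⟨hf, hlift⟩, fun g hg => Diffeomorph.ext fun v => ?_⟩
  obtain ⟨u, rfl⟩ := hπs v
  exact (hg.2 u).trans (hlift u).symm
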